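/- **Model.** Time is divided into slots indexed by $\mathbb N$. There are $n$ identical parties; party $u$ is woken up at a time $t_u$. A (LocalClock, acknowledgment-based) *protocol* is a single probability distribution $\mathcal D$ on infinite bit sequences, not depending on $n$; each party $u$ independently draws $X^{(u)}=(X^{(u)}_1,X^{(u)}_2,\dots)\sim\mathcal D$ and grabs a shared resource in slot $t_u+i$ ($i\ge 1$) iff $X^{(u)}_i=1$ and $u$ has not succeeded earlier. A party succeeds in a slot iff it is the only party that grabs the resource in that slot. The protocol is *memoryless* if the bits $X^{(u)}_1,X^{(u)}_2,\dots$ are independent. The *latency* $L^{(u)}\in\mathbb N\cup\{\infty\}$ of $u$ is $t^{\mathrm{succ}}_u-t_u$, where $t^{\mathrm{succ}}_u$ is the slot in which $u$ succeeds ($\infty$ if there is none). An *oblivious* adversary fixes $(t_u)_{u\in[n]}\in\mathbb N^n$ in advance; an *adaptive* adversary decides at each time $t$, as a function of the bits $X^{(u)}_i$ with $t_u+i\le t$ of the parties $u$ woken up so far, which further parties to wake up at time $t$ (at most $n$ in total; a party that is never woken up has latency $0$). For a class of adversaries let $$L^{\exp}_{\mathcal D}(n)=\sup_{\mathcal A}\max_{u\in[n]}\mathbb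 E\big[L^{(u)}\big],$$ and let $L^{\mathrm{whp}}_{\mathcal D}(n)$ be the least $\ell\in\mathbb N\cup\{\infty\}$ such that $\Pr[L^{(u)}\le \ell]\ge 1-n^{-2}$ for every adversary $\mathcal A$ of the class and every $u\in[n]$. (Here $g=O(f)$ and $g=o(f)$ are meant as $n\to\infty$.) **Theorem.** 1. There is a memoryless protocol $\mathcal D$ with $L^{\mathrm{whp}}_{\mathcal D}(n)=O\!\left(\frac{n\log^2 n}{\log\log n}\right)$ against adaptive adversaries. 2. There is a memoryless protocol $\mathcal D$ with $L^{\exp}_{\mathcal D}(n)=O\!\left(\frac{n\log n}{\log\log n}\right)$ against adaptive adversaries. 3. No memoryless protocol $\mathcal D$ satisfies $L^{\mathrm{whp}}_{\mathcal D}(n)=o\!\left(\frac{n\log^2 n}{\log\log n}\right)$, even against oblivious adversaries. 4. No memoryless protocol $\mathcal D$ satisfies $L^{\exp}_{\mathcal D}(n)=o\!\left(\frac{n\log n}{\log\log n}\right)$, even against oblivious adversaries. -/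

import Mathlib

open MeasureTheory ProbabilityTheory Filter Asymptotics
open scoped ENNReal

namespace ContentionResolution

noncomputable section

/-- An acknowledgment-based protocol in the `LocalClock` model: a probability distribution on
infinite bit sequences `x`. A party that draws `x` tries to grab the resource at local time `k + 1`
(that is, `k + 1` slots after its wake-up time) iff `x k = true` and it has not succeeded before.
The only feedback a party gets or uses is its own success, after which it stops. -/
abbrev LocalClockProtocol := ProbabilityMeasure (ℕ → Bool)

/-- Whether a party grabs at a given local time does not depend on its bits at other local times:
the bits of the sequence are independent (with arbitrary, clock-dependent, probabilities). -/
def IsMemoryless (D : LocalClockProtocol) : Prop :=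
  iIndepFun (fun (k : ℕ) (x : ℕ → Bool) => x k) (D : Measure (ℕ → Bool))

/-- The bit sequences of the `n` parties. -/
abbrev Bits (n : ℕ) := Fin n → ℕ → Bool

/-- The `n` parties draw their bit sequences independently from `D`. -/
def law (D : LocalClockProtocol) (n : ℕ) : Measure (Bits n) :=
  Measure.pi fun _ => (D : Measure (ℕ → Bool))

/-! ### The execution, for given wake-up times `w` (`⊤` for a party that is never woken up) -/

/-- The parties that grab the resource in slot `t`, if `S` is the set of parties that have
succeeded in an earlier slot. -/
def grabbers {n : ℕ} (w : Fin n → ℕ∞) (X : Bits n) (S : Set (Fin n)) (t : ℕ) : Set (Fin n) :=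
  {u | u ∉ S ∧ ∃ k : ℕ, w u + k + 1 = t ∧ X u k = true}

/-- The parties that succeed in one of the slots `0, …, t - 1`. A party succeeds in a slot iff
it is the only one that grabs the resource in this slot. -/
def succeededBefore {n : ℕ} (w : Fin n → ℕ∞) (X : Bits n) : ℕ → Set (Fin n)
  | 0 => ∅
  | t + 1 => succeededBefore w X t ∪ {u | grabbers w X (succeededBefore w X t) t = {u}}

/-- Party `u` succeeds in slot `t`. -/
def SucceedsAt {n : ℕ} (w : Fin n → ℕ∞) (X : Bits n) (t : ℕ) (u : Fin n) : Prop :=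
  grabbers w X (succeededBefore w X t) t = {u}

open Classical in
/-- The latency of party `u`: the time from its wake-up to its (first) success, `⊤` if it is woken
up but never succeeds. A party that is never woken up does not wait: its latency is `0`. -/
def latency {n : ℕ} (w : Fin n → ℕ∞) (X : Bits n) (u : Fin n) : ℕ∞ :=
  if w u = ⊤ then 0
  else ⨅ (l : ℕ) (_ : ∃ t : ℕ, w u + l = t ∧ SucceedsAt w X t u), (l : ℕ∞)

/-! ### Adversaries -/

/-- An oblivious adversary chooses the wake-up times of the `n` parties in advance. -/
abbrev ObliviousAdversary (n : ℕ) := Fin n → ℕ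

/-- What can be observed of an execution: the bits used so far by the parties woken up so far,
and `none` in all other places. -/
abbrev History (n : ℕ) := Fin n → ℕ → Option Bool

open Classical in
/-- The history through slot `t`, for wake-up times `w`: the bit `X u k` belongs to slot
`w u + k + 1`. -/
def history {n : ℕ} (w : Fin n → ℕ∞) (X : Bits n) (t : ℕ) : History n :=
  fun u k => if w u + k + 1 ≤ t then some (X u k) else none

/-- An adaptive adversary decides at each time `t`, from the history through slot `t`, which
parties are to be woken up at time `t` (first local time slot: `t + 1`); parties that are already
awake are unaffected. It wakes up at most `n` parties in total. -/
abbrev AdaptiveAdversary (n : ℕ) := ℕ → History n → Set (Fin n)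

open Classical in
/-- The wake-up times that have been decided at times `0, …, t - 1` (`⊤` if not yet woken up). -/
def wakeBefore {n : ℕ} (A : AdaptiveAdversary n) (X : Bits n) : ℕ → Fin n → ℕ∞
  | 0 => fun _ => ⊤
  | t + 1 => fun u =>
      if wakeBefore A X t u = ⊤ ∧ u ∈ A t (history (wakeBefore A X t) X t) then (t : ℕ∞)
      else wakeBefore A X t u

/-- The wake-up times that the adaptive adversary `A` produces when the parties use the bits `X`. -/
def adaptiveWake (n : ℕ) (A : AdaptiveAdversary n) (X : Bits n) (u : Fin n) : ℕ∞ :=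
  ⨅ t : ℕ, wakeBefore A X t u

/-- The wake-up times under an oblivious adversary do not depend on the bits. -/
def obliviousWake (n : ℕ) (A : ObliviousAdversary n) (_X : Bits n) (u : Fin n) : ℕ∞ :=
  (A u : ℕ∞)

/-! ### Latency metrics

A class of adversaries is given by a type `Adv n` for each `n`, together with the wake-up times
`wake n A X` that the adversary `A : Adv n` produces on the bits `X`. -/

/-- The expected latency with `n` parties: the supremum over all adversaries of the class and all
parties of the expected latency of this party. -/
def expLatency {Adv : ℕ → Type} (wake : ∀ n, Adv n → Bits n → Fin n → ℕ∞)
    (D : LocalClockProtocol) (n : ℕ) : ℝ≥0∞ :=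
  ⨆ (A : Adv n) (u : Fin n), ∫⁻ X, (latency (wake n A X) X u : ℝ≥0∞) ∂(law D n)

/-- The least `l` such that, against each adversary of the class, each of the `n` parties has
latency at most `l` with probability at least `1 - q`. -/
def latencyBound {Adv : ℕ → Type} (wake : ∀ n, Adv n → Bits n → Fin n → ℕ∞)
    (D : LocalClockProtocol) (n : ℕ) (q : ℝ≥0∞) : ℕ∞ :=
  sInf {l : ℕ∞ | ∀ (A : Adv n) (u : Fin n),
    1 - q ≤ law D n {X | latency (wake n A X) X u ≤ l}}

/-- The latency with high probability: the error probability is `n⁻²`. -/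
def whpLatency {Adv : ℕ → Type} (wake : ∀ n, Adv n → Bits n → Fin n → ℕ∞)
    (D : LocalClockProtocol) (n : ℕ) : ℝ≥0∞ :=
  (latencyBound wake D n (((n : ℝ≥0∞) ^ 2)⁻¹) : ℝ≥0∞)

/-- `L = O(f)` for an extended nonnegative function `L`. -/
def IsBigOLatency (L : ℕ → ℝ≥0∞) (f : ℕ → ℝ) : Prop :=
  ∃ g : ℕ → ℝ, g =O[atTop] f ∧ ∀ᶠ n in atTop, L n ≤ ENNReal.ofReal (g n)

/-- `L = o(f)` for an extended nonnegative function `L`. -/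
def IsLittleOLatency (L : ℕ → ℝ≥0∞) (f : ℕ → ℝ) : Prop :=
  ∃ g : ℕ → ℝ, g =o[atTop] f ∧ ∀ᶠ n in atTop, L n ≤ ENNReal.ofReal (g n)

end

end ContentionResolution

namespace ContentionResolution

noncomputable section

/-! Upper bounds. Let the bit probabilities `p k` decrease like `1 / k` (expectation) or `log k / k`
(high probability). Fix a party `u` and call the sum of the current probabilities of the other
parties that have not succeeded the contention of a slot. The first `x` slots of `u` are of three
kinds. Heavy slots, with contention at least `H`, are few: each party contributes at most `P = ∑ k <
x, p k` in total, so there are at most `n P / H` of them. A medium slot, with contention between `1`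
and `H`, produces a success with probability of order at least `exp (-2 H)`; only `n` successes are
possible, so there are `O(n exp (2 H))` medium slots up to a small error. In a light slot `u` itself
succeeds with probability at least `p k / 8`. As `p` decreases, the light slots carry at least the
mass of the last ages. The choice `H = (log log n) / 4`, for which `exp (2 H) = √(log n)`, produces
the factor `1 / log log n`. Both probabilistic statements are exponential supermartingales
(`survWeight`, `medWeight`). They hold against adaptive adversaries because the bits of one slot can
be redrawn given the past (`NonAnticipating.integral_resample`). The outcome is `latency_tail`.

Lower bounds. A small latency in either metric gives `SmallLatency D b ℓ`, with `b = 1` for high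
probability and `b = 0` for expectation. A large batch of parties woken up together blocks itself at
every age where `p` exceeds `n ^ (-1/2)`. So if its members probably have not succeeded before age
`T`, the rarer ages between `T` and `ℓ n` must have mass of order at least `log ^ b n`
(`SmallLatency.window_mass`).

To hold a batch back until age `T` at low cost, jamming parties are spread so that the contention
stays above some `c` of order `log log T`. A given party then succeeds in a slot with probability at
most its bit probability times a negative power of `log T`, and the total mass of the ages is only
polylogarithmic (`SmallLatency.sum_bitProb_le`). The jam must survive the successes of its own
members. For this only the ages with `p ≤ d ^ (-1/8)`, where `d` is about `√T`, are counted, so that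
each success removes very little (`law_real_not_calm_le`). If `S` is the mass of these light ages
below `d`, jamming costs about `T log log T / S` parties. The assumed bound on `ℓ` cancels the `log
log`, and mass of order `log ^ b T` must lie between `T` and `ε T log ^ (b + 1) T / S`
(`SmallLatency.exists_heavy_window`).

Finally, the ratio `log ^ (b + 1) d / S` tends to infinity with `d`. Let `r` be its value at an
index `N` that is a record. Then the windows from `T` to about `r T`, for `T` between `√N` and `N`,
all have this mass. About `log N / log r` of them are disjoint, which makes the light mass at `N` at
least of order `log ^ (b + 1) N / log r`. Hence `r = O(log r)`, a contradiction
(`not_smallLatency`). -/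

open Classical in
/-- Replace the coordinates in `C` of the bits `X` by those of `Y`. -/
def mixBits {n : ℕ} (C : Fin n → Set ℕ) (X Y : Bits n) : Bits n :=
  fun v k => if k ∈ C v then Y v k else X v k

/-! ### Functions of finitely many bits -/

/-- `F` depends only on the bits with local index less than `T`. -/
def FinDep {n : ℕ} {β : Type*} (T : ℕ) (F : Bits n → β) : Prop :=
  ∀ X X' : Bits n, (∀ v k, k < T → X v k = X' v k) → F X = F X'

theorem FinDep.mono {n : ℕ} {β : Type*} {T T' : ℕ} {F : Bits n → β} (h : FinDep T F)
    (hT : T ≤ T') : FinDep T' F :=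
  fun X X' hX => h X X' fun v k hk => hX v k (hk.trans_le hT)

/-- All quantities observed up to a fixed slot factor through a finite type; their measurability,
boundedness and integrability come from this. -/
theorem FinDep.exists_factor {n : ℕ} {β : Type*} {T : ℕ} {F : Bits n → β} (h : FinDep T F) :
    ∃ G : (Fin n → Fin T → Bool) → β, F = fun X => G fun v k => X v k := by
  refine ⟨fun y => F fun v k => if hk : k < T then y v ⟨k, hk⟩ else false, ?_⟩
  funext X
  exact h _ _ fun v k hk => by simp [hk]

theorem FinDep.measurable {n : ℕ} {β : Type*} [MeasurableSpace β] {T : ℕ} {F : Bits n → β}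
    (h : FinDep T F) : Measurable F := by
  obtain ⟨G, rfl⟩ := h.exists_factor
  exact (measurable_of_finite G).comp (by fun_prop)

theorem FinDep.exists_bound {n : ℕ} {T : ℕ} {F : Bits n → ℝ} (h : FinDep T F) :
    ∃ C : ℝ, ∀ X, ‖F X‖ ≤ C := by
  obtain ⟨G, rfl⟩ := h.exists_factor
  obtain ⟨C, hC⟩ := (Set.finite_range fun y => ‖G y‖).bddAbove
  exact ⟨C, fun X => hC ⟨_, rfl⟩⟩

instance {D : LocalClockProtocol} {n : ℕ} : IsProbabilityMeasure (law D n) := by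
  unfold law; infer_instance

theorem FinDep.integrable {n : ℕ} {D : LocalClockProtocol} {T : ℕ} {F : Bits n → ℝ}
    (h : FinDep T F) : Integrable F (law D n) := by
  obtain ⟨C, hC⟩ := h.exists_bound
  exact Integrable.of_bound h.measurable.aestronglyMeasurable C (ae_of_all _ hC)

theorem FinDep.measurableSet {n : ℕ} {T : ℕ} {P : Bits n → Prop} (h : FinDep T P) :
    MeasurableSet {X | P X} :=
  measurableSet_setOfPred.2 h.measurable

theorem FinDep.comp {n : ℕ} {β γ : Type*} {T : ℕ} {F : Bits n → β} (h : FinDep T F)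
    (g : β → γ) : FinDep T fun X => g (F X) :=
  fun X X' hX => congrArg g (h X X' hX)

theorem FinDep.comp₂ {n : ℕ} {β γ δ : Type*} {T : ℕ} {F : Bits n → β} {G : Bits n → γ}
    (hF : FinDep T F) (hG : FinDep T G) (g : β → γ → δ) : FinDep T fun X => g (F X) (G X) :=
  fun X X' hX => congrArg₂ g (hF X X' hX) (hG X X' hX)

/-- The probability that the bit at local index `k` is set. -/
def bitProb (D : LocalClockProtocol) (k : ℕ) : ℝ :=
  (D : Measure (ℕ → Bool)).real {x | x k = true}

theorem bitProb_nonneg (D : LocalClockProtocol) (k : ℕ) : 0 ≤ bitProb D k := measureReal_nonneg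

theorem bitProb_le_one (D : LocalClockProtocol) (k : ℕ) : bitProb D k ≤ 1 := measureReal_le_one

/-! ### Redrawing independent bits -/

open Classical in
-- Independence makes `D` the product of its marginals, so a sequence assembled coordinatewise from
-- two independent draws is distributed like a single draw. The set `C` has to be deterministic
-- here.
theorem IsMemoryless.measurePreserving_mix {D : LocalClockProtocol} (hD : IsMemoryless D)
    (C : Set ℕ) :
    MeasurePreserving (fun z : (ℕ → Bool) × (ℕ → Bool) => fun k => if k ∈ C then z.2 k else z.1 k)
      ((D : Measure (ℕ → Bool)).prod D) D := by
  have hm : Measurable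
      (fun z : (ℕ → Bool) × (ℕ → Bool) => fun k => if k ∈ C then z.2 k else z.1 k) := by
    refine measurable_pi_iff.2 fun k => ?_
    by_cases hk : k ∈ C <;> simp only [hk, if_true, if_false] <;> fun_prop
  refine ⟨hm, ?_⟩
  have hI := (iIndepFun_iff_map_fun_eq_infinitePi_map (P := (D : Measure (ℕ → Bool)))
    (X := fun (k : ℕ) (x : ℕ → Bool) => x k) (fun k => measurable_pi_apply k)).1 hD
  have hI' : (D : Measure (ℕ → Bool)) =
      Measure.infinitePi fun k => (D : Measure (ℕ → Bool)).map fun x => x k := by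
    rw [← hI]; exact Measure.map_id.symm
  have hpr : ∀ k : ℕ, IsProbabilityMeasure ((D : Measure (ℕ → Bool)).map fun x => x k) :=
    fun k => Measure.isProbabilityMeasure_map (measurable_pi_apply k).aemeasurable
  conv_rhs => rw [hI']
  refine Measure.eq_infinitePi _ fun s t ht => ?_
  rw [Measure.map_apply hm (.pi s.countable_toSet fun i _ => ht i)]
  have hpre : (fun z : (ℕ → Bool) × (ℕ → Bool) => fun k => if k ∈ C then z.2 k else z.1 k) ⁻¹'
      (Set.pi s t) = (Set.pi (s.filter (· ∉ C) : Finset ℕ) t) ×ˢ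
        (Set.pi (s.filter (· ∈ C) : Finset ℕ) t) := by
    ext z
    simp only [Set.mem_preimage, Set.mem_pi, Finset.mem_coe, Set.mem_prod, Finset.mem_filter,
      and_imp]
    constructor
    · intro h
      exact ⟨fun i hi hiC => by simpa [hiC] using h i hi, fun i hi hiC => by simpa [hiC] using h i hi⟩
    · rintro ⟨h1, h2⟩ i hi
      by_cases hiC : i ∈ C
      · simpa [hiC] using h2 i hi hiC
      · simpa [hiC] using h1 i hi hiC
  rw [hpre, Measure.prod_prod]
  conv_lhs => rw [hI', Measure.infinitePi_pi _ (fun i _ => ht i),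
    Measure.infinitePi_pi _ (fun i _ => ht i)]
  rw [mul_comm]
  exact Finset.prod_filter_mul_prod_filter_not s (· ∈ C) _

theorem IsMemoryless.measurePreserving_mixBits {D : LocalClockProtocol} (hD : IsMemoryless D)
    {n : ℕ} (C : Fin n → Set ℕ) :
    MeasurePreserving (fun z : Bits n × Bits n => mixBits C z.1 z.2)
      ((law D n).prod (law D n)) (law D n) := by
  have h1 := (measurePreserving_arrowProdEquivProdArrow (ℕ → Bool) (ℕ → Bool) (Fin n)
    (fun _ => (D : Measure (ℕ → Bool))) (fun _ => (D : Measure (ℕ → Bool)))).symm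
  have h2 := measurePreserving_pi (fun _ : Fin n => ((D : Measure (ℕ → Bool)).prod
    (D : Measure (ℕ → Bool)))) (fun _ => (D : Measure (ℕ → Bool)))
    (fun v => hD.measurePreserving_mix (C v))
  exact h2.comp h1

theorem mixBits_finDep_right {n : ℕ} {β : Type*} {T : ℕ} {F : Bits n → β} (h : FinDep T F)
    (C : Fin n → Set ℕ) (X : Bits n) : FinDep T fun Y => F (mixBits C X Y) := by
  intro Y Y' hY
  refine h _ _ fun v k hk => ?_
  simp only [mixBits, hY v k hk]

theorem mixBits_finDep_left {n : ℕ} {β : Type*} {T : ℕ} {F : Bits n → β} (h : FinDep T F)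
    (C : Fin n → Set ℕ) (Y : Bits n) : FinDep T fun X => F (mixBits C X Y) := by
  intro X X' hX
  refine h _ _ fun v k hk => ?_
  simp only [mixBits, hX v k hk]

theorem integral_mixBits {D : LocalClockProtocol} (hD : IsMemoryless D) {n T : ℕ}
    (C : Fin n → Set ℕ) {F : Bits n → ℝ} (hF : FinDep T F) :
    ∫ X, F X ∂(law D n) = ∫ X, ∫ Y, F (mixBits C X Y) ∂(law D n) ∂(law D n) := by
  have hmp := hD.measurePreserving_mixBits (n := n) C
  have hint : Integrable (fun z : Bits n × Bits n => F (mixBits C z.1 z.2))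
      ((law D n).prod (law D n)) := hmp.integrable_comp_of_integrable hF.integrable
  rw [← integral_prod (fun z : Bits n × Bits n => F (mixBits C z.1 z.2)) hint]
  conv_lhs => rw [← hmp.map_eq]
  exact integral_map hmp.measurable.aemeasurable hF.measurable.aestronglyMeasurable

/-! ### Wake-up times determined by the past, and contention in a slot -/

/-- The bits that belong to slot `t` for wake-up times `w`. -/
def slotBits {n : ℕ} (w : Fin n → ℕ∞) (t : ℕ) (v : Fin n) : Set ℕ := {k | w v + k + 1 = t}

/-- Wake-up times that are determined by the history: whether a party is woken up at time `j < t`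
depends only on the bits of the slots before `t`. -/
def NonAnticipating {n : ℕ} (wk : Bits n → Fin n → ℕ∞) : Prop :=
  ∀ (t : ℕ) (X X' : Bits n), (∀ v (k : ℕ), wk X v + k + 1 < t → X v k = X' v k) →
    ∀ v (j : ℕ), j < t → (wk X v = j ↔ wk X' v = j)

theorem nonAnticipating_const {n : ℕ} (w : Fin n → ℕ∞) : NonAnticipating fun _ : Bits n => w :=
  fun _ _ _ _ _ _ _ => Iff.rfl

/-- Party `v` has a set bit in slot `t`. -/
def Fires {n : ℕ} (w : Fin n → ℕ∞) (X : Bits n) (t : ℕ) (v : Fin n) : Prop :=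
  ∃ k : ℕ, w v + k + 1 = t ∧ X v k = true

open Classical in
/-- The value at the age that party `v` has in slot `t`, `0` if `v` is not awake. -/
def rate {n : ℕ} (p : ℕ → ℝ) (w : Fin n → ℕ∞) (t : ℕ) (v : Fin n) : ℝ :=
  if w v < t then p (t - 1 - (w v).toNat) else 0

theorem slotBits_eq {n : ℕ} (w : Fin n → ℕ∞) (t : ℕ) (v : Fin n) (k : ℕ) :
    w v + k + 1 = t ↔ w v < t ∧ k = t - 1 - (w v).toNat := by
  induction w v using ENat.recTopCoe with
  | top => simp
  | coe a =>
    norm_cast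
    simp only [ENat.toNat_natCast]
    omega

theorem rate_eq_of_eq {n : ℕ} (p : ℕ → ℝ) {w : Fin n → ℕ∞} {t : ℕ} {v : Fin n} {k : ℕ}
    (h : w v + k + 1 = t) : rate p w t v = p k := by
  obtain ⟨h1, h2⟩ := (slotBits_eq w t v k).1 h
  simp [rate, h1, h2]

theorem rate_nonneg {n : ℕ} {p : ℕ → ℝ} (hp : ∀ k, 0 ≤ p k) (w : Fin n → ℕ∞) (t : ℕ) (v : Fin n) :
    0 ≤ rate p w t v := by
  unfold rate; split_ifs; exacts [hp _, le_rfl]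

theorem rate_le {n : ℕ} {p : ℕ → ℝ} {c : ℝ} (hc : 0 ≤ c) (hp : ∀ k, p k ≤ c) (w : Fin n → ℕ∞)
    (t : ℕ) (v : Fin n) : rate p w t v ≤ c := by
  unfold rate; split_ifs; exacts [hp _, hc]

theorem rate_mono {n : ℕ} {p q : ℕ → ℝ} (h : ∀ k, p k ≤ q k) (w : Fin n → ℕ∞) (t : ℕ) (v : Fin n) :
    rate p w t v ≤ rate q w t v := by
  unfold rate; split_ifs; exacts [h _, le_rfl]

theorem grabbers_eq {n : ℕ} (w : Fin n → ℕ∞) (X : Bits n) (S : Set (Fin n)) (t : ℕ) :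
    grabbers w X S t = {u | u ∉ S ∧ Fires w X t u} := rfl

theorem measureReal_fires {n : ℕ} (D : LocalClockProtocol) (w : Fin n → ℕ∞) (t : ℕ) (v : Fin n) :
    (D : Measure (ℕ → Bool)).real {x | ∃ k : ℕ, w v + k + 1 = t ∧ x k = true} =
      rate (bitProb D) w t v := by
  by_cases h : w v < t
  · simp only [slotBits_eq, h, true_and, exists_eq_left, rate, if_true, bitProb]
  · simp [slotBits_eq, h, rate]

theorem measurableSet_fires {n : ℕ} (w : Fin n → ℕ∞) (t : ℕ) (v : Fin n) :
    MeasurableSet {x : ℕ → Bool | ∃ k : ℕ, w v + k + 1 = t ∧ x k = true} := by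
  by_cases h : w v < t
  · simp only [slotBits_eq, h, true_and, exists_eq_left]
    exact (measurable_pi_apply (X := fun _ : ℕ => Bool) (t - 1 - (w v).toNat))
      (measurableSet_singleton true)
  · simp [slotBits_eq, h]

theorem measureReal_not_fires {n : ℕ} (D : LocalClockProtocol) (w : Fin n → ℕ∞) (t : ℕ)
    (v : Fin n) :
    (D : Measure (ℕ → Bool)).real {x | ¬ ∃ k : ℕ, w v + k + 1 = t ∧ x k = true} =
      1 - rate (bitProb D) w t v := by
  rw [← measureReal_fires]
  exact probReal_compl_eq_one_sub (measurableSet_fires w t v)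

theorem law_real_pi {n : ℕ} (D : LocalClockProtocol) (s : Fin n → Set (ℕ → Bool)) :
    (law D n).real {Y | ∀ v, Y v ∈ s v} = ∏ v, (D : Measure (ℕ → Bool)).real (s v) := by
  have : {Y : Bits n | ∀ v, Y v ∈ s v} = Set.univ.pi s := by ext; simp
  rw [this, law, Measure.real, Measure.pi_pi, ENNReal.toReal_prod]
  rfl

open Classical in
/-- The probability that `a` is the only party of `A` that fires. -/
def soleProb {n : ℕ} (p : ℕ → ℝ) (w : Fin n → ℕ∞) (t : ℕ) (A : Set (Fin n)) (a : Fin n) : ℝ :=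
  if a ∈ A then rate p w t a * ∏ v ∈ Finset.univ.filter (fun v => v ∈ A ∧ v ≠ a),
    (1 - rate p w t v) else 0

open Classical in
theorem law_real_none {n : ℕ} (D : LocalClockProtocol) (w : Fin n → ℕ∞) (t : ℕ)
    (A : Set (Fin n)) :
    (law D n).real {Y | {v | v ∈ A ∧ Fires w Y t v} = ∅} =
      ∏ v ∈ Finset.univ.filter (fun v => v ∈ A), (1 - rate (bitProb D) w t v) := by
  have : {Y : Bits n | {v | v ∈ A ∧ Fires w Y t v} = ∅} = {Y | ∀ v, Y v ∈
      (if v ∈ A then {x : ℕ → Bool | ¬ ∃ k : ℕ, w v + k + 1 = t ∧ x k = true} else Set.univ)} := by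
    ext Y
    simp only [Set.mem_ofPred_eq, Set.eq_empty_iff_forall_notMem]
    refine forall_congr' fun v => ?_
    by_cases hv : v ∈ A <;> simp [hv, Fires]
  rw [this, law_real_pi, Finset.prod_filter]
  refine Finset.prod_congr rfl fun v _ => ?_
  split_ifs
  · exact measureReal_not_fires D w t v
  · simp

open Classical in
theorem law_real_sole {n : ℕ} (D : LocalClockProtocol) (w : Fin n → ℕ∞) (t : ℕ)
    (A : Set (Fin n)) (a : Fin n) :
    (law D n).real {Y | {v | v ∈ A ∧ Fires w Y t v} = {a}} = soleProb (bitProb D) w t A a := by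
  unfold soleProb
  split_ifs with ha
  · have : {Y : Bits n | {v | v ∈ A ∧ Fires w Y t v} = {a}} = {Y | ∀ v, Y v ∈
        (if v = a then {x : ℕ → Bool | ∃ k : ℕ, w v + k + 1 = t ∧ x k = true} else
        if v ∈ A then {x : ℕ → Bool | ¬ ∃ k : ℕ, w v + k + 1 = t ∧ x k = true} else Set.univ)} := by
      ext Y
      simp only [Set.mem_ofPred_eq, Set.ext_iff]
      refine forall_congr' fun v => ?_
      by_cases hva : v = a
      · subst hva; simp [ha, Fires]
      · by_cases hv : v ∈ A <;> simp [hv, hva, Fires]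
    rw [this, law_real_pi, Finset.prod_filter, ← Finset.mul_prod_erase _ _ (Finset.mem_univ a)]
    congr 1
    · rw [if_pos rfl]; exact measureReal_fires D w t a
    · rw [← Finset.mul_prod_erase (a := a) Finset.univ
        (fun v => if v ∈ A ∧ v ≠ a then 1 - rate (bitProb D) w t v else 1) (Finset.mem_univ a)]
      simp only [ne_eq, not_true_eq_false, and_false, if_false, one_mul]
      refine Finset.prod_congr rfl fun v hv => ?_
      rw [if_neg (Finset.ne_of_mem_erase hv)]
      by_cases hvA : v ∈ A
      · simp only [hvA, if_true, Finset.ne_of_mem_erase hv, not_false_eq_true, and_self]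
        exact measureReal_not_fires D w t v
      · simp [hvA]
  · rw [show {Y : Bits n | {v | v ∈ A ∧ Fires w Y t v} = {a}} = ∅ from ?_]
    · simp
    · ext Y
      simp only [Set.mem_ofPred_eq, Set.mem_empty_iff_false, iff_false, Set.ext_iff]
      intro h
      exact ha ((h a).2 rfl).1

/-! ### Executions are determined by the past -/

theorem mem_succeededBefore {n : ℕ} {w : Fin n → ℕ∞} {X : Bits n} {t : ℕ} {u : Fin n} :
    u ∈ succeededBefore w X t ↔ ∃ s < t, SucceedsAt w X s u := by
  induction t with
  | zero => simp [succeededBefore]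
  | succ t ih =>
    simp only [succeededBefore, Set.mem_union, ih, Set.mem_ofPred_eq]
    constructor
    · rintro (⟨s, hs, h⟩ | h)
      · exact ⟨s, by omega, h⟩
      · exact ⟨t, by omega, h⟩
    · rintro ⟨s, hs, h⟩
      rcases Nat.lt_succ_iff_lt_or_eq.1 hs with hs | rfl
      · exact Or.inl ⟨s, hs, h⟩
      · exact Or.inr h

theorem SucceedsAt.fires {n : ℕ} {w : Fin n → ℕ∞} {X : Bits n} {t : ℕ} {u : Fin n}
    (h : SucceedsAt w X t u) : Fires w X t u := by
  have : u ∈ grabbers w X (succeededBefore w X t) t := by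
    rw [show grabbers w X (succeededBefore w X t) t = {u} from h]; rfl
  exact this.2

theorem SucceedsAt.not_mem {n : ℕ} {w : Fin n → ℕ∞} {X : Bits n} {t : ℕ} {u : Fin n}
    (h : SucceedsAt w X t u) : u ∉ succeededBefore w X t := by
  have : u ∈ grabbers w X (succeededBefore w X t) t := by
    rw [show grabbers w X (succeededBefore w X t) t = {u} from h]; rfl
  exact this.1

theorem succeededBefore_mono {n : ℕ} (w : Fin n → ℕ∞) (X : Bits n) :
    Monotone (succeededBefore w X) := by
  intro s t hst u
  simp only [mem_succeededBefore]
  rintro ⟨r, hr, h⟩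
  exact ⟨r, hr.trans_le hst, h⟩

theorem slot_exists_wake {a : ℕ∞} {k t : ℕ} (h : a + k + 1 = t) : ∃ j : ℕ, j < t ∧ a = j := by
  induction a using ENat.recTopCoe with
  | top => simp at h
  | coe a => exact ⟨a, by norm_cast at h; omega, rfl⟩

theorem fires_congr {n : ℕ} {w w' : Fin n → ℕ∞} {X X' : Bits n} {t : ℕ} {v : Fin n}
    (hw : ∀ j : ℕ, j < t → (w v = j ↔ w' v = j)) (hX : ∀ k : ℕ, w v + k + 1 = t → X v k = X' v k) :
    Fires w X t v ↔ Fires w' X' t v := by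
  have key : ∀ k : ℕ, w v + k + 1 = t ↔ w' v + k + 1 = t := by
    intro k
    constructor
    · intro h
      obtain ⟨j, hj, hwj⟩ := slot_exists_wake h
      rw [(hw j hj).1 hwj, ← hwj]; exact h
    · intro h
      obtain ⟨j, hj, hwj⟩ := slot_exists_wake h
      rw [(hw j hj).2 hwj, ← hwj]; exact h
  constructor
  · rintro ⟨k, hk, hb⟩
    exact ⟨k, (key k).1 hk, (hX k hk) ▸ hb⟩
  · rintro ⟨k, hk, hb⟩
    exact ⟨k, (key k).2 hk, (hX k ((key k).2 hk)).symm ▸ hb⟩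

theorem rate_congr {n : ℕ} (p : ℕ → ℝ) {w w' : Fin n → ℕ∞} {t : ℕ} {v : Fin n}
    (hw : ∀ j : ℕ, j < t → (w v = j ↔ w' v = j)) : rate p w t v = rate p w' t v := by
  by_cases h : w v < t
  · obtain ⟨j, hj⟩ := ENat.ne_top_iff_exists.1 (ne_top_of_lt h)
    have hjt : j < t := by rw [← hj] at h; exact_mod_cast h
    have h' := (hw j hjt).1 hj.symm
    simp only [rate, h', ← hj]
  · have h' : ¬ w' v < t := by
      intro h'
      obtain ⟨j, hj⟩ := ENat.ne_top_iff_exists.1 (ne_top_of_lt h')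
      have hjt : j < t := by rw [← hj] at h'; exact_mod_cast h'
      rw [(hw j hjt).2 hj.symm] at h
      exact h (by exact_mod_cast hjt)
    simp [rate, h, h']

theorem succeededBefore_congr {n : ℕ} {w w' : Fin n → ℕ∞} {X X' : Bits n} {t : ℕ}
    (hw : ∀ v (j : ℕ), j < t → (w v = j ↔ w' v = j))
    (hX : ∀ v (k : ℕ), w v + k + 1 < t → X v k = X' v k) :
    ∀ s ≤ t, succeededBefore w X s = succeededBefore w' X' s := by
  intro s
  induction s with
  | zero => intro _; rfl
  | succ s ih =>
    intro hs
    have hs' := ih (by omega)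
    have hg : grabbers w X (succeededBefore w X s) s =
        grabbers w' X' (succeededBefore w' X' s) s := by
      ext v
      simp only [grabbers_eq, Set.mem_ofPred_eq, hs']
      rw [fires_congr (w' := w') (X' := X') (fun j hj => hw v j (by omega))
        (fun k hk => hX v k (by rw [hk]; exact_mod_cast hs))]
    simp only [succeededBefore, hs']
    rw [← hs', hg, hs']

/-! ### Resampling one slot -/

theorem mixBits_slot_past {n : ℕ} (w : Fin n → ℕ∞) (t : ℕ) (X Y : Bits n) (v : Fin n) (k : ℕ)
    (h : w v + k + 1 < t) : X v k = mixBits (slotBits w t) X Y v k := by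
  have : k ∉ slotBits w t v := fun hk => by
    have hk : w v + k + 1 = t := hk
    exact absurd hk h.ne
  simp [mixBits, this]

theorem mixBits_slot_now {n : ℕ} (w : Fin n → ℕ∞) (t : ℕ) (X Y : Bits n) (v : Fin n) (k : ℕ)
    (h : w v + k + 1 = t) : mixBits (slotBits w t) X Y v k = Y v k := by
  have : k ∈ slotBits w t v := h
  simp [mixBits, this]

section NonAnticipating

variable {n : ℕ} {wk : Bits n → Fin n → ℕ∞}

theorem NonAnticipating.wake_mix (h : NonAnticipating wk) (t : ℕ) (X Y : Bits n) (v : Fin n)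
    (j : ℕ) (hj : j < t) :
    wk X v = j ↔ wk (mixBits (slotBits (wk X) t) X Y) v = j :=
  h t X _ (fun v k hk => mixBits_slot_past _ t X Y v k hk) v j hj

theorem NonAnticipating.succeededBefore_mix (h : NonAnticipating wk) (t : ℕ) (X Y : Bits n) {s : ℕ}
    (hs : s ≤ t) :
    succeededBefore (wk (mixBits (slotBits (wk X) t) X Y)) (mixBits (slotBits (wk X) t) X Y) s =
      succeededBefore (wk X) X s :=
  (succeededBefore_congr (fun v j hj => h.wake_mix t X Y v j hj)
    (fun v k hk => mixBits_slot_past _ t X Y v k hk) s hs).symm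

theorem NonAnticipating.fires_mix (h : NonAnticipating wk) (t : ℕ) (X Y : Bits n) (v : Fin n) :
    Fires (wk (mixBits (slotBits (wk X) t) X Y)) (mixBits (slotBits (wk X) t) X Y) t v ↔
      Fires (wk X) Y t v := by
  rw [← fires_congr (w := wk X) (X := mixBits (slotBits (wk X) t) X Y)
    (fun j hj => h.wake_mix t X Y v j hj) (fun k _ => rfl)]
  exact fires_congr (fun j _ => Iff.rfl) fun k hk => mixBits_slot_now _ t X Y v k hk

theorem NonAnticipating.succeedsAt_mix (h : NonAnticipating wk) (t : ℕ) (X Y : Bits n)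
    (v : Fin n) :
    SucceedsAt (wk (mixBits (slotBits (wk X) t) X Y)) (mixBits (slotBits (wk X) t) X Y) t v ↔
      {a | a ∈ (succeededBefore (wk X) X t)ᶜ ∧ Fires (wk X) Y t a} = {v} := by
  unfold SucceedsAt
  simp only [grabbers_eq, h.succeededBefore_mix t X Y le_rfl, h.fires_mix t X Y,
    Set.mem_compl_iff]

theorem NonAnticipating.wake_finDep (h : NonAnticipating wk) {t : ℕ} {X X' : Bits n}
    (hX : ∀ v k, k < t → X v k = X' v k) (v : Fin n) (j : ℕ) (hj : j < t) :
    wk X v = j ↔ wk X' v = j :=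
  h t X X' (fun v k hk => hX v k (by
    have : (k : ℕ∞) < t := lt_of_le_of_lt (le_trans (le_add_left le_rfl) le_self_add) hk
    exact_mod_cast this)) v j hj

theorem NonAnticipating.finDep_succeededBefore (h : NonAnticipating wk) (t : ℕ) :
    FinDep t fun X => succeededBefore (wk X) X t := by
  intro X X' hX
  exact succeededBefore_congr (fun v j hj => h.wake_finDep hX v j hj)
    (fun v k hk => hX v k (by
      have : (k : ℕ∞) < t := lt_of_le_of_lt (le_trans (le_add_left le_rfl) le_self_add) hk
      exact_mod_cast this)) t le_rfl

theorem lt_of_slot {a : ℕ∞} {k t : ℕ} (h : a + k + 1 = t) : k < t := by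
  obtain ⟨j, -, rfl⟩ := slot_exists_wake h
  norm_cast at h; omega

theorem NonAnticipating.finDep_fires (h : NonAnticipating wk) (t : ℕ) (v : Fin n) :
    FinDep t fun X => Fires (wk X) X t v := by
  intro X X' hX
  exact propext (fires_congr (fun j hj => h.wake_finDep hX v j hj)
    fun k hk => hX v k (lt_of_slot hk))

theorem NonAnticipating.finDep_succeedsAt (h : NonAnticipating wk) (t : ℕ) (v : Fin n) :
    FinDep t fun X => SucceedsAt (wk X) X t v := by
  intro X X' hX
  unfold SucceedsAt
  simp only [grabbers_eq, h.finDep_succeededBefore t X X' hX]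
  have := fun a => h.finDep_fires t a X X' hX
  simp only at this
  simp only [this]

theorem NonAnticipating.finDep_slotBits (h : NonAnticipating wk) (t : ℕ) :
    FinDep t fun X => slotBits (wk X) t := by
  intro X X' hX
  funext v
  ext k
  change wk X v + k + 1 = t ↔ wk X' v + k + 1 = t
  constructor
  · intro hk
    obtain ⟨j, hj, hwj⟩ := slot_exists_wake hk
    rw [(h.wake_finDep hX v j hj).1 hwj, ← hwj]; exact hk
  · intro hk
    obtain ⟨j, hj, hwj⟩ := slot_exists_wake hk
    rw [(h.wake_finDep hX v j hj).2 hwj, ← hwj]; exact hk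

theorem NonAnticipating.finDep_mix {D : LocalClockProtocol} (h : NonAnticipating wk) (t : ℕ)
    {T : ℕ} {F : Bits n → ℝ} (hF : FinDep T F) :
    FinDep (max T t) fun X => ∫ Y, F (mixBits (slotBits (wk X) t) X Y) ∂(law D n) := by
  intro X X' hX
  have h1 := h.finDep_slotBits t X X' fun v k hk => hX v k (hk.trans_le (le_max_right _ _))
  simp only at h1 ⊢
  rw [h1]
  refine integral_congr_ae (ae_of_all _ fun Y => ?_)
  exact mixBits_finDep_left hF _ Y X X' fun v k hk => hX v k (hk.trans_le (le_max_left _ _))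

/-- The value `t` stands for all times from `t` on and for `⊤`, which leaves finitely many classes.
-/
theorem exists_truncation (t : ℕ) :
    ∃ g : ℕ∞ → Fin (t + 1), ∀ (a : ℕ∞) (j : ℕ), j < t → (a = j ↔ (g a : ℕ) = j) := by
  refine ⟨fun a => if h : a.toNat < t ∧ a ≠ ⊤ then ⟨a.toNat, by omega⟩ else Fin.last t,
    fun a j hj => ?_⟩
  induction a using ENat.recTopCoe with
  | top => simp; omega
  | coe a =>
    by_cases ha : a < t
    · simp [ha]
    · simp [ha]; omega

open Classical in
/-- The expectation does not change if the bits of slot `t` are drawn afresh. -/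
theorem NonAnticipating.integral_resample {D : LocalClockProtocol} (hD : IsMemoryless D)
    (h : NonAnticipating wk) (t : ℕ) {T : ℕ} {F : Bits n → ℝ} (hF : FinDep T F) :
    ∫ X, F X ∂(law D n) =
      ∫ X, ∫ Y, F (mixBits (slotBits (wk X) t) X Y) ∂(law D n) ∂(law D n) := by
  -- The set of redrawn bits depends on `X`, whereas `integral_mixBits` needs a fixed set. The
  -- wake-up pattern truncated at `t` takes finitely many values and determines this set, so the
  -- expectation is split according to the pattern.
  obtain ⟨cls, cls_spec⟩ : ∃ cls : Bits n → Fin n → Fin (t + 1), ∀ X v (j : ℕ), j < t →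
      (wk X v = j ↔ (cls X v : ℕ) = j) := by
    obtain ⟨g, hg⟩ := exists_truncation t
    exact ⟨fun X v => g (wk X v), fun X v j hj => hg _ j hj⟩
  have cls_eq : ∀ X X', (∀ v (j : ℕ), j < t → (wk X v = j ↔ wk X' v = j)) → cls X = cls X' := by
    intro X X' hXX
    funext v
    apply Fin.ext
    by_cases h1 : (cls X v : ℕ) < t
    · exact ((cls_spec X' v _ h1).1 ((hXX v _ h1).1 ((cls_spec X v _ h1).2 rfl))).symm
    · by_cases h2 : (cls X' v : ℕ) < t
      · exact ((cls_spec X v _ h2).1 ((hXX v _ h2).2 ((cls_spec X' v _ h2).2 rfl)))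
      · have := (cls X v).2; have := (cls X' v).2; omega
  have cls_dep : FinDep t cls := fun X X' hX => cls_eq X X' fun v j hj => h.wake_finDep hX v j hj
  obtain ⟨wt, hwt⟩ : ∃ wt : (Fin n → Fin (t + 1)) → Fin n → Set ℕ, ∀ τ v k,
      k ∈ wt τ v ↔ (τ v : ℕ) + k + 1 = t := ⟨fun τ v => {k | (τ v : ℕ) + k + 1 = t}, fun _ _ _ => Iff.rfl⟩
  have wt_eq : ∀ X, slotBits (wk X) t = wt (cls X) := by
    intro X
    funext v
    ext k
    rw [hwt]
    change wk X v + k + 1 = t ↔ (cls X v : ℕ) + k + 1 = t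
    constructor
    · intro hk
      obtain ⟨j, hj, hwj⟩ := slot_exists_wake hk
      rw [(cls_spec X v j hj).1 hwj]
      rw [hwj] at hk; exact_mod_cast hk
    · intro hk
      rw [(cls_spec X v (cls X v) (by omega)).2 rfl]
      exact_mod_cast hk
  -- Redrawing slot `t` preserves the pattern: wake-ups before time `t` are decided by bits of
  -- earlier slots. So each piece of the partition is compatible with the substitution.
  have cls_mix : ∀ τ X Y, cls (mixBits (wt τ) X Y) = τ ↔ cls X = τ := by
    intro τ X Y
    constructor
    · intro hc
      rw [← hc]
      apply cls_eq
      intro v j hj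
      refine (h t (mixBits (wt τ) X Y) X ?_ v j hj).symm
      intro v k hk
      have : k ∉ wt τ v := by
        rw [← hc, ← wt_eq]
        intro hk'
        have hk' : wk (mixBits (wt τ) X Y) v + k + 1 = t := hk'
        exact absurd hk' hk.ne
      simp [mixBits, this]
    · intro hc
      rw [← hc]
      apply cls_eq
      intro v j hj
      rw [← wt_eq]
      exact (h.wake_mix t X Y v j hj).symm
  have hsum : ∀ G : Bits n → ℝ, ∀ X, G X = ∑ τ, if cls X = τ then G X else 0 := by
    intro G X
    rw [Finset.sum_ite_eq Finset.univ (cls X) (fun _ => G X), if_pos (Finset.mem_univ _)]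
  have hdep : ∀ τ, FinDep (max T t) fun X => if cls X = τ then F X else 0 := by
    intro τ X X' hX
    have h1 := cls_dep X X' fun v k hk => hX v k (hk.trans_le (le_max_right _ _))
    have h2 := hF X X' fun v k hk => hX v k (hk.trans_le (le_max_left _ _))
    simp only [h1, h2]
  have hdep' : ∀ τ, FinDep (max T t) fun X => if cls X = τ then
      ∫ Y, F (mixBits (slotBits (wk X) t) X Y) ∂(law D n) else 0 := by
    intro τ X X' hX
    have h1 := cls_dep X X' fun v k hk => hX v k (hk.trans_le (le_max_right _ _))
    have h2 := h.finDep_mix (D := D) t hF X X' hX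
    simp only at h2
    simp only [h1, h2]
  calc ∫ X, F X ∂(law D n) = ∫ X, ∑ τ, (if cls X = τ then F X else 0) ∂(law D n) :=
        integral_congr_ae (ae_of_all _ fun X => hsum F X)
    _ = ∑ τ, ∫ X, (if cls X = τ then F X else 0) ∂(law D n) :=
        integral_finsetSum _ fun τ _ => (hdep τ).integrable
    _ = ∑ τ, ∫ X, (if cls X = τ then
          ∫ Y, F (mixBits (slotBits (wk X) t) X Y) ∂(law D n) else 0) ∂(law D n) := by
        refine Finset.sum_congr rfl fun τ _ => ?_
        rw [integral_mixBits hD (wt τ) (hdep τ)]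
        refine integral_congr_ae (ae_of_all _ fun X => ?_)
        simp only [cls_mix]
        by_cases hc : cls X = τ
        · simp only [hc, if_true, wt_eq]
        · simp only [hc, if_false, integral_zero]
    _ = ∫ X, ∑ τ, (if cls X = τ then
          ∫ Y, F (mixBits (slotBits (wk X) t) X Y) ∂(law D n) else 0) ∂(law D n) :=
        (integral_finsetSum _ fun τ _ => (hdep' τ).integrable).symm
    _ = _ := integral_congr_ae (ae_of_all _ fun X => (hsum (fun X =>
          ∫ Y, F (mixBits (slotBits (wk X) t) X Y) ∂(law D n)) X).symm)

theorem NonAnticipating.integral_le_of_step {D : LocalClockProtocol} (hD : IsMemoryless D)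
    (h : NonAnticipating wk) (t : ℕ) {T : ℕ} {F G : Bits n → ℝ} (hF : FinDep T F)
    (hG : FinDep T G)
    (hFG : ∀ X, ∫ Y, F (mixBits (slotBits (wk X) t) X Y) ∂(law D n) ≤ G X) :
    ∫ X, F X ∂(law D n) ≤ ∫ X, G X ∂(law D n) := by
  rw [h.integral_resample hD t hF]
  exact integral_mono (h.finDep_mix t hF).integrable hG.integrable hFG

end NonAnticipating

open Classical in
-- The bits of the slot enter the bound only through the identity of the one party of `A` that
-- fires, so the integral is a finite sum over that party.
theorem slot_integral_le {n : ℕ} (D : LocalClockProtocol) (w : Fin n → ℕ∞) (t : ℕ)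
    (A : Set (Fin n)) {T : ℕ} {φ : Bits n → ℝ} (hφ : FinDep T φ) (b : ℝ) (δ : Fin n → ℝ)
    (h : ∀ Y, φ Y ≤ b + ∑ a, if {v | v ∈ A ∧ Fires w Y t v} = {a} then δ a else 0) :
    ∫ Y, φ Y ∂(law D n) ≤ b + ∑ a, soleProb (bitProb D) w t A a * δ a := by
  have hdep : ∀ a, FinDep t fun Y : Bits n =>
      if {v | v ∈ A ∧ Fires w Y t v} = {a} then δ a else 0 := by
    intro a X X' hX
    have := fun v => (nonAnticipating_const w).finDep_fires t v X X' hX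
    simp only at this
    simp only [this]
  have hint : ∀ a ∈ Finset.univ, Integrable (fun Y : Bits n =>
      if {v | v ∈ A ∧ Fires w Y t v} = {a} then δ a else 0) (law D n) :=
    fun a _ => (hdep a).integrable
  calc ∫ Y, φ Y ∂(law D n)
      ≤ ∫ Y, (b + ∑ a, if {v | v ∈ A ∧ Fires w Y t v} = {a} then δ a else 0) ∂(law D n) :=
        integral_mono hφ.integrable ((integrable_const b).add (integrable_finsetSum _ hint)) h
    _ = b + ∑ a, soleProb (bitProb D) w t A a * δ a := by
        rw [integral_add (integrable_const b) (integrable_finsetSum _ hint),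
          integral_finsetSum _ hint]
        simp only [integral_const, probReal_univ, one_smul]
        congr 1
        refine Finset.sum_congr rfl fun a _ => ?_
        rw [← law_real_sole]
        have hms : MeasurableSet {Y : Bits n | {v | v ∈ A ∧ Fires w Y t v} = {a}} := by
          refine FinDep.measurableSet (T := t) fun X X' hX => ?_
          have := fun v => (nonAnticipating_const w).finDep_fires t v X X' hX
          simp only at this
          simp only [this]
        have := integral_indicator_const (μ := law D n) (δ a) hms
        rw [smul_eq_mul] at this
        rw [← this]
        rfl

theorem markov_finDep {n : ℕ} {D : LocalClockProtocol} {T : ℕ} {F : Bits n → ℝ} (hF : FinDep T F)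
    (h0 : ∀ X, 0 ≤ F X) {c : ℝ} (hc : 0 < c) :
    (law D n).real {X | c ≤ F X} ≤ (∫ X, F X ∂(law D n)) / c := by
  rw [le_div_iff₀ hc, mul_comm]
  exact mul_meas_ge_le_integral_of_nonneg (ae_of_all _ h0) hF.integrable c

/-! ### Executions with the same past, and the drift in one slot -/

/-- The two executions agree in all slots before `t`. -/
structure SamePast {n : ℕ} (t : ℕ) (w : Fin n → ℕ∞) (X : Bits n) (w' : Fin n → ℕ∞)
    (X' : Bits n) : Prop where
  wake : ∀ v (j : ℕ), j < t → (w v = j ↔ w' v = j)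
  bits : ∀ v (k : ℕ), w v + k + 1 < t → X v k = X' v k

section SamePast

variable {n t s : ℕ} {w w' : Fin n → ℕ∞} {X X' : Bits n}

theorem SamePast.succeededBefore (h : SamePast t w X w' X') (hs : s ≤ t) :
    succeededBefore w X s = ContentionResolution.succeededBefore w' X' s :=
  succeededBefore_congr h.wake h.bits s hs

theorem SamePast.rate (h : SamePast t w X w' X') (hs : s ≤ t) (p : ℕ → ℝ) (v : Fin n) :
    rate p w s v = ContentionResolution.rate p w' s v :=
  rate_congr p fun j hj => h.wake v j (hj.trans_le hs)

theorem SamePast.fires (h : SamePast t w X w' X') (hs : s < t) (v : Fin n) :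
    Fires w X s v ↔ Fires w' X' s v :=
  fires_congr (fun j hj => h.wake v j (hj.trans hs))
    fun k hk => h.bits v k (by rw [hk]; exact_mod_cast hs)

theorem SamePast.succeedsAt (h : SamePast t w X w' X') (hs : s < t) (v : Fin n) :
    SucceedsAt w X s v ↔ SucceedsAt w' X' s v := by
  unfold SucceedsAt
  simp only [grabbers_eq, h.succeededBefore hs.le, h.fires hs]

theorem SamePast.slot (h : SamePast t w X w' X') (hs : s ≤ t) (v : Fin n) (k : ℕ) :
    w v + k + 1 = s ↔ w' v + k + 1 = s := by
  constructor
  · intro hk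
    obtain ⟨j, hj, hwj⟩ := slot_exists_wake hk
    rw [(h.wake v j (hj.trans_le hs)).1 hwj, ← hwj]; exact hk
  · intro hk
    obtain ⟨j, hj, hwj⟩ := slot_exists_wake hk
    rw [(h.wake v j (hj.trans_le hs)).2 hwj, ← hwj]; exact hk

variable {wk : Bits n → Fin n → ℕ∞}

theorem NonAnticipating.samePast_mix (h : NonAnticipating wk) (t : ℕ) (X Y : Bits n) :
    SamePast t (wk X) X (wk (mixBits (slotBits (wk X) t) X Y)) (mixBits (slotBits (wk X) t) X Y) :=
  ⟨fun v j hj => h.wake_mix t X Y v j hj, fun v k hk => mixBits_slot_past _ t X Y v k hk⟩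

theorem NonAnticipating.finDep_of_samePast (h : NonAnticipating wk) {β : Type*} {t : ℕ}
    {Φ : (Fin n → ℕ∞) → Bits n → β}
    (hΦ : ∀ w X w' X', SamePast t w X w' X' → Φ w X = Φ w' X') :
    FinDep t fun X => Φ (wk X) X := by
  intro X X' hX
  refine hΦ _ _ _ _ ⟨fun v j hj => h.wake_finDep hX v j hj, fun v k hk => hX v k ?_⟩
  have : (k : ℕ∞) < t := lt_of_le_of_lt (le_trans (le_add_left le_rfl) le_self_add) hk
  exact_mod_cast this

theorem succeedsAt_unique {a b : Fin n} (ha : SucceedsAt w X t a) (hb : SucceedsAt w X t b) :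
    a = b := by
  have : ({a} : Set (Fin n)) = {b} := ha.symm.trans hb
  exact Set.singleton_injective this

open Classical in
theorem sum_succeedsAt_of (δ : Fin n → ℝ) {a : Fin n} (ha : SucceedsAt w X t a) :
    ∑ v, (if SucceedsAt w X t v then δ v else 0) = δ a := by
  rw [Finset.sum_eq_single a]
  · simp [ha]
  · intro b _ hb
    rw [if_neg fun h => hb (succeedsAt_unique h ha)]
  · simp

open Classical in
theorem sum_succeedsAt_none (δ : Fin n → ℝ) (h : ∀ a, ¬ SucceedsAt w X t a) :
    ∑ v, (if SucceedsAt w X t v then δ v else 0) = 0 :=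
  Finset.sum_eq_zero fun v _ => if_neg (h v)

open Classical in
-- Given the past, a party succeeds in slot `t` with probability exactly `soleProb`. A bound for the
-- next value in terms of the party that succeeds therefore integrates to an explicit drift, and
-- supermartingale properties can be checked slot by slot.
theorem NonAnticipating.step_le {D : LocalClockProtocol} (hD : IsMemoryless D)
    (h : NonAnticipating wk) (t : ℕ) {T : ℕ} {F G : Bits n → ℝ} (hF : FinDep T F) (hG : FinDep T G)
    (hstep : ∀ X, ∃ (b : ℝ) (δ : Fin n → ℝ),
      (∀ X', SamePast t (wk X) X (wk X') X' →
        F X' ≤ b + ∑ a, if SucceedsAt (wk X') X' t a then δ a else 0) ∧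
      b + ∑ a, soleProb (bitProb D) (wk X) t (ContentionResolution.succeededBefore (wk X) X t)ᶜ a
        * δ a ≤ G X) :
    ∫ X, F X ∂(law D n) ≤ ∫ X, G X ∂(law D n) := by
  refine h.integral_le_of_step hD t hF hG fun X => ?_
  obtain ⟨b, δ, h1, h2⟩ := hstep X
  refine le_trans (slot_integral_le D (wk X) t _ (mixBits_finDep_right hF _ X) b δ fun Y => ?_) h2
  refine (h1 _ (h.samePast_mix t X Y)).trans (le_of_eq ?_)
  simp only [h.succeedsAt_mix]

open Classical in
theorem NonAnticipating.supermartingale {D : LocalClockProtocol} (hD : IsMemoryless D)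
    (h : NonAnticipating wk) {M : ℕ → Bits n → ℝ} (t₀ : ℕ)
    (hdep : ∀ t, t₀ ≤ t → FinDep t (M t)) (t₁ : ℕ) (ht : t₀ ≤ t₁)
    (hstep : ∀ t X, t₀ ≤ t → t < t₁ → ∃ (b : ℝ) (δ : Fin n → ℝ),
      (∀ X', SamePast t (wk X) X (wk X') X' →
        M (t + 1) X' ≤ b + ∑ a, if SucceedsAt (wk X') X' t a then δ a else 0) ∧
      b + ∑ a, soleProb (bitProb D) (wk X) t (ContentionResolution.succeededBefore (wk X) X t)ᶜ a
        * δ a ≤ M t X) :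
    ∫ X, M t₁ X ∂(law D n) ≤ ∫ X, M t₀ X ∂(law D n) := by
  induction t₁, ht using Nat.le_induction with
  | base => exact le_rfl
  | succ t ht ih =>
    refine (h.step_le hD t (hdep _ (by omega)) ((hdep t ht).mono (Nat.le_succ t))
      fun X => hstep t X ht (Nat.lt_succ_self t)).trans (ih fun s X h1 h2 => hstep s X h1 (by omega))

end SamePast

/-! ### Bounds for one slot -/

theorem exp_neg_two_mul_le {q : ℝ} (h0 : 0 ≤ q) (h1 : q ≤ 1 / 2) :
    Real.exp (-(2 * q)) ≤ 1 - q := by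
  rw [Real.exp_neg, inv_le_iff_one_le_mul₀ (Real.exp_pos _)]
  have : 2 * q + 1 ≤ Real.exp (2 * q) := Real.add_one_le_exp _
  nlinarith

section soleProb

variable {n : ℕ} {p : ℕ → ℝ} {w : Fin n → ℕ∞} {t : ℕ} {A : Set (Fin n)} {a : Fin n}

open Classical in
theorem soleProb_nonneg (h0 : ∀ k, 0 ≤ p k) (h1 : ∀ k, p k ≤ 1) : 0 ≤ soleProb p w t A a := by
  unfold soleProb
  split_ifs
  · exact mul_nonneg (rate_nonneg h0 _ _ _) (Finset.prod_nonneg fun v _ =>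
      sub_nonneg.2 (rate_le zero_le_one h1 _ _ _))
  · exact le_rfl

open Classical in
-- Each factor `1 - q` with `q ≤ 1/2` is at least `exp (-2 q)`; this is where the exponent `2 H` of
-- the medium slots comes from.
theorem soleProb_ge (h0 : ∀ k, 0 ≤ p k) (h1 : ∀ k, p k ≤ 1 / 2) (ha : a ∈ A) :
    rate p w t a * Real.exp (-(2 * ∑ v ∈ Finset.univ.filter (fun v => v ∈ A ∧ v ≠ a),
      rate p w t v)) ≤ soleProb p w t A a := by
  unfold soleProb
  rw [if_pos ha, Finset.mul_sum, ← Finset.sum_neg_distrib, Real.exp_sum]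
  refine mul_le_mul_of_nonneg_left (Finset.prod_le_prod (fun v _ => (Real.exp_pos _).le)
    fun v _ => ?_) (rate_nonneg h0 _ _ _)
  exact exp_neg_two_mul_le (rate_nonneg h0 _ _ _) (rate_le (by norm_num) h1 _ _ _)

open Classical in
-- Any subset `J` of the contenders and any minorant `f` of the probabilities bound the contention
-- from below. The share of `a` is subtracted since `a` may belong to `J`.
theorem soleProb_le {f : ℕ → ℝ} (h0 : ∀ k, 0 ≤ p k) (h1 : ∀ k, p k ≤ 1) (hf0 : ∀ k, 0 ≤ f k)
    (hf : ∀ k, f k ≤ p k)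
    {J : Finset (Fin n)} (hJ : ∀ v ∈ J, v ∈ A) :
    soleProb p w t A a ≤ rate p w t a * Real.exp (-(∑ v ∈ J, rate f w t v - rate f w t a)) := by
  unfold soleProb
  split_ifs with ha
  · refine mul_le_mul_of_nonneg_left ?_ (rate_nonneg h0 _ _ _)
    have h2 : ∑ v ∈ J, rate f w t v - rate f w t a ≤
        ∑ v ∈ Finset.univ.filter (fun v => v ∈ A ∧ v ≠ a), rate p w t v := by
      have : ∑ v ∈ J, rate f w t v ≤ ∑ v ∈ J.erase a, rate f w t v + rate f w t a := by
        by_cases haJ : a ∈ J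
        · rw [Finset.sum_erase_add _ _ haJ]
        · rw [Finset.erase_eq_of_notMem haJ]
          linarith [rate_nonneg hf0 w t a]
      have h3 : ∑ v ∈ J.erase a, rate f w t v ≤ ∑ v ∈ J.erase a, rate p w t v :=
        Finset.sum_le_sum fun v _ => rate_mono hf _ _ _
      have h4 : ∑ v ∈ J.erase a, rate p w t v ≤
          ∑ v ∈ Finset.univ.filter (fun v => v ∈ A ∧ v ≠ a), rate p w t v := by
        refine Finset.sum_le_sum_of_subset_of_nonneg ?_ fun v _ _ => rate_nonneg h0 _ _ _
        intro v hv
        rw [Finset.mem_erase] at hv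
        simp [hv.1, hJ v hv.2]
      linarith
    calc ∏ v ∈ Finset.univ.filter (fun v => v ∈ A ∧ v ≠ a), (1 - rate p w t v)
        ≤ ∏ v ∈ Finset.univ.filter (fun v => v ∈ A ∧ v ≠ a), Real.exp (-rate p w t v) :=
          Finset.prod_le_prod (fun v _ => sub_nonneg.2 (rate_le zero_le_one h1 _ _ _))
            fun v _ => Real.one_sub_le_exp_neg _
      _ = Real.exp (-∑ v ∈ Finset.univ.filter (fun v => v ∈ A ∧ v ≠ a), rate p w t v) := by
          rw [← Real.exp_sum, Finset.sum_neg_distrib]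
      _ ≤ _ := Real.exp_le_exp.2 (neg_le_neg h2)
  · exact mul_nonneg (rate_nonneg h0 _ _ _) (Real.exp_pos _).le

end soleProb

/-! ### Latencies -/

theorem succeedsAt_lt {n : ℕ} {w : Fin n → ℕ∞} {X : Bits n} {t : ℕ} {u : Fin n}
    (h : SucceedsAt w X t u) : w u < t := by
  obtain ⟨k, hk, -⟩ := h.fires
  exact ((slotBits_eq w t u k).1 hk).1

/-- The last admissible slot is `a + l`, and `succeededBefore` counts the slots strictly before its
argument. -/
theorem latency_le_iff {n : ℕ} {w : Fin n → ℕ∞} {X : Bits n} {u : Fin n} {a : ℕ} (ha : w u = a)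
    (l : ℕ) : latency w X u ≤ l ↔ u ∈ succeededBefore w X (a + l + 1) := by
  have htop : w u ≠ ⊤ := by rw [ha]; exact ENat.natCast_ne_top a
  rw [mem_succeededBefore, latency, if_neg htop, ← ENat.lt_add_one_iff (ENat.natCast_ne_top l)]
  simp only [iInf_lt_iff]
  constructor
  · rintro ⟨i, ⟨t, ht, hs⟩, hi⟩
    refine ⟨t, ?_, hs⟩
    rw [ha] at ht
    norm_cast at ht hi
    omega
  · rintro ⟨s, hs, h⟩
    have := succeedsAt_lt h
    rw [ha] at this
    norm_cast at this
    refine ⟨s - a, ⟨s, ?_, h⟩, ?_⟩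
    · rw [ha]; norm_cast; omega
    · norm_cast; omega

theorem latency_eq_zero_of_top {n : ℕ} {w : Fin n → ℕ∞} {X : Bits n} {u : Fin n} (h : w u = ⊤) :
    latency w X u = 0 := if_pos h

/-! ### Adaptive adversaries are non-anticipating -/

section Adaptive

variable {n : ℕ} (A : AdaptiveAdversary n)

theorem wakeBefore_eq_top_or_lt (X : Bits n) (t : ℕ) (v : Fin n) :
    wakeBefore A X t v = ⊤ ∨ ∃ j : ℕ, j < t ∧ wakeBefore A X t v = j := by
  induction t with
  | zero => left; rfl
  | succ t ih =>
    simp only [wakeBefore]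
    split_ifs with h
    · exact Or.inr ⟨t, by omega, rfl⟩
    · rcases ih with ih | ⟨j, hj, ih⟩
      · exact Or.inl ih
      · exact Or.inr ⟨j, by omega, ih⟩

theorem wakeBefore_stable (X : Bits n) {s t : ℕ} (hst : s ≤ t) (v : Fin n) {j : ℕ}
    (h : wakeBefore A X s v = j) : wakeBefore A X t v = j := by
  induction t, hst using Nat.le_induction with
  | base => exact h
  | succ t _ ih =>
    simp only [wakeBefore]
    rw [if_neg, ih]
    rw [ih]
    simp

/-- A finite wake-up time is never revised, and decisions from time `t` on only produce times that
are at least `t`. So a wake-up time below `t` is already fixed after `t` steps. -/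
theorem wakeBefore_eq_iff (X : Bits n) {t j : ℕ} (hj : j < t) (v : Fin n) :
    adaptiveWake n A X v = j ↔ wakeBefore A X t v = j := by
  constructor
  · intro h
    obtain ⟨s, hs⟩ : ∃ s, wakeBefore A X s v = j := by
      by_contra hne
      push Not at hne
      have hall : ∀ s, wakeBefore A X s v ≠ j := hne
      have : (j : ℕ∞) < adaptiveWake n A X v := by
        have h1 : ((j : ℕ∞) + 1) ≤ adaptiveWake n A X v := by
          refine le_iInf fun s => ?_
          have h2 : adaptiveWake n A X v ≤ wakeBefore A X s v := iInf_le _ s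
          rw [h] at h2
          exact Order.add_one_le_of_lt (lt_of_le_of_ne h2 (hall s).symm)
        exact lt_of_lt_of_le (ENat.lt_add_one_iff (ENat.natCast_ne_top j) |>.2 le_rfl) h1
      rw [h] at this
      exact lt_irrefl _ this
    rcases wakeBefore_eq_top_or_lt A X t v with ht | ⟨i, hi, ht⟩
    · exfalso
      have hjs : t < s := by
        by_contra hts
        rw [wakeBefore_stable A X (by omega : s ≤ t) v hs] at ht
        exact ENat.natCast_ne_top _ ht
      have key : ∀ r, t ≤ r → wakeBefore A X r v = ⊤ ∨ ∃ i : ℕ, t ≤ i ∧ wakeBefore A X r v = i := by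
        intro r hr
        induction r, hr using Nat.le_induction with
        | base => exact Or.inl ht
        | succ r hr ih =>
          simp only [wakeBefore]
          split_ifs
          · exact Or.inr ⟨r, hr, rfl⟩
          · exact ih
      rcases key s hjs.le with h1 | ⟨i, hi, h1⟩
      · rw [hs] at h1; exact ENat.natCast_ne_top _ h1
      · rw [hs] at h1; norm_cast at h1; omega
    · rcases le_total s t with h1 | h1
      · exact wakeBefore_stable A X h1 v hs
      · rw [ht, ← hs, wakeBefore_stable A X h1 v ht]
  · intro h
    refine le_antisymm (h ▸ iInf_le _ t) (le_iInf fun s => ?_)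
    rcases wakeBefore_eq_top_or_lt A X s v with hs | ⟨i, hi, hs⟩
    · rw [hs]; exact le_top
    · have h1 := wakeBefore_stable A X (le_max_left s t) v hs
      have h2 := wakeBefore_stable A X (le_max_right s t) v h
      rw [hs, ← h1, h2]

/-- By induction on the decision times: the history through a slot before `t` shows only bits on
which the two executions agree. -/
theorem nonAnticipating_adaptiveWake : NonAnticipating (adaptiveWake n A) := by
  intro t X X' hX
  have key : ∀ s ≤ t, wakeBefore A X s = wakeBefore A X' s := by
    intro s
    induction s with
    | zero => intro _; rfl
    | succ s ih =>
      intro hs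
      have ih := ih (by omega)
      have hh : history (wakeBefore A X s) X s = history (wakeBefore A X' s) X' s := by
        rw [← ih]
        funext v k
        simp only [history]
        split_ifs with hk
        · congr 1
          refine hX v k ?_
          rcases wakeBefore_eq_top_or_lt A X s v with h | ⟨j, hj, h⟩
          · rw [h] at hk; simp at hk
          · rw [(wakeBefore_eq_iff A X hj v).2 h, ← h]
            exact lt_of_le_of_lt hk (by exact_mod_cast hs)
        · rfl
      funext v
      simp only [wakeBefore]
      rw [hh, ih]
  intro v j hj
  rw [wakeBefore_eq_iff A X hj, wakeBefore_eq_iff A X' hj, key t le_rfl]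

end Adaptive

/-! ### Antitone sums -/

/-- The maximum of `s` is at least the number of its other elements, so moving the elements down to
an initial segment only increases an antitone `p`. -/
theorem sum_le_sum_range_card {p : ℕ → ℝ} (hp : Antitone p) (s : Finset ℕ) :
    ∑ k ∈ s, p k ≤ ∑ k ∈ Finset.range s.card, p k := by
  induction s using Finset.induction_on_max with
  | empty => simp
  | insert a s hs ih =>
    have ha : a ∉ s := fun h => lt_irrefl _ (hs a h)
    rw [Finset.sum_insert ha, Finset.card_insert_of_notMem ha, Finset.sum_range_succ]
    have : s.card ≤ a := by
      have := Finset.card_le_card (fun x hx => Finset.mem_range.2 (hs x hx) : s ⊆ Finset.range a)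
      simpa using this
    linarith [hp this]

/-- At most `B` ages are missing from `G`, and they take away the most if they are the first `B`
ones. -/
theorem sum_Ico_le_of_card {p : ℕ → ℝ} (hp : Antitone p) (h0 : ∀ k, 0 ≤ p k) {x B : ℕ}
    {G : Finset ℕ} (hG : G ⊆ Finset.range x) (hcard : x ≤ G.card + B) :
    ∑ k ∈ Finset.Ico B x, p k ≤ ∑ k ∈ G, p k := by
  rcases le_total x B with hxB | hxB
  · rw [Finset.Ico_eq_empty_of_le hxB, Finset.sum_empty]
    exact Finset.sum_nonneg fun k _ => h0 k
  have h1 : ∑ k ∈ Finset.range x \ G, p k + ∑ k ∈ G, p k = ∑ k ∈ Finset.range x, p k :=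
    Finset.sum_sdiff hG
  have h2 : ∑ k ∈ Finset.range x \ G, p k ≤ ∑ k ∈ Finset.range B, p k := by
    refine (sum_le_sum_range_card hp _).trans ?_
    refine Finset.sum_le_sum_of_subset_of_nonneg (Finset.range_mono ?_) fun k _ _ => h0 k
    rw [Finset.card_sdiff_of_subset hG, Finset.card_range]
    omega
  have h3 := Finset.sum_range_add_sum_Ico p hxB
  linarith

/-- Different slots of the window meet `v` at different ages, so at most `x` distinct ages occur,
whenever `v` is woken up. -/
theorem sum_rate_window_le {p : ℕ → ℝ} (hp : Antitone p) (h0 : ∀ k, 0 ≤ p k) {n : ℕ}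
    (w : Fin n → ℕ∞) (v : Fin n) (a x : ℕ) :
    ∑ k ∈ Finset.range x, rate p w (a + k + 1) v ≤ ∑ k ∈ Finset.range x, p k := by
  classical
  have h1 : ∑ k ∈ Finset.range x, rate p w (a + k + 1) v =
      ∑ k ∈ (Finset.range x).filter (fun k => w v < (a + k + 1 : ℕ)),
        p (a + k + 1 - 1 - (w v).toNat) := by
    rw [Finset.sum_filter]
    refine Finset.sum_congr rfl fun k _ => ?_
    simp only [rate]
  have hinj : Set.InjOn (fun k => a + k + 1 - 1 - (w v).toNat)
      ((Finset.range x).filter (fun k => w v < (a + k + 1 : ℕ)) : Finset ℕ) := by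
    intro k hk l hl hkl
    simp only [Finset.coe_filter, Set.mem_ofPred_eq] at hk hl hkl
    have htop := ne_top_of_lt hk.2
    obtain ⟨j, hj⟩ := ENat.ne_top_iff_exists.1 htop
    rw [← hj] at hk hl hkl
    have h2 : j < a + k + 1 := by exact_mod_cast hk.2
    have h3 : j < a + l + 1 := by exact_mod_cast hl.2
    rw [ENat.toNat_natCast] at hkl
    omega
  rw [h1, ← Finset.sum_image (f := p) hinj]
  refine (sum_le_sum_range_card hp _).trans
    (Finset.sum_le_sum_of_subset_of_nonneg (Finset.range_mono ?_) fun k _ _ => h0 k)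
  refine Finset.card_image_le.trans ((Finset.card_filter_le _ _).trans ?_)
  rw [Finset.card_range]

/-! ### The two supermartingales behind the upper bounds -/

section Upper

variable {n : ℕ}

/-- In slot `t`, party `u` is awake and has local index less than `x`. -/
def Act (w : Fin n → ℕ∞) (u : Fin n) (x t : ℕ) : Prop := ∃ k < x, w u + k + 1 = t

open Classical in
/-- The contention in slot `t` from the parties of `A` other than `u`. -/
def loadOn (p : ℕ → ℝ) (w : Fin n → ℕ∞) (A : Set (Fin n)) (u : Fin n) (t : ℕ) : ℝ :=
  ∑ v ∈ Finset.univ.filter (fun v => v ∈ A ∧ v ≠ u), rate p w t v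

/-- The contention in slot `t` from the parties other than `u` that have not succeeded. -/
def load (p : ℕ → ℝ) (w : Fin n → ℕ∞) (X : Bits n) (u : Fin n) (t : ℕ) : ℝ :=
  loadOn p w (succeededBefore w X t)ᶜ u t

/-- Party `u` has not succeeded before slot `t` at a local index less than `x`. -/
def Surv (w : Fin n → ℕ∞) (X : Bits n) (u : Fin n) (x t : ℕ) : Prop :=
  ∀ s < t, Act w u x s → ¬ SucceedsAt w X s u

open Classical in
/-- Survival of `u`, compensated by the success probability in slots of low contention. -/
def survWeight (p : ℕ → ℝ) (w : Fin n → ℕ∞) (X : Bits n) (u : Fin n) (x t : ℕ) : ℝ :=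
  if Surv w X u x t then Real.exp (∑ s ∈ Finset.range t,
    if Act w u x s ∧ load p w X u s < 1 then rate p w s u / 8 else 0) else 0

open Classical in
/-- The number of slots of medium contention, compensated by the number of successes. -/
def medWeight (p : ℕ → ℝ) (H : ℝ) (w : Fin n → ℕ∞) (X : Bits n) (u : Fin n) (x t : ℕ) : ℝ :=
  Real.exp ((∑ s ∈ Finset.range t, if Act w u x s ∧ Surv w X u x s ∧ 1 ≤ load p w X u s ∧
    load p w X u s < H then Real.exp (-(2 * H)) / 8 else 0) -
      (succeededBefore w X t).ncard)

variable {t s x : ℕ} {w w' : Fin n → ℕ∞} {X X' : Bits n} {u : Fin n} {p : ℕ → ℝ} {H : ℝ}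

theorem SamePast.act (h : SamePast t w X w' X') (hs : s ≤ t) : Act w u x s ↔ Act w' u x s := by
  simp only [Act, h.slot hs]

theorem SamePast.load (h : SamePast t w X w' X') (hs : s ≤ t) :
    load p w X u s = ContentionResolution.load p w' X' u s := by
  simp only [ContentionResolution.load, loadOn, h.rate hs]
  rw [h.succeededBefore hs]

theorem SamePast.surv (h : SamePast t w X w' X') (hs : s ≤ t) :
    Surv w X u x s ↔ Surv w' X' u x s := by
  refine forall_congr' fun r => forall_congr' fun hr => ?_
  rw [h.act (by omega : r ≤ t), h.succeedsAt (by omega : r < t)]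

theorem SamePast.survWeight (h : SamePast t w X w' X') :
    survWeight p w X u x t = ContentionResolution.survWeight p w' X' u x t := by
  classical
  have : ∑ s ∈ Finset.range t, (if Act w u x s ∧ ContentionResolution.load p w X u s < 1 then
      ContentionResolution.rate p w s u / 8 else 0) = ∑ s ∈ Finset.range t,
      (if Act w' u x s ∧ ContentionResolution.load p w' X' u s < 1 then
      ContentionResolution.rate p w' s u / 8 else 0) := by
    refine Finset.sum_congr rfl fun s hs => ?_
    have hs : s ≤ t := (Finset.mem_range.1 hs).le
    simp only [h.act hs, h.load hs, h.rate hs]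
  simp only [ContentionResolution.survWeight, h.surv le_rfl, this]

theorem SamePast.medWeight (h : SamePast t w X w' X') :
    medWeight p H w X u x t = ContentionResolution.medWeight p H w' X' u x t := by
  classical
  have : ∑ s ∈ Finset.range t, (if Act w u x s ∧ Surv w X u x s ∧
      1 ≤ ContentionResolution.load p w X u s ∧ ContentionResolution.load p w X u s < H then
      Real.exp (-(2 * H)) / 8 else 0) = ∑ s ∈ Finset.range t,
      (if Act w' u x s ∧ Surv w' X' u x s ∧ 1 ≤ ContentionResolution.load p w' X' u s ∧
      ContentionResolution.load p w' X' u s < H then Real.exp (-(2 * H)) / 8 else 0) := by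
    refine Finset.sum_congr rfl fun s hs => ?_
    have hs : s ≤ t := (Finset.mem_range.1 hs).le
    simp only [h.act hs, h.load hs, h.surv hs]
  simp only [ContentionResolution.medWeight, h.succeededBefore le_rfl, this]

theorem surv_succ : Surv w X u x (t + 1) ↔
    Surv w X u x t ∧ (Act w u x t → ¬ SucceedsAt w X t u) := by
  constructor
  · intro h
    exact ⟨fun s hs => h s (by omega), h t (by omega)⟩
  · rintro ⟨h1, h2⟩ s hs
    rcases Nat.lt_succ_iff_lt_or_eq.1 hs with hs | rfl
    · exact h1 s hs
    · exact h2

theorem Surv.not_mem (h : Surv w X u x t) (ha : Act w u x t) : u ∉ succeededBefore w X t := by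
  rw [mem_succeededBefore]
  rintro ⟨s, hs, hsucc⟩
  refine h s hs ?_ hsucc
  obtain ⟨k, hk, hkt⟩ := ha
  obtain ⟨j, hj, hwj⟩ := slot_exists_wake hkt
  obtain ⟨l, hl, -⟩ := hsucc.fires
  rw [hwj] at hkt hl
  norm_cast at hkt hl
  exact ⟨l, by omega, by rw [hwj]; norm_cast⟩

theorem load_nonneg (h0 : ∀ k, 0 ≤ p k) : 0 ≤ load p w X u t := by
  unfold load loadOn
  exact Finset.sum_nonneg fun v _ => rate_nonneg h0 w t v

theorem exp_two_le_eight : Real.exp 2 ≤ 8 := by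
  have h := Real.exp_one_lt_d9
  have h2 : Real.exp 2 = Real.exp 1 * Real.exp 1 := by rw [← Real.exp_add]; norm_num
  rw [h2]
  nlinarith [Real.exp_pos 1]

theorem eighth_le_exp_neg_two : (1 / 8 : ℝ) ≤ Real.exp (-2) := by
  rw [Real.exp_neg, one_div]
  exact inv_anti₀ (Real.exp_pos _) exp_two_le_eight

open Classical in
-- In a light slot `u` fires alone with probability at least `q * exp (-2) ≥ q / 8`, where `q` is
-- its rate. The factor `1 - q / 8` lost by survival pays for the growth `exp (q / 8)` of the
-- compensator.
theorem survWeight_step (h0 : ∀ k, 0 ≤ p k) (h1 : ∀ k, p k ≤ 1 / 2) (w : Fin n → ℕ∞) (X : Bits n)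
    (u : Fin n) (x t : ℕ) : ∃ (b : ℝ) (δ : Fin n → ℝ),
    (∀ w' X', SamePast t w X w' X' →
      survWeight p w' X' u x (t + 1) ≤ b + ∑ a, if SucceedsAt w' X' t a then δ a else 0) ∧
    b + ∑ a, soleProb p w t (succeededBefore w X t)ᶜ a * δ a ≤ survWeight p w X u x t := by
  by_cases hg : (Act w u x t ∧ load p w X u t < 1) ∧ Surv w X u x t
  · obtain ⟨⟨hact, hload⟩, hsurv⟩ := hg
    set b := survWeight p w X u x t * Real.exp (rate p w t u / 8) with hb
    have hb0 : 0 ≤ b := by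
      rw [hb, survWeight, if_pos hsurv]; positivity
    refine ⟨b, fun a => if a = u then -b else 0, ?_, ?_⟩
    · intro w' X' hs
      by_cases hu : SucceedsAt w' X' t u
      · rw [sum_succeedsAt_of _ hu, if_pos rfl, survWeight, if_neg]
        · simp
        · intro h
          exact (surv_succ.1 h).2 ((hs.act le_rfl).1 hact) hu
      · have hz : ∑ a, (if SucceedsAt w' X' t a then (if a = u then -b else 0) else 0) = 0 := by
          refine Finset.sum_eq_zero fun a _ => ?_
          split_ifs with h2 h3
          · subst h3; exact absurd h2 hu
          · rfl
          · rfl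
        rw [hz, add_zero, survWeight, if_pos (surv_succ.2 ⟨(hs.surv le_rfl).1 hsurv, fun _ => hu⟩),
          Finset.sum_range_succ, Real.exp_add, hb, hs.survWeight, survWeight,
          if_pos ((hs.surv le_rfl).1 hsurv),
          if_pos ⟨(hs.act le_rfl).1 hact, (hs.load le_rfl) ▸ hload⟩, hs.rate le_rfl]
    · have hsum : ∑ a, soleProb p w t (succeededBefore w X t)ᶜ a * (if a = u then -b else 0) =
          -(soleProb p w t (succeededBefore w X t)ᶜ u * b) := by
        simp
      rw [hsum]
      have hmem : u ∈ (succeededBefore w X t)ᶜ := hsurv.not_mem hact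
      have h2 := soleProb_ge (w := w) (t := t) h0 h1 hmem
      have h3 : rate p w t u * (1 / 8) ≤ soleProb p w t (succeededBefore w X t)ᶜ u := by
        refine le_trans (mul_le_mul_of_nonneg_left ?_ (rate_nonneg h0 _ _ _)) h2
        refine eighth_le_exp_neg_two.trans (Real.exp_le_exp.2 ?_)
        have : load p w X u t < 1 := hload
        unfold load loadOn at this
        linarith
      set q := rate p w t u
      have h4 : (1 - q / 8) * Real.exp (q / 8) ≤ 1 := by
        have := Real.one_sub_le_exp_neg (q / 8)
        calc (1 - q / 8) * Real.exp (q / 8) ≤ Real.exp (-(q / 8)) * Real.exp (q / 8) :=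
              mul_le_mul_of_nonneg_right this (Real.exp_pos _).le
          _ = 1 := by rw [← Real.exp_add]; simp
      have hS : 0 ≤ survWeight p w X u x t := by rw [survWeight, if_pos hsurv]; positivity
      calc b + -(soleProb p w t (succeededBefore w X t)ᶜ u * b)
          ≤ b + -(q * (1 / 8) * b) := by
            have := mul_le_mul_of_nonneg_right h3 hb0
            linarith
        _ = survWeight p w X u x t * ((1 - q / 8) * Real.exp (q / 8)) := by rw [hb]; ring
        _ ≤ survWeight p w X u x t * 1 := mul_le_mul_of_nonneg_left h4 hS
        _ = _ := mul_one _
  · refine ⟨survWeight p w X u x t, fun _ => 0, ?_, by simp⟩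
    intro w' X' hs
    simp only [ite_self, Finset.sum_const_zero, add_zero]
    rw [hs.survWeight]
    by_cases hsurv : Surv w' X' u x (t + 1)
    · have h2 := (surv_succ.1 hsurv).1
      rw [survWeight, if_pos hsurv, survWeight, if_pos h2, Finset.sum_range_succ, if_neg, add_zero]
      rintro ⟨h3, h4⟩
      exact hg ⟨⟨(hs.act le_rfl).2 h3, (hs.load le_rfl).symm ▸ h4⟩, (hs.surv le_rfl).2 h2⟩
    · rw [survWeight, if_neg hsurv, survWeight]
      split_ifs
      · positivity
      · exact le_rfl

theorem ncard_succ_of_succeedsAt {a : Fin n} (h : SucceedsAt w X t a) :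
    (succeededBefore w X (t + 1)).ncard = (succeededBefore w X t).ncard + 1 := by
  have h1 : succeededBefore w X (t + 1) = insert a (succeededBefore w X t) := by
    ext v
    simp only [mem_succeededBefore, Set.mem_insert_iff]
    constructor
    · rintro ⟨s, hs, hv⟩
      rcases Nat.lt_succ_iff_lt_or_eq.1 hs with hs | rfl
      · exact Or.inr ⟨s, hs, hv⟩
      · exact Or.inl (succeedsAt_unique hv h)
    · rintro (rfl | ⟨s, hs, hv⟩)
      · exact ⟨t, by omega, h⟩
      · exact ⟨s, by omega, hv⟩
  rw [h1, Set.ncard_insert_of_notMem h.not_mem (Set.toFinite _)]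

open Classical in
-- Put `κ = exp (-2 H) / 8`. In a medium slot somebody succeeds with probability at least `2 κ`, and
-- a success multiplies the weight by `exp (-1) ≤ 1/2`. The expected loss of a proportion `κ` pays
-- for the growth `exp κ`.
theorem medWeight_step (h0 : ∀ k, 0 ≤ p k) (h1 : ∀ k, p k ≤ 1 / 2) (w : Fin n → ℕ∞)
    (X : Bits n) (u : Fin n) (x t : ℕ) : ∃ (b : ℝ) (δ : Fin n → ℝ),
    (∀ w' X', SamePast t w X w' X' →
      medWeight p H w' X' u x (t + 1) ≤ b + ∑ a, if SucceedsAt w' X' t a then δ a else 0) ∧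
    b + ∑ a, soleProb p w t (succeededBefore w X t)ᶜ a * δ a ≤ medWeight p H w X u x t := by
  have hpos : 0 < medWeight p H w X u x t := Real.exp_pos _
  by_cases hg : Act w u x t ∧ Surv w X u x t ∧ 1 ≤ load p w X u t ∧ load p w X u t < H
  · set κ := Real.exp (-(2 * H)) / 8 with hκ
    set b := medWeight p H w X u x t * Real.exp κ with hb
    have hb0 : 0 < b := by positivity
    refine ⟨b, fun _ => -(b / 2), ?_, ?_⟩
    · intro w' X' hs
      have hg' : Act w' u x t ∧ Surv w' X' u x t ∧ 1 ≤ load p w' X' u t ∧ load p w' X' u t < H := by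
        rw [← hs.act le_rfl, ← hs.surv le_rfl, ← hs.load le_rfl]; exact hg
      by_cases hu : ∃ a, SucceedsAt w' X' t a
      · obtain ⟨a, ha⟩ := hu
        rw [sum_succeedsAt_of _ ha, medWeight, Finset.sum_range_succ, if_pos hg',
          ncard_succ_of_succeedsAt ha, hb, hs.medWeight, medWeight]
        set m := (succeededBefore w' X' t).ncard
        set σ := ∑ s ∈ Finset.range t, (if Act w' u x s ∧ Surv w' X' u x s ∧
          1 ≤ load p w' X' u s ∧ load p w' X' u s < H then κ else 0)
        have e1 : Real.exp (σ + κ - ((m + 1 : ℕ) : ℝ)) =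
            Real.exp (σ - m) * Real.exp κ * Real.exp (-1) := by
          rw [← Real.exp_add, ← Real.exp_add]; push_cast; congr 1; ring
        rw [e1]
        have e2 : Real.exp (-1) ≤ 1 / 2 := by
          have := Real.exp_neg_one_lt_d9; linarith
        have e3 : 0 < Real.exp (σ - m) * Real.exp κ := by positivity
        nlinarith
      · push Not at hu
        rw [sum_succeedsAt_none _ hu, add_zero, medWeight, Finset.sum_range_succ, if_pos hg', hb,
          hs.medWeight, medWeight, ← Real.exp_add]
        refine Real.exp_le_exp.2 ?_
        have : (succeededBefore w' X' t).ncard ≤ (succeededBefore w' X' (t + 1)).ncard :=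
          Set.ncard_le_ncard (succeededBefore_mono w' X' (Nat.le_succ t)) (Set.toFinite _)
        have : ((succeededBefore w' X' t).ncard : ℝ) ≤ (succeededBefore w' X' (t + 1)).ncard := by
          exact_mod_cast this
        linarith
    · obtain ⟨hact, hsurv, hl1, hlH⟩ := hg
      have hmem : u ∈ (succeededBefore w X t)ᶜ := hsurv.not_mem hact
      unfold load at hl1 hlH
      generalize (succeededBefore w X t)ᶜ = A at *
      have hsum : ∑ a, soleProb p w t A a * -(b / 2) = -((∑ a, soleProb p w t A a) * (b / 2)) := by
        rw [Finset.sum_mul, ← Finset.sum_neg_distrib]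
        exact Finset.sum_congr rfl fun a _ => by ring
      rw [hsum]
      -- The competitors of `a` are contained in the parties counted by the load together with `u`,
      -- whose rate is at most `1/2`. The exponent is thus at least `-(2 H + 1)`, and the
      -- contention, at least `1`, multiplies the exponential.
      have hκle : 2 * κ ≤ ∑ a, soleProb p w t A a := by
        calc 2 * κ ≤ 1 * (Real.exp (-(2 * H)) * Real.exp (-1)) := by
              have : (1 : ℝ) / 4 ≤ Real.exp (-1) := by
                have := Real.exp_neg_one_gt_d9; linarith
              rw [hκ]
              nlinarith [Real.exp_pos (-(2 * H))]
          _ ≤ loadOn p w A u t * (Real.exp (-(2 * H)) * Real.exp (-1)) := by gcongr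
          _ = ∑ a ∈ Finset.univ.filter (fun v => v ∈ A ∧ v ≠ u),
                rate p w t a * (Real.exp (-(2 * H)) * Real.exp (-1)) := by
              rw [loadOn, Finset.sum_mul]
          _ ≤ ∑ a ∈ Finset.univ.filter (fun v => v ∈ A ∧ v ≠ u), soleProb p w t A a := by
              refine Finset.sum_le_sum fun a ha => ?_
              rw [Finset.mem_filter] at ha
              refine le_trans (mul_le_mul_of_nonneg_left ?_ (rate_nonneg h0 _ _ _))
                (soleProb_ge h0 h1 ha.2.1)
              rw [← Real.exp_add]
              refine Real.exp_le_exp.2 ?_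
              have h5 : ∑ v ∈ Finset.univ.filter (fun v => v ∈ A ∧ v ≠ a), rate p w t v ≤
                  loadOn p w A u t + 1 / 2 := by
                calc ∑ v ∈ Finset.univ.filter (fun v => v ∈ A ∧ v ≠ a), rate p w t v
                    ≤ ∑ v ∈ insert u (Finset.univ.filter (fun v => v ∈ A ∧ v ≠ u)),
                        rate p w t v := by
                      refine Finset.sum_le_sum_of_subset_of_nonneg ?_
                        fun v _ _ => rate_nonneg h0 _ _ _
                      intro v hv
                      simp only [Finset.mem_insert, Finset.mem_filter, Finset.mem_univ,
                        true_and] at hv ⊢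
                      by_cases hvu : v = u
                      · exact Or.inl hvu
                      · exact Or.inr ⟨hv.1, hvu⟩
                  _ = rate p w t u + loadOn p w A u t := by
                      rw [Finset.sum_insert (by simp), loadOn]
                  _ ≤ _ := by linarith [rate_le (by norm_num : (0:ℝ) ≤ 1/2) h1 w t u]
              linarith
          _ ≤ ∑ a, soleProb p w t A a :=
              Finset.sum_le_sum_of_subset_of_nonneg (Finset.subset_univ _)
                fun a _ _ => soleProb_nonneg h0 fun k => (h1 k).trans (by norm_num)
      have h4 : (1 - κ) * Real.exp κ ≤ 1 := by
        have := Real.one_sub_le_exp_neg κ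
        calc (1 - κ) * Real.exp κ ≤ Real.exp (-κ) * Real.exp κ :=
              mul_le_mul_of_nonneg_right this (Real.exp_pos _).le
          _ = 1 := by rw [← Real.exp_add]; simp
      calc b + -((∑ a, soleProb p w t A a) * (b / 2)) ≤ b + -((2 * κ) * (b / 2)) := by
            have := mul_le_mul_of_nonneg_right hκle (by positivity : 0 ≤ b / 2)
            linarith
        _ = medWeight p H w X u x t * ((1 - κ) * Real.exp κ) := by rw [hb]; ring
        _ ≤ medWeight p H w X u x t * 1 := mul_le_mul_of_nonneg_left h4 hpos.le
        _ = _ := mul_one _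
  · refine ⟨medWeight p H w X u x t, fun _ => 0, ?_, by simp⟩
    intro w' X' hs
    simp only [ite_self, Finset.sum_const_zero, add_zero]
    rw [hs.medWeight, medWeight, medWeight, Finset.sum_range_succ, if_neg, add_zero]
    · refine Real.exp_le_exp.2 ?_
      have : (succeededBefore w' X' t).ncard ≤ (succeededBefore w' X' (t + 1)).ncard :=
        Set.ncard_le_ncard (succeededBefore_mono w' X' (Nat.le_succ t)) (Set.toFinite _)
      have : ((succeededBefore w' X' t).ncard : ℝ) ≤ (succeededBefore w' X' (t + 1)).ncard := by
        exact_mod_cast this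
      linarith
    · rw [← hs.act le_rfl, ← hs.surv le_rfl, ← hs.load le_rfl]; exact hg

end Upper

/-! ### The tail of the latency -/

section Tail

variable {n : ℕ}

theorem sum_act_eq {w : Fin n → ℕ∞} {u : Fin n} {a x t : ℕ} (ha : w u = a) (ht : a + x + 1 ≤ t)
    (Q : ℕ → Prop) (f : ℕ → ℝ) [DecidablePred fun s => Act w u x s ∧ Q s]
    [DecidablePred fun k => Q (a + k + 1)] :
    ∑ s ∈ Finset.range t, (if Act w u x s ∧ Q s then f s else 0) =
      ∑ k ∈ (Finset.range x).filter (fun k => Q (a + k + 1)), f (a + k + 1) := by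
  have hact : ∀ s, Act w u x s ↔ ∃ k < x, a + k + 1 = s := by
    intro s
    simp only [Act, ha]
    norm_cast
  rw [← Finset.sum_filter, ← Finset.sum_image (f := f) (g := fun k => a + k + 1)
    (fun k _ l _ h => by simpa using h)]
  refine Finset.sum_congr ?_ fun _ _ => rfl
  ext s
  simp only [Finset.mem_filter, Finset.mem_range, hact, Finset.mem_image]
  constructor
  · rintro ⟨-, ⟨k, hk, rfl⟩, hQ⟩
    exact ⟨k, ⟨hk, hQ⟩, rfl⟩
  · rintro ⟨k, ⟨hk, hQ⟩, rfl⟩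
    exact ⟨by omega, ⟨k, hk, rfl⟩, hQ⟩

theorem sum_load_le {p : ℕ → ℝ} (hp : Antitone p) (h0 : ∀ k, 0 ≤ p k) (w : Fin n → ℕ∞)
    (X : Bits n) (u : Fin n) (a x : ℕ) :
    ∑ k ∈ Finset.range x, load p w X u (a + k + 1) ≤ n * ∑ k ∈ Finset.range x, p k := by
  classical
  calc ∑ k ∈ Finset.range x, load p w X u (a + k + 1)
      ≤ ∑ k ∈ Finset.range x, ∑ v, rate p w (a + k + 1) v := by
        refine Finset.sum_le_sum fun k _ => ?_
        unfold load loadOn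
        exact Finset.sum_le_sum_of_subset_of_nonneg (Finset.subset_univ _)
          fun v _ _ => rate_nonneg h0 _ _ _
    _ = ∑ v, ∑ k ∈ Finset.range x, rate p w (a + k + 1) v := Finset.sum_comm
    _ ≤ ∑ _v : Fin n, ∑ k ∈ Finset.range x, p k :=
        Finset.sum_le_sum fun v _ => sum_rate_window_le hp h0 w v a x
    _ = _ := by simp

/-- The heavy slots number at most `n P / H`, with `P` the mass of the first `x` ages. If there are
at least `M` medium slots, `medWeight` is large, since at most `n` successes are subtracted.
Otherwise at most `B` of the first `x` ages of `u` are not light, and the exponent of `survWeight`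
contains at least the mass of the ages from `B` on. -/
theorem weight_large_of_latency {p : ℕ → ℝ} (hp : Antitone p) (h0 : ∀ k, 0 ≤ p k)
    {w : Fin n → ℕ∞} {X : Bits n} {u : Fin n} {a x B M t : ℕ} {H : ℝ} (hH : 1 ≤ H)
    (hB : n * (∑ k ∈ Finset.range x, p k) / H + M ≤ B) (ha : w u = a) (ht : a + x + 1 ≤ t)
    (hlat : (x : ℕ∞) < latency w X u) :
    Real.exp ((∑ k ∈ Finset.Ico B x, p k) / 8) ≤ survWeight p w X u x t ∨
      Real.exp (Real.exp (-(2 * H)) / 8 * M - n) ≤ medWeight p H w X u x t := by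
  classical
  have hnot : u ∉ succeededBefore w X (a + x + 1) := by
    rw [← latency_le_iff ha]; exact not_le.2 hlat
  have hsurv : ∀ s ≤ t, Surv w X u x s := by
    rintro s hs r hr ⟨k, hk, hkr⟩ hsucc
    rw [ha] at hkr
    norm_cast at hkr
    exact hnot (mem_succeededBefore.2 ⟨r, by omega, hsucc⟩)
  set κ := Real.exp (-(2 * H)) / 8 with hκ
  have hκ0 : 0 ≤ κ := by positivity
  set G := (Finset.range x).filter (fun k => load p w X u (a + k + 1) < 1) with hG
  set Md := (Finset.range x).filter (fun k => 1 ≤ load p w X u (a + k + 1) ∧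
    load p w X u (a + k + 1) < H) with hMd
  set Hv := (Finset.range x).filter (fun k => H ≤ load p w X u (a + k + 1)) with hHv
  by_cases hm : M ≤ Md.card
  · right
    rw [medWeight]
    have h1 : ∑ s ∈ Finset.range t, (if Act w u x s ∧ Surv w X u x s ∧ 1 ≤ load p w X u s ∧
        load p w X u s < H then κ else 0) = Md.card * κ := by
      have h2 : ∑ s ∈ Finset.range t, (if Act w u x s ∧ Surv w X u x s ∧ 1 ≤ load p w X u s ∧
          load p w X u s < H then κ else 0) = ∑ s ∈ Finset.range t, (if Act w u x s ∧
          (1 ≤ load p w X u s ∧ load p w X u s < H) then κ else 0) := by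
        refine Finset.sum_congr rfl fun s hs => ?_
        simp only [hsurv s (Finset.mem_range.1 hs).le, true_and]
      rw [h2, sum_act_eq ha ht (fun s => 1 ≤ load p w X u s ∧ load p w X u s < H) fun _ => κ]
      simp [hMd]
    rw [h1]
    refine Real.exp_le_exp.2 ?_
    have h3 : ((succeededBefore w X t).ncard : ℝ) ≤ n := by
      have := Set.ncard_le_card (succeededBefore w X t)
      rw [Nat.card_eq_fintype_card, Fintype.card_fin] at this
      exact_mod_cast this
    have h4 : (M : ℝ) ≤ Md.card := by exact_mod_cast hm
    nlinarith
  · left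
    rw [survWeight, if_pos (hsurv t le_rfl),
      sum_act_eq ha ht (fun s => load p w X u s < 1) fun s => rate p w s u / 8]
    refine Real.exp_le_exp.2 ?_
    have h1 : ∀ k, rate p w (a + k + 1) u = p k := fun k =>
      rate_eq_of_eq p (by rw [ha]; norm_cast)
    simp only [h1]
    rw [← Finset.sum_div]
    refine div_le_div_of_nonneg_right ?_ (by norm_num)
    refine sum_Ico_le_of_card hp h0 (Finset.filter_subset _ _) ?_
    have hheavy : (Hv.card : ℝ) ≤ n * (∑ k ∈ Finset.range x, p k) / H := by
      rw [le_div_iff₀ (by linarith)]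
      calc (Hv.card : ℝ) * H = ∑ k ∈ Hv, H := by simp
        _ ≤ ∑ k ∈ Hv, load p w X u (a + k + 1) :=
            Finset.sum_le_sum fun k hk => (Finset.mem_filter.1 hk).2
        _ ≤ ∑ k ∈ Finset.range x, load p w X u (a + k + 1) :=
            Finset.sum_le_sum_of_subset_of_nonneg (Finset.filter_subset _ _)
              fun k _ _ => load_nonneg h0
        _ ≤ _ := sum_load_le hp h0 w X u a x
    have hcov : x ≤ G.card + (Md.card + Hv.card) := by
      have : Finset.range x ⊆ G ∪ (Md ∪ Hv) := by
        intro k hk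
        simp only [hG, hMd, hHv, Finset.mem_union, Finset.mem_filter, hk, true_and]
        rcases lt_or_ge (load p w X u (a + k + 1)) 1 with h | h
        · exact Or.inl h
        · rcases lt_or_ge (load p w X u (a + k + 1)) H with h' | h'
          · exact Or.inr (Or.inl ⟨h, h'⟩)
          · exact Or.inr (Or.inr h')
      have := Finset.card_le_card this
      rw [Finset.card_range] at this
      refine this.trans ((Finset.card_union_le _ _).trans ?_)
      have := Finset.card_union_le Md Hv
      omega
    have hB' : ((Md.card + Hv.card : ℕ) : ℝ) ≤ B := by
      have : (Md.card : ℝ) ≤ M := by exact_mod_cast (not_le.1 hm).le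
      push_cast
      linarith
    have : Md.card + Hv.card ≤ B := by exact_mod_cast hB'
    have hcard : G.card = ((Finset.range x).filter
        (fun k => load p w X u (a + k + 1) < 1)).card := rfl
    refine hcov.trans (le_trans (Nat.add_le_add_left this _) (le_of_eq ?_))
    congr

/-- Both weights have expectation at most `1`, so Markov's inequality applies to the alternative in
`weight_large_of_latency`. -/
theorem latency_tail {D : LocalClockProtocol} (hD : IsMemoryless D) (hp : Antitone (bitProb D))
    (h1 : ∀ k, bitProb D k ≤ 1 / 2) {wk : Bits n → Fin n → ℕ∞} (hwk : NonAnticipating wk)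
    (u : Fin n) {x B M : ℕ} {H : ℝ} (hH : 1 ≤ H)
    (hB : n * (∑ k ∈ Finset.range x, bitProb D k) / H + M ≤ B) :
    law D n {X | (x : ℕ∞) < latency (wk X) X u} ≤ ENNReal.ofReal
      (Real.exp (-((∑ k ∈ Finset.Ico B x, bitProb D k) / 8)) +
        Real.exp (n - Real.exp (-(2 * H)) / 8 * M)) := by
  set p := bitProb D with hpdef
  have h0 : ∀ k, 0 ≤ p k := bitProb_nonneg D
  have hS : ∀ t, FinDep t fun X : Bits n => survWeight p (wk X) X u x t := fun t =>
    hwk.finDep_of_samePast (Φ := fun w X => survWeight p w X u x t) fun _ _ _ _ h => h.survWeight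
  have hM : ∀ t, FinDep t fun X : Bits n => medWeight p H (wk X) X u x t := fun t =>
    hwk.finDep_of_samePast (Φ := fun w X => medWeight p H w X u x t) fun _ _ _ _ h => h.medWeight
  have hSE : ∀ t, ∫ X, survWeight p (wk X) X u x t ∂(law D n) ≤ 1 := by
    intro t
    refine (hwk.supermartingale hD 0 (fun t _ => hS t) t (Nat.zero_le t) fun s X _ _ => ?_).trans ?_
    · obtain ⟨b, δ, h2, h3⟩ := survWeight_step h0 h1 (wk X) X u x s
      exact ⟨b, δ, fun X' hs => h2 _ _ hs, h3⟩
    · have : ∀ X : Bits n, survWeight p (wk X) X u x 0 = 1 := fun X => by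
        simp [survWeight, Surv]
      simp [this]
  have hME : ∀ t, ∫ X, medWeight p H (wk X) X u x t ∂(law D n) ≤ 1 := by
    intro t
    refine (hwk.supermartingale hD 0 (fun t _ => hM t) t (Nat.zero_le t) fun s X _ _ => ?_).trans ?_
    · obtain ⟨b, δ, h2, h3⟩ := medWeight_step (H := H) h0 h1 (wk X) X u x s
      exact ⟨b, δ, fun X' hs => h2 _ _ hs, h3⟩
    · have : ∀ X : Bits n, medWeight p H (wk X) X u x 0 = 1 := fun X => by
        simp [medWeight, succeededBefore]
      simp [this]
  -- The wake-up time of `u` may be random and unbounded. On the event that it is at most `N`, all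
  -- relevant slots lie before one fixed slot, and the resulting bound does not depend on `N`.
  set E : ℕ → Set (Bits n) := fun N => {X | ∃ a ≤ N, wk X u = (a : ℕ) ∧ (x : ℕ∞) < latency (wk X) X u}
    with hE
  have hunion : {X | (x : ℕ∞) < latency (wk X) X u} = ⋃ N, E N := by
    ext X
    simp only [Set.mem_ofPred_eq, Set.mem_iUnion, hE]
    constructor
    · intro h
      have htop : wk X u ≠ ⊤ := fun htop => by
        rw [latency_eq_zero_of_top htop] at h; simp at h
      obtain ⟨a, ha⟩ := ENat.ne_top_iff_exists.1 htop
      exact ⟨a, a, le_rfl, ha.symm, h⟩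
    · rintro ⟨N, a, -, -, h⟩
      exact h
  have hmono : Monotone E := by
    rintro N N' hN X ⟨a, ha, h⟩
    exact ⟨a, ha.trans hN, h⟩
  rw [hunion, hmono.measure_iUnion]
  refine iSup_le fun N => ?_
  set t := N + x + 1
  set c₁ := Real.exp ((∑ k ∈ Finset.Ico B x, p k) / 8)
  set c₂ := Real.exp (Real.exp (-(2 * H)) / 8 * M - n)
  have hsub : E N ⊆ {X | c₁ ≤ survWeight p (wk X) X u x t} ∪
      {X | c₂ ≤ medWeight p H (wk X) X u x t} := by
    rintro X ⟨a, ha, hwa, hlat⟩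
    exact weight_large_of_latency hp h0 hH hB hwa (by omega) hlat
  have hm1 := markov_finDep (D := D) (hS t) (fun X => by
    simp only [survWeight]; split_ifs <;> positivity) (Real.exp_pos _ : 0 < c₁)
  have hm2 := markov_finDep (D := D) (hM t) (fun X => (Real.exp_pos _).le)
    (Real.exp_pos _ : 0 < c₂)
  have e1 : (law D n).real (E N) ≤ Real.exp (-((∑ k ∈ Finset.Ico B x, p k) / 8)) +
      Real.exp (n - Real.exp (-(2 * H)) / 8 * M) := by
    refine (measureReal_mono hsub).trans ((measureReal_union_le _ _).trans (add_le_add ?_ ?_))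
    · refine hm1.trans ?_
      rw [Real.exp_neg, ← one_div]
      exact div_le_div_of_nonneg_right (hSE t) (Real.exp_pos _).le
    · refine hm2.trans ?_
      have e2 : Real.exp (n - Real.exp (-(2 * H)) / 8 * M) = 1 / c₂ := by
        rw [one_div, ← Real.exp_neg, neg_sub]
      rw [e2]
      exact div_le_div_of_nonneg_right (hME t) (Real.exp_pos _).le
  rw [← ofReal_measureReal]
  exact ENNReal.ofReal_le_ofReal e1

theorem measurableSet_lt_latency {wk : Bits n → Fin n → ℕ∞} (hwk : NonAnticipating wk) (u : Fin n)
    (x : ℕ) : MeasurableSet {X | (x : ℕ∞) < latency (wk X) X u} := by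
  have h : {X | (x : ℕ∞) < latency (wk X) X u} =
      ⋃ a : ℕ, {X | wk X u = a ∧ u ∉ succeededBefore (wk X) X (a + x + 1)} := by
    ext X
    simp only [Set.mem_ofPred_eq, Set.mem_iUnion]
    constructor
    · intro h
      have htop : wk X u ≠ ⊤ := fun htop => by
        rw [latency_eq_zero_of_top htop] at h; simp at h
      obtain ⟨a, ha⟩ := ENat.ne_top_iff_exists.1 htop
      refine ⟨a, ha.symm, ?_⟩
      rw [← latency_le_iff ha.symm]; exact not_le.2 h
    · rintro ⟨a, ha, h⟩
      rw [← latency_le_iff ha] at h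
      exact not_le.1 h
  rw [h]
  refine MeasurableSet.iUnion fun a => FinDep.measurableSet (T := a + x + 1) ?_
  refine hwk.finDep_of_samePast (Φ := fun w X => (w u = a ∧ u ∉ succeededBefore w X (a + x + 1)))
    fun w X w' X' h => ?_
  rw [h.wake u a (by omega), h.succeededBefore le_rfl]

end Tail

/-! ### Explicit protocols, and the passage from tails to the latency metrics -/

/-- The memoryless protocol with prescribed bit probabilities. -/
theorem exists_memoryless (p : ℕ → ℝ) (h0 : ∀ k, 0 ≤ p k) (h1 : ∀ k, p k ≤ 1) :
    ∃ D : LocalClockProtocol, IsMemoryless D ∧ bitProb D = p := by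
  let μ : ℕ → Measure Bool := fun k =>
    ENNReal.ofReal (p k) • Measure.dirac true + ENNReal.ofReal (1 - p k) • Measure.dirac false
  have hμ : ∀ k, IsProbabilityMeasure (μ k) := fun k => ⟨by
    simp only [μ, Measure.coe_add, Measure.coe_smul, Pi.add_apply, Pi.smul_apply, measure_univ,
      smul_eq_mul, mul_one]
    rw [← ENNReal.ofReal_add (h0 k) (sub_nonneg.2 (h1 k))]
    simp⟩
  refine ⟨⟨Measure.infinitePi μ, inferInstance⟩, ?_, ?_⟩
  · exact iIndepFun_infinitePi (P := μ) (X := fun _ b => b) fun _ => measurable_id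
  · funext k
    have h : (Measure.infinitePi μ) {x : ℕ → Bool | x k = true} = μ k {true} := by
      rw [← Measure.infinitePi_map_eval μ k, Measure.map_apply (measurable_pi_apply k)
        (measurableSet_singleton _)]
      rfl
    change (Measure.infinitePi μ).real {x : ℕ → Bool | x k = true} = p k
    rw [Measure.real, h]
    simp [μ, h0 k]

theorem sum_one_div_le (x : ℕ) :
    ∑ k ∈ Finset.range x, (1 : ℝ) / ((k : ℝ) + 1) ≤ 1 + Real.log x := by
  have h := harmonic_le_one_add_log x
  rw [harmonic] at h
  push_cast at h
  simpa [one_div] using h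

theorem log_div_le_sum_Ico {c : ℝ} (hc : 0 < c) {B x : ℕ} (h : B ≤ x) :
    Real.log ((x + c) / (B + c)) ≤ ∑ k ∈ Finset.Ico B x, 1 / ((k : ℝ) + c) := by
  induction x, h using Nat.le_induction with
  | base => simp [div_self (by positivity : (B : ℝ) + c ≠ 0)]
  | succ x hx ih =>
    rw [Finset.sum_Ico_succ_top hx]
    have h1 : (((x + 1 : ℕ) : ℝ) + c) / (B + c) = ((x + c) / (B + c)) * (1 + 1 / (x + c)) := by
      push_cast
      field_simp
      ring
    rw [h1, Real.log_mul (by positivity) (by positivity)]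
    have h2 : Real.log (1 + 1 / ((x : ℝ) + c)) ≤ 1 / ((x : ℝ) + c) := by
      have := Real.log_le_sub_one_of_pos (by positivity : 0 < 1 + 1 / ((x : ℝ) + c))
      linarith
    linarith

theorem whpLatency_le {Adv : ℕ → Type} {wake : ∀ n, Adv n → Bits n → Fin n → ℕ∞}
    (hwake : ∀ n A, NonAnticipating (wake n A)) (D : LocalClockProtocol) (n x : ℕ)
    (h : ∀ (A : Adv n) u, law D n {X | (x : ℕ∞) < latency (wake n A X) X u} ≤
      ((n : ℝ≥0∞) ^ 2)⁻¹) : whpLatency wake D n ≤ ENNReal.ofReal x := by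
  have h1 : latencyBound wake D n (((n : ℝ≥0∞) ^ 2)⁻¹) ≤ (x : ℕ∞) := by
    refine sInf_le fun A u => ?_
    have h2 := prob_compl_eq_one_sub (μ := law D n) (measurableSet_lt_latency (hwake n A) u x)
    have h3 : {X | (x : ℕ∞) < latency (wake n A X) X u}ᶜ =
        {X | latency (wake n A X) X u ≤ (x : ℕ∞)} := by
      ext X; simp
    rw [← h3, h2]
    exact tsub_le_tsub_left (h A u) _
  have h4 : whpLatency wake D n ≤ ((x : ℕ∞) : ℝ≥0∞) := by
    unfold whpLatency
    exact_mod_cast h1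
  refine h4.trans (le_of_eq ?_)
  simp

/-- Latencies are split at the values `l * 4 ^ j`. Tails `16 ^ (-j)` against values `4 ^ (j + 1)`
leave a geometric series of ratio `1/4`, and its sum `16 c / 3` is rounded up to `6 c`. An infinite
latency is covered because all terms are then at least `1`. -/
theorem lintegral_latency_le {n : ℕ} {D : LocalClockProtocol} {wk : Bits n → Fin n → ℕ∞}
    (hwk : NonAnticipating wk) (u : Fin n) {l : ℕ} (hl : 1 ≤ l) {c : ℝ} (hc : 0 ≤ c)
    (h : ∀ j : ℕ, law D n {X | ((l * 4 ^ j : ℕ) : ℕ∞) < latency (wk X) X u} ≤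
      ENNReal.ofReal (c * (1 / 16) ^ j)) :
    ∫⁻ X, (latency (wk X) X u : ℝ≥0∞) ∂(law D n) ≤ ENNReal.ofReal ((1 + 6 * c) * l) := by
  classical
  set E : ℕ → Set (Bits n) := fun j => {X | ((l * 4 ^ j : ℕ) : ℕ∞) < latency (wk X) X u} with hE
  have hEm : ∀ j, MeasurableSet (E j) := fun j => measurableSet_lt_latency hwk u _
  have hpt : ∀ X, (latency (wk X) X u : ℝ≥0∞) ≤ (l : ℝ≥0∞) +
      ∑' j, (E j).indicator (fun _ => ((l * 4 ^ (j + 1) : ℕ) : ℝ≥0∞)) X := by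
    intro X
    by_cases htop : latency (wk X) X u = ⊤
    · have : ∑' j, (E j).indicator (fun _ => ((l * 4 ^ (j + 1) : ℕ) : ℝ≥0∞)) X = ⊤ := by
        refine top_le_iff.1 ?_
        rw [← ENNReal.tsum_const_eq_top_of_ne_zero (α := ℕ) (one_ne_zero : (1 : ℝ≥0∞) ≠ 0)]
        refine ENNReal.tsum_le_tsum fun j => ?_
        have hX : X ∈ E j := by
          change ((l * 4 ^ j : ℕ) : ℕ∞) < latency (wk X) X u
          rw [htop]; exact ENat.natCast_lt_top _
        rw [Set.indicator_of_mem hX]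
        have : 1 ≤ l * 4 ^ (j + 1) := Nat.one_le_iff_ne_zero.2 (by positivity)
        exact_mod_cast this
      rw [this]; simp
    · obtain ⟨m, hm⟩ := ENat.ne_top_iff_exists.1 htop
      rw [← hm]
      by_cases hml : m ≤ l
      · refine le_trans ?_ le_self_add
        simp only [ENat.toENNReal_coe]
        exact_mod_cast hml
      · have hex : ∃ j, m ≤ l * 4 ^ j := ⟨m, by
          have : m < 4 ^ m := Nat.lt_pow_self (by norm_num)
          nlinarith⟩
        obtain ⟨j, hj⟩ : ∃ j, Nat.find hex = j + 1 := by
          rcases h0 : Nat.find hex with _ | j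
          · have := Nat.find_spec hex
            rw [h0] at this; simp at this; omega
          · exact ⟨j, rfl⟩
        have h1 := Nat.find_spec hex
        rw [hj] at h1
        have h2 : l * 4 ^ j < m := not_le.1 (Nat.find_min hex (by omega))
        have hX : X ∈ E j := by
          change ((l * 4 ^ j : ℕ) : ℕ∞) < latency (wk X) X u
          rw [← hm]; exact_mod_cast h2
        refine le_trans ?_ (le_trans (ENNReal.le_tsum j) le_add_self)
        rw [Set.indicator_of_mem hX]
        simp only [ENat.toENNReal_coe]
        exact_mod_cast h1
  calc ∫⁻ X, (latency (wk X) X u : ℝ≥0∞) ∂(law D n)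
      ≤ ∫⁻ X, ((l : ℝ≥0∞) + ∑' j, (E j).indicator (fun _ => ((l * 4 ^ (j + 1) : ℕ) : ℝ≥0∞)) X)
          ∂(law D n) := lintegral_mono hpt
    _ = (l : ℝ≥0∞) + ∑' j, ((l * 4 ^ (j + 1) : ℕ) : ℝ≥0∞) * law D n (E j) := by
        rw [lintegral_add_left measurable_const, lintegral_const, measure_univ, mul_one,
          lintegral_tsum fun j => (measurable_const.indicator (hEm j)).aemeasurable]
        congr 1
        refine tsum_congr fun j => ?_
        rw [lintegral_indicator_const (hEm j)]
    _ ≤ ENNReal.ofReal l + ∑' j, ENNReal.ofReal ((4 * c * l) * (1 / 4) ^ j) := by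
        refine add_le_add (by simp) (ENNReal.tsum_le_tsum fun j => ?_)
        calc ((l * 4 ^ (j + 1) : ℕ) : ℝ≥0∞) * law D n (E j)
            ≤ ENNReal.ofReal ((l * 4 ^ (j + 1) : ℕ) : ℝ) * ENNReal.ofReal (c * (1 / 16) ^ j) := by
              rw [ENNReal.ofReal_natCast]; gcongr; exact h j
          _ = _ := by
              rw [← ENNReal.ofReal_mul (by positivity)]
              congr 1
              push_cast
              have : (4 : ℝ) ^ j * (1 / 16) ^ j = (1 / 4) ^ j := by rw [← mul_pow]; norm_num
              rw [← this]; ring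
    _ = ENNReal.ofReal (l + (4 * c * l) * (1 - 1 / 4)⁻¹) := by
        rw [← ENNReal.ofReal_tsum_of_nonneg (fun j => by positivity)
          ((summable_geometric_of_lt_one (by norm_num) (by norm_num)).mul_left _),
          tsum_mul_left, tsum_geometric_of_lt_one (by norm_num) (by norm_num),
          ← ENNReal.ofReal_add (by positivity) (by positivity)]
    _ ≤ _ := by
        refine ENNReal.ofReal_le_ofReal ?_
        have : 0 ≤ c * l := by positivity
        norm_num
        nlinarith

theorem tendsto_log_nat : Tendsto (fun n : ℕ => Real.log n) atTop atTop :=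
  Real.tendsto_log_atTop.comp tendsto_natCast_atTop_atTop

theorem tendsto_log_log_nat : Tendsto (fun n : ℕ => Real.log (Real.log n)) atTop atTop :=
  Real.tendsto_log_atTop.comp tendsto_log_nat

theorem eventually_mul_log_pow_le (c : ℝ) (k : ℕ) :
    ∀ᶠ n : ℕ in atTop, c * Real.log n ^ k ≤ n := by
  have h := (Real.isLittleO_pow_log_id_atTop (n := k)).comp_tendsto tendsto_natCast_atTop_atTop
  have hc : (0 : ℝ) < 1 / (|c| + 1) := by positivity
  filter_upwards [h.bound hc] with n hn
  simp only [Function.comp, Real.norm_eq_abs, id, Nat.abs_cast] at hn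
  have h1 : c * Real.log n ^ k ≤ |c| * |Real.log n ^ k| := by
    rw [← abs_mul]; exact le_abs_self _
  have h2 : |c| * |Real.log n ^ k| ≤ |c| * (1 / (|c| + 1) * n) := by gcongr
  have h3 : |c| * (1 / (|c| + 1) * n) ≤ n := by
    rw [← mul_assoc, mul_one_div]
    have : |c| / (|c| + 1) ≤ 1 := by rw [div_le_one (by positivity)]; linarith
    nlinarith [Nat.cast_nonneg (α := ℝ) n]
  linarith

/-- The quantities `√(log n)` and `log √(log n)` in the range where the bounds hold. -/
theorem sqrt_log_facts {n : ℕ} (h4 : 4 ≤ Real.log (Real.log n)) :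
    ∃ s g : ℝ, Real.log n = s ^ 2 ∧ Real.log (Real.log n) = 2 * g ∧ 2 ≤ g ∧ g ≤ s ∧
      Real.exp (-g) = 1 / s := by
  have hpos : 0 < Real.log n := by
    by_contra hneg
    have hn : 0 ≤ Real.log n := Real.log_natCast_nonneg n
    have : Real.log n = 0 := le_antisymm (not_lt.1 hneg) hn
    rw [this] at h4; simp at h4; linarith
  have hs : 0 < √(Real.log n) := Real.sqrt_pos.2 hpos
  refine ⟨√(Real.log n), Real.log √(Real.log n), (Real.sq_sqrt hpos.le).symm, ?_, ?_, ?_, ?_⟩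
  · rw [Real.log_sqrt hpos.le]; ring
  · rw [Real.log_sqrt hpos.le]; linarith
  · have := Real.log_le_sub_one_of_pos hs; linarith
  · rw [Real.exp_neg, Real.exp_log hs, one_div]

/-! ### Expected latency -/

/-- `latency_tail` is used with `x = l * 4 ^ j`, `B = l * 2 ^ j`, `M` half of `B`, and `H = g / 2 =
(log log n) / 4`. The ages between `B` and `x` have mass at least `32 * log (2 ^ j / 2)`; an eighth
of it in the exponent gives `16 * 16 ^ (-j)`. This fixes the constant `32` of the protocol. -/
theorem expected_tail {D : LocalClockProtocol} (hD : IsMemoryless D)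
    (hp : bitProb D = fun k : ℕ => 32 / ((k : ℝ) + 64)) {n : ℕ} {wk : Bits n → Fin n → ℕ∞}
    (hwk : NonAnticipating wk) (u : Fin n) {l : ℕ} {s g : ℝ} (hn : 4 ≤ n)
    (hs : Real.log n = s ^ 2) (hg2 : 2 ≤ g) (hgs : g ≤ s) (hexp : Real.exp (-g) = 1 / s)
    (hl : 1000 * (n * s ^ 2 / g) ≤ l) (hln : (l : ℝ) ≤ (n : ℝ) ^ 2) (hl64 : 64 ≤ l) (j : ℕ) :
    law D n {X | ((l * 4 ^ j : ℕ) : ℕ∞) < latency (wk X) X u} ≤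
      ENNReal.ofReal (17 * (1 / 16) ^ j) := by
  have hg0 : 0 < g := by linarith
  have hs0 : 0 < s := by linarith
  have hn0 : (0 : ℝ) < n := by positivity
  have hl0 : (0 : ℝ) < l := by positivity
  have hanti : Antitone (bitProb D) := by
    rw [hp]
    intro a b hab
    have : (a : ℝ) ≤ b := by exact_mod_cast hab
    simp only
    gcongr
  have hhalf : ∀ k, bitProb D k ≤ 1 / 2 := by
    intro k
    rw [hp]
    simp only
    rw [div_le_div_iff₀ (by positivity) (by norm_num)]
    have : (0 : ℝ) ≤ k := by positivity
    linarith
  have h2j : (1 : ℝ) ≤ 2 ^ j := one_le_pow₀ (by norm_num)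
  have hj2 : (j : ℝ) + 1 ≤ 2 ^ j := by
    have : j < 2 ^ j := Nat.lt_pow_self (by norm_num)
    exact_mod_cast this
  have hlogl : Real.log l ≤ 2 * s ^ 2 := by
    calc Real.log l ≤ Real.log ((n : ℝ) ^ 2) := Real.log_le_log hl0 hln
      _ = 2 * s ^ 2 := by rw [Real.log_pow, hs]; norm_num
  have hlog4 : Real.log 4 ≤ 2 := by
    have := Real.log_le_sub_one_of_pos (by norm_num : (0 : ℝ) < 2)
    have h4 : Real.log 4 = 2 * Real.log 2 := by
      rw [show (4 : ℝ) = 2 ^ 2 by norm_num, Real.log_pow]; norm_num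
    rw [h4]; linarith
  have hlogx : Real.log ((l * 4 ^ j : ℕ) : ℝ) ≤ 2 * s ^ 2 + j * 2 := by
    push_cast
    rw [Real.log_mul hl0.ne' (by positivity), Real.log_pow]
    have : (j : ℝ) * Real.log 4 ≤ j * 2 := by gcongr
    linarith
  -- The mass is of order `log n + j`. The summand `j` is absorbed by the factor `2 ^ j`, which `B`
  -- also has.
  have hP : ∑ k ∈ Finset.range (l * 4 ^ j), bitProb D k ≤ 96 * s ^ 2 * 2 ^ j := by
    have h1 : ∑ k ∈ Finset.range (l * 4 ^ j), bitProb D k ≤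
        32 * ∑ k ∈ Finset.range (l * 4 ^ j), 1 / ((k : ℝ) + 1) := by
      rw [Finset.mul_sum, hp]
      refine Finset.sum_le_sum fun k _ => ?_
      rw [mul_one_div]
      gcongr
      norm_num
    have h2 := sum_one_div_le (l * 4 ^ j)
    have h3 : 1 + (2 * s ^ 2 + j * 2) ≤ 3 * s ^ 2 * 2 ^ j := by
      have : 4 ≤ s ^ 2 := by nlinarith
      nlinarith
    linarith
  have hM1 : (((l * 2 ^ j / 2 : ℕ)) : ℝ) ≤ l * 2 ^ j / 2 := by
    have := Nat.cast_div_le (α := ℝ) (m := l * 2 ^ j) (n := 2)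
    push_cast at this
    exact this
  have hM2 : (l : ℝ) * 2 ^ j / 4 ≤ ((l * 2 ^ j / 2 : ℕ) : ℝ) := by
    have h1 : l * 2 ^ j ≤ 2 * (l * 2 ^ j / 2) + 1 := by omega
    have h2 : (l : ℝ) * 2 ^ j ≤ 2 * ((l * 2 ^ j / 2 : ℕ) : ℝ) + 1 := by exact_mod_cast h1
    have h3 : (64 : ℝ) ≤ l := by exact_mod_cast hl64
    nlinarith
  have hB : n * (∑ k ∈ Finset.range (l * 4 ^ j), bitProb D k) / (g / 2) +
      ((l * 2 ^ j / 2 : ℕ) : ℝ) ≤ ((l * 2 ^ j : ℕ) : ℝ) := by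
    have h1 : n * (∑ k ∈ Finset.range (l * 4 ^ j), bitProb D k) / (g / 2) ≤ l * 2 ^ j / 2 := by
      calc n * (∑ k ∈ Finset.range (l * 4 ^ j), bitProb D k) / (g / 2)
          ≤ n * (96 * s ^ 2 * 2 ^ j) / (g / 2) := by gcongr
        _ = 192 * (n * s ^ 2 / g) * 2 ^ j := by field_simp; ring
        _ ≤ l / 2 * 2 ^ j := by
            have : 0 ≤ n * s ^ 2 / g := by positivity
            gcongr; linarith
        _ = _ := by ring
    push_cast
    linarith
  refine (latency_tail hD hanti hhalf hwk u (by linarith : 1 ≤ g / 2) hB).trans ?_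
  refine ENNReal.ofReal_le_ofReal ?_
  have hterm1 : Real.exp (-((∑ k ∈ Finset.Ico (l * 2 ^ j) (l * 4 ^ j), bitProb D k) / 8)) ≤
      16 * (1 / 16) ^ j := by
    have h24 : l * 2 ^ j ≤ l * 4 ^ j := Nat.mul_le_mul_left _ (Nat.pow_le_pow_left (by norm_num) j)
    have h1 := log_div_le_sum_Ico (by norm_num : (0 : ℝ) < 64) h24
    have h2 : ∑ k ∈ Finset.Ico (l * 2 ^ j) (l * 4 ^ j), bitProb D k =
        32 * ∑ k ∈ Finset.Ico (l * 2 ^ j) (l * 4 ^ j), 1 / ((k : ℝ) + 64) := by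
      rw [Finset.mul_sum, hp]
      exact Finset.sum_congr rfl fun k _ => by rw [mul_one_div]
    have h3 : Real.log ((2 : ℝ) ^ j / 2) ≤
        Real.log ((((l * 4 ^ j : ℕ) : ℝ) + 64) / (((l * 2 ^ j : ℕ) : ℝ) + 64)) := by
      refine Real.log_le_log (by positivity) ?_
      rw [div_le_div_iff₀ (by norm_num) (by positivity)]
      push_cast
      have h4 : (4 : ℝ) ^ j = 2 ^ j * 2 ^ j := by rw [← mul_pow]; norm_num
      have h5 : (64 : ℝ) ≤ l := by exact_mod_cast hl64
      rw [h4]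
      nlinarith
    rw [h2]
    calc Real.exp (-((32 * ∑ k ∈ Finset.Ico (l * 2 ^ j) (l * 4 ^ j), 1 / ((k : ℝ) + 64)) / 8))
        ≤ Real.exp (-(4 * Real.log ((2 : ℝ) ^ j / 2))) := by
          refine Real.exp_le_exp.2 ?_
          linarith
      _ = 16 * (1 / 16) ^ j := by
          rw [show -(4 * Real.log ((2 : ℝ) ^ j / 2)) = Real.log ((((2 : ℝ) ^ j / 2) ^ 4)⁻¹) by
            rw [Real.log_inv, Real.log_pow]; norm_num, Real.exp_log (by positivity)]
          rw [div_pow, inv_div, ← pow_mul, mul_comm j 4, pow_mul, one_div, inv_pow]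
          norm_num
          rfl
  -- Since `exp (-2 H) = 1 / s` and `M` is at least `250 * n * s * 2 ^ j`, the compensator exceeds
  -- `2 * n * 2 ^ j`, far more than the `n` possible successes.
  have hterm2 : Real.exp (n - Real.exp (-(2 * (g / 2))) / 8 * ((l * 2 ^ j / 2 : ℕ) : ℝ)) ≤
      (1 / 16) ^ j := by
    have h1 : Real.exp (-(2 * (g / 2))) = 1 / s := by rw [← hexp]; congr 1; ring
    rw [h1]
    have h2 : 1000 * (n * s) ≤ l := by
      refine le_trans ?_ hl
      have : n * s ≤ n * s ^ 2 / g := by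
        rw [le_div_iff₀ hg0]
        nlinarith [mul_pos hn0 hs0]
      linarith
    have h3 : 2 * n * 2 ^ j ≤ 1 / s / 8 * ((l * 2 ^ j / 2 : ℕ) : ℝ) := by
      calc 2 * n * 2 ^ j ≤ 1 / s / 8 * (1000 * (n * s) * 2 ^ j / 4) := by
            have : 1 / s / 8 * (1000 * (n * s) * 2 ^ j / 4) = 1000 / 32 * (n * 2 ^ j) := by
              field_simp; ring
            rw [this]
            have : 0 ≤ (n : ℝ) * 2 ^ j := by positivity
            linarith
        _ ≤ 1 / s / 8 * (l * 2 ^ j / 4) := by gcongr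
        _ ≤ _ := by gcongr
    have h4 : Real.log 16 ≤ 4 := by
      have : Real.log 16 = 2 * Real.log 4 := by
        rw [show (16 : ℝ) = 4 ^ 2 by norm_num, Real.log_pow]; norm_num
      rw [this]; linarith
    have h5 : (1 / 16 : ℝ) ^ j = Real.exp (-(j * Real.log 16)) := by
      rw [← Real.log_pow, ← Real.log_inv, Real.exp_log (by positivity)]
      simp
    rw [h5]
    refine Real.exp_le_exp.2 ?_
    have h6 : (j : ℝ) * Real.log 16 ≤ j * 4 := by gcongr
    have h7 : (4 : ℝ) ≤ n := by exact_mod_cast hn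
    nlinarith
  linarith

theorem exists_expLatency : ∃ D : LocalClockProtocol, IsMemoryless D ∧
    IsBigOLatency (expLatency adaptiveWake D)
      (fun n : ℕ => (n : ℝ) * Real.log n / Real.log (Real.log n)) := by
  obtain ⟨D, hD, hp⟩ := exists_memoryless (fun k : ℕ => 32 / ((k : ℝ) + 64))
    (fun k => by positivity) (fun k => by
      rw [div_le_one (by positivity)]
      have : (0 : ℝ) ≤ k := by positivity
      linarith)
  -- `103 = 1 + 6 * 17` combines `lintegral_latency_le` with the constant `17` of `expected_tail`.
  -- The constant `1000` there becomes `2000` because `log log n = 2 g`.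
  refine ⟨D, hD, fun n => 103 * (⌈2000 * ((n : ℝ) * Real.log n / Real.log (Real.log n))⌉₊ : ℝ),
    ?_, ?_⟩
  · refine IsBigO.of_bound (103 * 2001) ?_
    filter_upwards [tendsto_log_log_nat.eventually_ge_atTop 4, eventually_ge_atTop 4] with n h4 hn
    obtain ⟨s, g, hs, hg, hg2, hgs, -⟩ := sqrt_log_facts h4
    set y := (n : ℝ) * Real.log n / Real.log (Real.log n) with hy
    have hn' : (4 : ℝ) ≤ n := by exact_mod_cast hn
    have hy1 : 1 ≤ y := by
      rw [hy, hg, hs, le_div_iff₀ (by linarith)]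
      nlinarith
    have hc : (⌈2000 * y⌉₊ : ℝ) ≤ 2000 * y + 1 := (Nat.ceil_lt_add_one (by linarith)).le
    rw [Real.norm_of_nonneg (by positivity), Real.norm_of_nonneg (by linarith)]
    linarith
  · filter_upwards [tendsto_log_log_nat.eventually_ge_atTop 4, eventually_ge_atTop 64,
      eventually_mul_log_pow_le 2001 1] with n h4 hn hpow
    obtain ⟨s, g, hs, hg, hg2, hgs, hexp⟩ := sqrt_log_facts h4
    have hn' : (64 : ℝ) ≤ n := by exact_mod_cast hn
    have hns : 0 ≤ n * s ^ 2 / g := by positivity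
    have hle : n * s ^ 2 / (2 * g) = n * s ^ 2 / g / 2 := by field_simp
    refine iSup_le fun A => iSup_le fun u => ?_
    have hl1 : 1000 * (n * s ^ 2 / g) ≤ (⌈2000 * ((n : ℝ) * Real.log n /
        Real.log (Real.log n))⌉₊ : ℝ) := by
      refine le_trans (le_of_eq ?_) (Nat.le_ceil _)
      rw [hg, hs, hle]; ring
    have hl2 : (⌈2000 * ((n : ℝ) * Real.log n / Real.log (Real.log n))⌉₊ : ℝ) ≤ (n : ℝ) ^ 2 := by
      refine (Nat.ceil_lt_add_one (by rw [hg, hs, hle]; positivity)).le.trans ?_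
      rw [hs] at hpow
      rw [hg, hs]
      have h1 : n * s ^ 2 / (2 * g) ≤ n * s ^ 2 := by
        rw [div_le_iff₀ (by linarith)]
        have : 0 ≤ n * s ^ 2 := by positivity
        nlinarith
      have h2 : 1 ≤ n * s ^ 2 := by nlinarith
      nlinarith
    have hl3 : 64 ≤ ⌈2000 * ((n : ℝ) * Real.log n / Real.log (Real.log n))⌉₊ := by
      have : (64 : ℝ) ≤ (⌈2000 * ((n : ℝ) * Real.log n / Real.log (Real.log n))⌉₊ : ℝ) := by
        refine le_trans ?_ hl1
        have : 64 ≤ n * s ^ 2 / g := by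
          rw [le_div_iff₀ (by linarith)]
          nlinarith
        linarith
      exact_mod_cast this
    have hwk := nonAnticipating_adaptiveWake A
    refine (lintegral_latency_le hwk u (by omega) (by norm_num : (0 : ℝ) ≤ 17)
      (expected_tail hD hp hwk u (by omega) hs hg2 hgs hexp hl1 hl2 hl3)).trans ?_
    norm_num

/-! ### Latency with high probability -/

/-- Here `B` is half of `x` and `M` a quarter. The factor `log k` in the probabilities gives the
ages between `x / 2` and `x` a mass of at least `32 log n`, so that `u` survives the light slots
with probability at most `n ^ (-4)`. It also raises the mass of the first `x` ages to order `log ^ 2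
n`, and heavy slots then force `x` to have this second logarithm. -/
theorem whp_tail {D : LocalClockProtocol} (hD : IsMemoryless D)
    (hp : bitProb D = fun k : ℕ => 192 * (Real.log ((k : ℝ) + 4096) / ((k : ℝ) + 4096)))
    (hanti : Antitone (bitProb D)) (hhalf : ∀ k, bitProb D k ≤ 1 / 2)
    {n : ℕ} {wk : Bits n → Fin n → ℕ∞}
    (hwk : NonAnticipating wk) (u : Fin n) {x : ℕ} {s g : ℝ} (hn : 4 ≤ n)
    (hs : Real.log n = s ^ 2) (hg2 : 2 ≤ g) (hgs : g ≤ s) (hexp : Real.exp (-g) = 1 / s)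
    (hx : 20000 * (n * s ^ 4 / g) ≤ x) (hxn : (x : ℝ) + 4096 ≤ (n : ℝ) ^ 2) (hx4096 : 4096 ≤ x)
    (hsn : 4 * s ^ 2 ≤ n) :
    law D n {X | (x : ℕ∞) < latency (wk X) X u} ≤ ((n : ℝ≥0∞) ^ 2)⁻¹ := by
  have hg0 : 0 < g := by linarith
  have hs0 : 0 < s := by linarith
  have hn4 : (4 : ℝ) ≤ n := by exact_mod_cast hn
  have hn0 : (0 : ℝ) < n := by positivity
  have hx4 : (4096 : ℝ) ≤ x := by exact_mod_cast hx4096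
  have hs4 : 4 ≤ s ^ 2 := by nlinarith
  have hns : (n : ℝ) * s ≤ n * s ^ 4 / g := by
    rw [le_div_iff₀ hg0]
    have h1 : g * s ≤ s ^ 4 := by
      calc g * s ≤ s * s := by gcongr
        _ = s ^ 2 := by ring
        _ ≤ s ^ 4 := by nlinarith
    calc n * s * g = n * (g * s) := by ring
      _ ≤ n * s ^ 4 := by gcongr
  have hlogx : Real.log ((x : ℝ) + 4096) ≤ 2 * s ^ 2 := by
    calc Real.log ((x : ℝ) + 4096) ≤ Real.log ((n : ℝ) ^ 2) :=
          Real.log_le_log (by positivity) hxn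
      _ = 2 * s ^ 2 := by rw [Real.log_pow, hs]; norm_num
  have hP : ∑ k ∈ Finset.range x, bitProb D k ≤ 1152 * s ^ 4 := by
    have h1 : ∑ k ∈ Finset.range x, bitProb D k ≤
        192 * (2 * s ^ 2) * ∑ k ∈ Finset.range x, 1 / ((k : ℝ) + 1) := by
      rw [Finset.mul_sum, hp]
      refine Finset.sum_le_sum fun k hk => ?_
      have hkx : (k : ℝ) ≤ x := by exact_mod_cast (Finset.mem_range.1 hk).le
      have h2 : Real.log ((k : ℝ) + 4096) ≤ 2 * s ^ 2 :=
        (Real.log_le_log (by positivity) (by linarith)).trans hlogx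
      calc 192 * (Real.log ((k : ℝ) + 4096) / ((k : ℝ) + 4096))
          ≤ 192 * (2 * s ^ 2 / ((k : ℝ) + 1)) := by
            gcongr
            norm_num
        _ = _ := by ring
    have h2 := sum_one_div_le x
    have h3 : Real.log x ≤ 2 * s ^ 2 :=
      (Real.log_le_log (by linarith) (by linarith)).trans hlogx
    calc ∑ k ∈ Finset.range x, bitProb D k
        ≤ 192 * (2 * s ^ 2) * (1 + 2 * s ^ 2) := h1.trans (by gcongr; linarith)
      _ ≤ 192 * (2 * s ^ 2) * (3 * s ^ 2) := by gcongr; linarith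
      _ = _ := by ring
  have hM1 : ((x / 4 : ℕ) : ℝ) ≤ x / 4 := by
    have := Nat.cast_div_le (α := ℝ) (m := x) (n := 4)
    exact_mod_cast this
  have hM2 : (x : ℝ) / 8 ≤ ((x / 4 : ℕ) : ℝ) := by
    have h1 : x ≤ 8 * (x / 4) := by omega
    have h2 : (x : ℝ) ≤ 8 * ((x / 4 : ℕ) : ℝ) := by exact_mod_cast h1
    linarith
  have hB1 : (x : ℝ) / 2 ≤ (((x + 1) / 2 : ℕ) : ℝ) := by
    have h1 : x ≤ 2 * ((x + 1) / 2) := by omega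
    have h2 : (x : ℝ) ≤ 2 * (((x + 1) / 2 : ℕ) : ℝ) := by exact_mod_cast h1
    linarith
  have hB : n * (∑ k ∈ Finset.range x, bitProb D k) / (g / 2) + ((x / 4 : ℕ) : ℝ) ≤
      (((x + 1) / 2 : ℕ) : ℝ) := by
    have h1 : n * (∑ k ∈ Finset.range x, bitProb D k) / (g / 2) ≤ x / 8 := by
      calc n * (∑ k ∈ Finset.range x, bitProb D k) / (g / 2)
          ≤ n * (1152 * s ^ 4) / (g / 2) := by gcongr
        _ = 2304 * (n * s ^ 4 / g) := by field_simp; ring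
        _ ≤ x / 8 := by
            have : 0 ≤ n * s ^ 4 / g := by positivity
            linarith
    linarith
  refine (latency_tail hD hanti hhalf hwk u (by linarith : 1 ≤ g / 2) hB).trans ?_
  have hexps : Real.exp (-(4 * s ^ 2)) = ((n : ℝ) ^ 4)⁻¹ := by
    rw [← hs, Real.exp_neg, mul_comm, ← Real.exp_log hn0, Real.log_exp, ← Real.exp_nat_mul,
      mul_comm]
    norm_num
  have hterm1 : Real.exp (-((∑ k ∈ Finset.Ico ((x + 1) / 2) x, bitProb D k) / 8)) ≤
      ((n : ℝ) ^ 4)⁻¹ := by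
    rw [← hexps]
    refine Real.exp_le_exp.2 ?_
    have hcard : (x : ℝ) / 3 ≤ ((Finset.Ico ((x + 1) / 2) x).card : ℝ) := by
      rw [Nat.card_Ico]
      have h1 : x ≤ 3 * (x - (x + 1) / 2) := by omega
      have h2 : (x : ℝ) ≤ 3 * ((x - (x + 1) / 2 : ℕ) : ℝ) := by exact_mod_cast h1
      linarith
    have hterm : ∀ k ∈ Finset.Ico ((x + 1) / 2) x, 96 * s ^ 2 / x ≤ bitProb D k := by
      intro k hk
      refine le_trans ?_ (hanti (Finset.mem_Ico.1 hk).2.le)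
      rw [hp]
      simp only
      have h1 : s ^ 2 ≤ Real.log ((x : ℝ) + 4096) := by
        rw [← hs]
        refine Real.log_le_log hn0 ?_
        have : (n : ℝ) ≤ n * s := by nlinarith
        have : 0 ≤ n * s ^ 4 / g := by positivity
        linarith
      calc 96 * s ^ 2 / x = 192 * (s ^ 2 / (x + x)) := by field_simp; ring
        _ ≤ 192 * (Real.log ((x : ℝ) + 4096) / (x + 4096)) := by
            gcongr
            exact le_trans (by positivity) h1
    have hsum := Finset.card_nsmul_le_sum _ _ _ hterm
    rw [nsmul_eq_mul] at hsum
    have : 32 * s ^ 2 ≤ ((Finset.Ico ((x + 1) / 2) x).card : ℝ) * (96 * s ^ 2 / x) := by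
      calc 32 * s ^ 2 = x / 3 * (96 * s ^ 2 / x) := by field_simp; ring
        _ ≤ _ := by gcongr
    linarith
  have hterm2 : Real.exp (n - Real.exp (-(2 * (g / 2))) / 8 * ((x / 4 : ℕ) : ℝ)) ≤
      ((n : ℝ) ^ 4)⁻¹ := by
    rw [← hexps]
    refine Real.exp_le_exp.2 ?_
    have h1 : Real.exp (-(2 * (g / 2))) = 1 / s := by rw [← hexp]; congr 1; ring
    rw [h1]
    have h3 : 2 * (n : ℝ) ≤ 1 / s / 8 * ((x / 4 : ℕ) : ℝ) := by
      calc 2 * (n : ℝ) ≤ 1 / s / 8 * (20000 * (n * s) / 8) := by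
            have : 1 / s / 8 * (20000 * (n * s) / 8) = 20000 / 64 * n := by field_simp; ring
            rw [this]; linarith
        _ ≤ 1 / s / 8 * (x / 8) := by gcongr; linarith
        _ ≤ _ := by gcongr
    linarith
  have hfin : ((n : ℝ) ^ 4)⁻¹ + ((n : ℝ) ^ 4)⁻¹ ≤ ((n : ℝ) ^ 2)⁻¹ := by
    have h2 : ((n : ℝ) ^ 4)⁻¹ = ((n : ℝ) ^ 2)⁻¹ * ((n : ℝ) ^ 2)⁻¹ := by
      rw [← mul_inv]; congr 1; ring
    have h3 : ((n : ℝ) ^ 2)⁻¹ ≤ 1 / 2 := by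
      rw [inv_le_comm₀ (by positivity) (by norm_num)]
      nlinarith
    have h4 : 0 ≤ ((n : ℝ) ^ 2)⁻¹ := by positivity
    rw [h2]
    nlinarith
  calc ENNReal.ofReal _ ≤ ENNReal.ofReal (((n : ℝ) ^ 2)⁻¹) :=
        ENNReal.ofReal_le_ofReal ((add_le_add hterm1 hterm2).trans hfin)
    _ = ((n : ℝ≥0∞) ^ 2)⁻¹ := by
        rw [ENNReal.ofReal_inv_of_pos (by positivity), ENNReal.ofReal_pow (by positivity),
          ENNReal.ofReal_natCast]

theorem log_div_antitone :
    Antitone fun k : ℕ => 192 * (Real.log ((k : ℝ) + 4096) / ((k : ℝ) + 4096)) := by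
  intro a b hab
  have h : (a : ℝ) ≤ b := by exact_mod_cast hab
  have he : Real.exp 1 ≤ 4096 := by have := Real.exp_one_lt_d9; linarith
  have ha : (0 : ℝ) ≤ a := by positivity
  have := Real.log_div_self_antitoneOn (a := (a : ℝ) + 4096) (b := (b : ℝ) + 4096)
    (Set.mem_Ici.2 (by linarith)) (Set.mem_Ici.2 (by linarith)) (by linarith)
  simp only at this ⊢
  linarith

/-- The shift `4096 = 2 ^ 12` exceeds `e`, where `log y / y` starts to decrease, and `192 * 12 * log
2 / 4096 < 1/2`. -/
theorem log_div_le_half (k : ℕ) :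
    192 * (Real.log ((k : ℝ) + 4096) / ((k : ℝ) + 4096)) ≤ 1 / 2 := by
  refine (log_div_antitone (Nat.zero_le k)).trans ?_
  have h : Real.log 4096 = 12 * Real.log 2 := by
    rw [show (4096 : ℝ) = 2 ^ 12 by norm_num, Real.log_pow]; norm_num
  have := Real.log_two_lt_d9
  simp only [Nat.cast_zero, zero_add]
  rw [h]
  linarith

theorem exists_whpLatency : ∃ D : LocalClockProtocol, IsMemoryless D ∧
    IsBigOLatency (whpLatency adaptiveWake D)
      (fun n : ℕ => (n : ℝ) * Real.log n ^ 2 / Real.log (Real.log n)) := by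
  obtain ⟨D, hD, hp⟩ := exists_memoryless
    (fun k : ℕ => 192 * (Real.log ((k : ℝ) + 4096) / ((k : ℝ) + 4096)))
    (fun k => by
      have : 0 ≤ Real.log ((k : ℝ) + 4096) := Real.log_nonneg (by
        have : (0 : ℝ) ≤ k := by positivity
        linarith)
      positivity)
    (fun k => (log_div_le_half k).trans (by norm_num))
  refine ⟨D, hD, fun n => (⌈40000 * ((n : ℝ) * Real.log n ^ 2 / Real.log (Real.log n))⌉₊ : ℝ),
    ?_, ?_⟩
  · refine IsBigO.of_bound 40001 ?_
    filter_upwards [tendsto_log_log_nat.eventually_ge_atTop 4, eventually_ge_atTop 4] with n h4 hn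
    obtain ⟨s, g, hs, hg, hg2, hgs, -⟩ := sqrt_log_facts h4
    set y := (n : ℝ) * Real.log n ^ 2 / Real.log (Real.log n) with hy
    have hn' : (4 : ℝ) ≤ n := by exact_mod_cast hn
    have hy1 : 1 ≤ y := by
      rw [hy, hg, hs, le_div_iff₀ (by linarith)]
      have h1 : s ≤ s ^ 2 := by nlinarith
      have h2 : s ^ 2 ≤ (s ^ 2) ^ 2 := by nlinarith
      nlinarith
    have hc : (⌈40000 * y⌉₊ : ℝ) ≤ 40000 * y + 1 := (Nat.ceil_lt_add_one (by linarith)).le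
    rw [Real.norm_of_nonneg (by positivity), Real.norm_of_nonneg (by linarith)]
    linarith
  · filter_upwards [tendsto_log_log_nat.eventually_ge_atTop 4, eventually_ge_atTop 4096,
      eventually_mul_log_pow_le 40001 2, eventually_mul_log_pow_le 4 1] with n h4 hn hpow hpow1
    obtain ⟨s, g, hs, hg, hg2, hgs, hexp⟩ := sqrt_log_facts h4
    have hn' : (4096 : ℝ) ≤ n := by exact_mod_cast hn
    have hns : 0 ≤ n * s ^ 4 / g := by positivity
    have hle : n * (s ^ 2) ^ 2 / (2 * g) = n * s ^ 4 / g / 2 := by field_simp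
    have hs2 : 4 ≤ s ^ 2 := by nlinarith
    have hx1 : 20000 * (n * s ^ 4 / g) ≤ (⌈40000 * ((n : ℝ) * Real.log n ^ 2 /
        Real.log (Real.log n))⌉₊ : ℝ) := by
      refine le_trans (le_of_eq ?_) (Nat.le_ceil _)
      rw [hg, hs, hle]; ring
    have hx3 : (4096 : ℝ) ≤ (⌈40000 * ((n : ℝ) * Real.log n ^ 2 /
        Real.log (Real.log n))⌉₊ : ℝ) := by
      refine le_trans ?_ hx1
      have : 4096 ≤ n * s ^ 4 / g := by
        rw [le_div_iff₀ (by linarith)]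
        have h1 : g ≤ s ^ 4 := by nlinarith
        nlinarith
      linarith
    refine whpLatency_le (fun n A => nonAnticipating_adaptiveWake A) D n _ fun A u => ?_
    refine whp_tail hD hp (hp ▸ log_div_antitone) (fun k => by rw [hp]; exact log_div_le_half k)
      (nonAnticipating_adaptiveWake A) u (by omega) hs hg2 hgs hexp hx1 ?_ (by exact_mod_cast hx3)
      (by rw [hs] at hpow1; linarith)
    have := (Nat.ceil_lt_add_one (a := 40000 * ((n : ℝ) * Real.log n ^ 2 /
      Real.log (Real.log n))) (by rw [hg, hs, hle]; positivity)).le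
    refine (add_le_add_left this _).trans ?_
    rw [hs] at hpow
    rw [hg, hs]
    have h1 : n * (s ^ 2) ^ 2 / (2 * g) ≤ n * (s ^ 2) ^ 2 / 4 := by
      gcongr
      linarith
    have h2 : 0 ≤ n * (s ^ 2) ^ 2 := by positivity
    have h3 : (n : ℝ) * (40001 * (s ^ 2) ^ 2) ≤ n * n := by gcongr
    have h4 : (n : ℝ) ≤ n * (s ^ 2) ^ 2 :=
      le_mul_of_one_le_right (by positivity) (one_le_pow₀ (by linarith))
    have h5 : (4096 : ℝ) * n ≤ n * n := by gcongr
    linarith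

/-! ### Slots with high contention -/

theorem one_add_three_mul_mul_exp_le {C : ℝ} (hC : 0 ≤ C) :
    (1 + 3 * C) * Real.exp (-C) ≤ 5 * Real.exp (-(C / 2)) := by
  have h1 : 1 + C / 2 + (C / 2) ^ 2 / 2 ≤ Real.exp (C / 2) :=
    Real.quadratic_le_exp_of_nonneg (by linarith)
  have h2 : Real.exp (-(C / 2)) = Real.exp (C / 2) * Real.exp (-C) := by
    rw [← Real.exp_add]; ring_nf
  rw [h2, ← mul_assoc]
  refine mul_le_mul_of_nonneg_right ?_ (Real.exp_pos _).le
  nlinarith [sq_nonneg (C - 1)]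

open Classical in
/-- It is unlikely that at most one party of a set with high contention fires. -/
theorem law_real_subsingleton_le {n : ℕ} (D : LocalClockProtocol) (w : Fin n → ℕ∞) (t : ℕ)
    (A : Finset (Fin n)) :
    (law D n).real {Y | {v | v ∈ A ∧ Fires w Y t v}.Subsingleton} ≤
      5 * Real.exp (-((∑ v ∈ A, rate (bitProb D) w t v) / 2)) := by
  set C := ∑ v ∈ A, rate (bitProb D) w t v with hC
  have hr0 : ∀ v, 0 ≤ rate (bitProb D) w t v := rate_nonneg (bitProb_nonneg D) w t
  have hr1 : ∀ v, rate (bitProb D) w t v ≤ 1 := rate_le zero_le_one (bitProb_le_one D) w t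
  have hC0 : 0 ≤ C := Finset.sum_nonneg fun v _ => hr0 v
  have hsub : {Y : Bits n | {v | v ∈ A ∧ Fires w Y t v}.Subsingleton} ⊆
      {Y | {v | v ∈ A ∧ Fires w Y t v} = ∅} ∪
        ⋃ a ∈ A, {Y | {v | v ∈ A ∧ Fires w Y t v} = {a}} := by
    intro Y hY
    rcases Set.Subsingleton.eq_empty_or_singleton hY with h | ⟨a, h⟩
    · exact Or.inl h
    · refine Or.inr (Set.mem_biUnion (x := a) ?_ h)
      have : a ∈ {v | v ∈ A ∧ Fires w Y t v} := by rw [h]; rfl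
      exact this.1
  have h0 : (law D n).real {Y | {v | v ∈ A ∧ Fires w Y t v} = ∅} ≤ Real.exp (-C) := by
    have := law_real_none D w t (A : Set (Fin n))
    simp only [Finset.mem_coe, Finset.filter_mem_eq_inter, Finset.univ_inter] at this
    rw [this, hC, ← Finset.sum_neg_distrib, Real.exp_sum]
    refine Finset.prod_le_prod (fun v _ => sub_nonneg.2 (hr1 v)) fun v _ => ?_
    have := Real.add_one_le_exp (-rate (bitProb D) w t v)
    linarith
  have h1 : ∀ a ∈ A, (law D n).real {Y | {v | v ∈ A ∧ Fires w Y t v} = {a}} ≤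
      rate (bitProb D) w t a * (3 * Real.exp (-C)) := by
    intro a _
    have := law_real_sole D w t (A : Set (Fin n)) a
    simp only [Finset.mem_coe] at this
    rw [this]
    refine (soleProb_le (f := bitProb D) (J := A) (bitProb_nonneg D) (bitProb_le_one D)
      (bitProb_nonneg D) (fun _ => le_rfl) fun v hv => hv).trans ?_
    refine mul_le_mul_of_nonneg_left ?_ (hr0 a)
    rw [show -(∑ v ∈ A, rate (bitProb D) w t v - rate (bitProb D) w t a) =
      rate (bitProb D) w t a + -C by rw [hC]; ring, Real.exp_add]
    refine mul_le_mul_of_nonneg_right ?_ (Real.exp_pos _).le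
    exact (Real.exp_le_exp.2 (hr1 a)).trans Real.exp_one_lt_three.le
  calc (law D n).real {Y | {v | v ∈ A ∧ Fires w Y t v}.Subsingleton}
      ≤ (law D n).real ({Y | {v | v ∈ A ∧ Fires w Y t v} = ∅} ∪
        ⋃ a ∈ A, {Y | {v | v ∈ A ∧ Fires w Y t v} = {a}}) := measureReal_mono hsub
    _ ≤ (law D n).real {Y | {v | v ∈ A ∧ Fires w Y t v} = ∅} +
        ∑ a ∈ A, (law D n).real {Y | {v | v ∈ A ∧ Fires w Y t v} = {a}} :=
        (measureReal_union_le _ _).trans (by gcongr; exact measureReal_biUnion_finset_le _ _)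
    _ ≤ Real.exp (-C) + ∑ a ∈ A, rate (bitProb D) w t a * (3 * Real.exp (-C)) :=
        add_le_add h0 (Finset.sum_le_sum h1)
    _ = (1 + 3 * C) * Real.exp (-C) := by rw [← Finset.sum_mul, ← hC]; ring
    _ ≤ 5 * Real.exp (-(C / 2)) := one_add_three_mul_mul_exp_le hC0

theorem law_real_eq_integral {n : ℕ} (D : LocalClockProtocol) {T : ℕ} {P : Bits n → Prop}
    [DecidablePred P] (hP : FinDep T P) :
    (law D n).real {X | P X} = ∫ X, (if P X then 1 else 0) ∂(law D n) := by
  have : (fun X => if P X then (1 : ℝ) else 0) = {X | P X}.indicator 1 := by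
    funext X
    by_cases h : P X <;> simp [h]
  rw [this, integral_indicator_one hP.measurableSet]

open Classical in
/-- The same bound for a random set that does not depend on the bits of the slot. -/
theorem law_real_subsingleton_of_invariant {n : ℕ} {D : LocalClockProtocol} (hD : IsMemoryless D)
    (w : Fin n → ℕ∞) (t : ℕ) {T : ℕ} {A : Bits n → Finset (Fin n)} (hdep : FinDep T A)
    (hA : ∀ X Y, A (mixBits (slotBits w t) X Y) = A X) (c : ℝ) :
    (law D n).real {X | c ≤ ∑ v ∈ A X, rate (bitProb D) w t v ∧
      {v | v ∈ A X ∧ Fires w X t v}.Subsingleton} ≤ 5 * Real.exp (-(c / 2)) := by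
  have hf := (nonAnticipating_const (n := n) w).finDep_fires t
  have hfm : ∀ X Y v, Fires w (mixBits (slotBits w t) X Y) t v ↔ Fires w Y t v :=
    fun X Y v => (nonAnticipating_const (n := n) w).fires_mix t X Y v
  have hF : FinDep (max T t) fun X : Bits n => c ≤ ∑ v ∈ A X, rate (bitProb D) w t v ∧
      {v | v ∈ A X ∧ Fires w X t v}.Subsingleton := by
    intro X X' hX
    have h1 := hdep X X' fun v k hk => hX v k (hk.trans_le (le_max_left _ _))
    have h2 := fun v => hf v X X' fun v k hk => hX v k (hk.trans_le (le_max_right _ _))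
    simp only at h1 h2
    simp only [h1, h2]
  have hF' : FinDep (max T t) fun X : Bits n => if c ≤ ∑ v ∈ A X, rate (bitProb D) w t v ∧
      {v | v ∈ A X ∧ Fires w X t v}.Subsingleton then (1 : ℝ) else 0 :=
    fun X X' hX => if_congr (iff_of_eq (hF X X' hX)) rfl rfl
  rw [law_real_eq_integral D hF, integral_mixBits hD (slotBits w t) hF']
  have hle : ∀ X, ∫ Y, (if c ≤ ∑ v ∈ A (mixBits (slotBits w t) X Y), rate (bitProb D) w t v ∧
      {v | v ∈ A (mixBits (slotBits w t) X Y) ∧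
        Fires w (mixBits (slotBits w t) X Y) t v}.Subsingleton then (1 : ℝ) else 0) ∂(law D n) ≤
      5 * Real.exp (-(c / 2)) := by
    intro X
    simp only [hA, hfm]
    by_cases h : c ≤ ∑ v ∈ A X, rate (bitProb D) w t v
    · simp only [h, true_and]
      rw [← law_real_eq_integral D (T := t)]
      · refine (law_real_subsingleton_le D w t (A X)).trans ?_
        gcongr
      · intro Y Y' hY
        have h2 := fun v => hf v Y Y' hY
        simp only at h2
        simp only [h2]
    · simp only [h, false_and, if_false, integral_zero]
      positivity
  calc _ ≤ ∫ _ : Bits n, 5 * Real.exp (-(c / 2)) ∂(law D n) :=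
        integral_mono_of_nonneg (ae_of_all _ fun X => integral_nonneg fun Y => by
          positivity) (integrable_const _) (ae_of_all _ hle)
    _ = _ := by simp

/-- If in each slot either nobody can fire or the contention is high, then probably nobody
succeeds. -/
theorem law_real_succeededBefore_nonempty_le {n : ℕ} (D : LocalClockProtocol) (w : Fin n → ℕ∞)
    (c : ℝ) (t : ℕ) (h : ∀ s < t, (∀ v, rate (bitProb D) w s v = 0) ∨
      c ≤ ∑ v, rate (bitProb D) w s v) :
    (law D n).real {X | (succeededBefore w X t).Nonempty} ≤ t * (5 * Real.exp (-(c / 2))) := by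
  classical
  induction t with
  | zero => simp [succeededBefore]
  | succ t ih =>
    have hsub : {X : Bits n | (succeededBefore w X (t + 1)).Nonempty} ⊆
        {X | (succeededBefore w X t).Nonempty} ∪
          ⋃ a ∈ (Finset.univ : Finset (Fin n)), {X | {v | v ∈ Set.univ ∧ Fires w X t v} = {a}} := by
      rintro X ⟨u, hu⟩
      -- Only the first success matters: until then every party still contends, and the full
      -- contention of the slot is available.
      by_cases h0 : (succeededBefore w X t).Nonempty
      · exact Or.inl h0
      · have h0' := Set.not_nonempty_iff_eq_empty.1 h0
        obtain ⟨s, hs, hsu⟩ := mem_succeededBefore.1 hu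
        have hst : s = t := by
          by_contra hne
          exact h0 ⟨u, mem_succeededBefore.2 ⟨s, by omega, hsu⟩⟩
        subst hst
        refine Or.inr (Set.mem_biUnion (x := u) (Finset.mem_coe.2 (Finset.mem_univ u)) ?_)
        have := hsu
        unfold SucceedsAt at this
        rw [grabbers_eq, h0'] at this
        simpa using this
    have hnow : (law D n).real (⋃ a ∈ (Finset.univ : Finset (Fin n)),
        {X | {v | v ∈ Set.univ ∧ Fires w X t v} = {a}}) ≤ 5 * Real.exp (-(c / 2)) := by
      rcases h t (by omega) with h0 | hc
      · refine (measureReal_biUnion_finset_le _ _).trans ?_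
        refine le_trans (le_of_eq (Finset.sum_eq_zero fun a _ => ?_))
          (by positivity : 0 ≤ 5 * Real.exp (-(c / 2)))
        rw [law_real_sole, soleProb, if_pos (Set.mem_univ a), h0, zero_mul]
      · refine le_trans (measureReal_mono ?_) ((law_real_subsingleton_le D w t Finset.univ).trans
          (by gcongr))
        intro X hX
        simp only [Set.mem_iUnion] at hX
        obtain ⟨a, -, ha⟩ := hX
        have ha : {v | v ∈ Set.univ ∧ Fires w X t v} = {a} := ha
        change {v | v ∈ Finset.univ ∧ Fires w X t v}.Subsingleton
        simp only [Set.mem_univ, true_and, Finset.mem_univ] at ha ⊢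
        rw [ha]
        exact Set.subsingleton_singleton
    calc _ ≤ _ := measureReal_mono hsub
      _ ≤ _ := measureReal_union_le _ _
      _ ≤ t * (5 * Real.exp (-(c / 2))) + 5 * Real.exp (-(c / 2)) :=
        add_le_add (ih fun s hs => h s (by omega)) hnow
      _ = _ := by push_cast; ring

open Classical in
/-- The indicator of a proposition. -/
def ind (P : Prop) : ℝ := if P then 1 else 0

theorem ind_of {P : Prop} (h : P) : ind P = 1 := if_pos h

theorem ind_of_not {P : Prop} (h : ¬ P) : ind P = 0 := if_neg h

theorem ind_nonneg (P : Prop) : 0 ≤ ind P := by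
  unfold ind; split_ifs <;> norm_num

theorem FinDep.ind {n T : ℕ} {P : Bits n → Prop} (h : FinDep T P) : FinDep T fun X => ind (P X) :=
  h.comp ContentionResolution.ind

theorem integral_ind {n : ℕ} (D : LocalClockProtocol) {T : ℕ} {P : Bits n → Prop}
    (hP : FinDep T P) : ∫ X, ind (P X) ∂(law D n) = (law D n).real {X | P X} := by
  classical
  rw [law_real_eq_integral D hP]
  refine integral_congr_ae (ae_of_all _ fun X => ?_)
  unfold ind
  congr

/-! ### A batch of parties that have not succeeded before age `T` -/

theorem IsMemoryless.real_forall_false {D : LocalClockProtocol} (hD : IsMemoryless D)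
    (K : Finset ℕ) :
    (D : Measure (ℕ → Bool)).real {x | ∀ k ∈ K, x k = false} = ∏ k ∈ K, (1 - bitProb D k) := by
  have hset : ∀ k, (fun x : ℕ → Bool => x k) ⁻¹' {false} = {x | x k = true}ᶜ := by
    intro k
    ext x
    simp
  have h := iIndepFun.measure_inter_preimage_eq_mul (f := fun (k : ℕ) (x : ℕ → Bool) => x k)
    (β := fun _ => Bool) hD K (sets := fun _ => {false}) fun _ _ => measurableSet_singleton _
  have hs : {x : ℕ → Bool | ∀ k ∈ K, x k = false} =
      ⋂ k ∈ K, (fun x : ℕ → Bool => x k) ⁻¹' {false} := by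
    ext x; simp
  rw [hs, Measure.real, h, ENNReal.toReal_prod]
  refine Finset.prod_congr rfl fun k _ => ?_
  rw [hset, ← Measure.real, probReal_compl_eq_one_sub, bitProb]
  exact (measurable_pi_apply (X := fun _ : ℕ => Bool) k) (measurableSet_singleton true)

section Window

variable {n : ℕ} {D : LocalClockProtocol} {w : Fin n → ℕ∞} {s T : ℕ} {K : Finset ℕ}

open Classical in
-- The bits of `v` at ages from `T` on are used after slot `s + T`. Redrawing those at the ages of
-- `K` keeps the first event and makes the second one independent of it.
theorem law_real_not_mem_and_silent (hD : IsMemoryless D) {v : Fin n} (hv : w v = s)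
    (hK : ∀ k ∈ K, T ≤ k) :
    (law D n).real {X | v ∉ succeededBefore w X (s + T + 1) ∧ ∀ k ∈ K, X v k = false} =
      (∏ k ∈ K, (1 - bitProb D k)) * (law D n).real {X | v ∉ succeededBefore w X (s + T + 1)} := by
  obtain ⟨b, hb⟩ : ∃ b : ℕ, ∀ k ∈ K, k < b :=
    ⟨K.sup id + 1, fun k hk => Nat.lt_succ_of_le (Finset.le_sup (f := id) hk)⟩
  set M := max (s + T + 1) b
  have hdepS : FinDep M fun X : Bits n => v ∉ succeededBefore w X (s + T + 1) := by
    intro X X' hX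
    have := (nonAnticipating_const w).finDep_succeededBefore (s + T + 1) X X'
      fun v k hk => hX v k (hk.trans_le (le_max_left _ _))
    simp only at this
    simp only [this]
  have hdepK : FinDep M fun X : Bits n => ∀ k ∈ K, X v k = false := by
    intro X X' hX
    refine propext (forall₂_congr fun k hk => ?_)
    rw [hX v k ((hb k hk).trans_le (le_max_right _ _))]
  have hdep : FinDep M fun X : Bits n => v ∉ succeededBefore w X (s + T + 1) ∧
      ∀ k ∈ K, X v k = false := hdepS.comp₂ hdepK And
  set C : Fin n → Set ℕ := fun u => if u = v then K else ∅
  have hF : FinDep M fun X : Bits n => ind (v ∉ succeededBefore w X (s + T + 1) ∧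
      ∀ k ∈ K, X v k = false) := hdep.ind
  have hS : ∀ X Y, succeededBefore w (mixBits C X Y) (s + T + 1) =
      succeededBefore w X (s + T + 1) := by
    intro X Y
    refine succeededBefore_congr (t := s + T + 1) (fun _ _ _ => Iff.rfl) (fun u k hk => ?_) _ le_rfl
    have : k ∉ C u := by
      intro hmem
      simp only [C] at hmem
      split_ifs at hmem with huv
      · have hkT := hK k (Finset.mem_coe.1 hmem)
        rw [huv, hv] at hk
        norm_cast at hk
        omega
      · exact hmem
    simp [mixBits, this]
  have hsil : ∀ X Y, (∀ k ∈ K, mixBits C X Y v k = false) ↔ ∀ k ∈ K, Y v k = false := by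
    intro X Y
    refine forall₂_congr fun k hk => ?_
    have : k ∈ C v := by simp [C, hk]
    simp [mixBits, this]
  have hprod : (law D n).real {Y | ∀ k ∈ K, Y v k = false} = ∏ k ∈ K, (1 - bitProb D k) := by
    have : {Y : Bits n | ∀ k ∈ K, Y v k = false} = {Y | ∀ u, Y u ∈
        (if u = v then {x : ℕ → Bool | ∀ k ∈ K, x k = false} else Set.univ)} := by
      ext Y
      simp only [Set.mem_ofPred_eq]
      constructor
      · intro h u
        split_ifs with huv
        · subst huv; exact h
        · trivial
      · intro h
        simpa using h v
    rw [this, law_real_pi, Finset.prod_eq_single v]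
    · rw [if_pos rfl, hD.real_forall_false]
    · intro u _ huv
      rw [if_neg huv]; simp
    · simp
  rw [← integral_ind D hdep, integral_mixBits hD C hF, ← integral_ind D hdepS,
    ← integral_const_mul]
  refine integral_congr_ae (ae_of_all _ fun X => ?_)
  simp only [hS, hsil]
  by_cases hX : v ∉ succeededBefore w X (s + T + 1)
  · simp only [hX, not_false_eq_true, true_and, ind_of trivial, mul_one]
    rw [← hprod, ← integral_ind D hdepK]
  · simp [hX, ind_of_not not_false]

/-- The parties of the batch `B` that have not succeeded before age `T` and do not fire at an age
of `K`. -/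
def silent (w : Fin n → ℕ∞) (B : Finset (Fin n)) (t : ℕ) (K : Finset ℕ)
    (X : Bits n) : Finset (Fin n) :=
  open Classical in B.filter fun v => v ∉ succeededBefore w X t ∧ ∀ k ∈ K, X v k = false

variable {B : Finset (Fin n)} {l : ℕ}

open Classical in
theorem finDep_silent {M : ℕ} (hM : s + T + 1 ≤ M) (hK : ∀ k ∈ K, k < M) :
    FinDep M (silent w B (s + T + 1) K) := by
  intro X X' hX
  have := (nonAnticipating_const w).finDep_succeededBefore (s + T + 1) X X'
      fun v k hk => hX v k (hk.trans_le hM)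
  simp only at this
  unfold silent
  rw [this]
  refine Finset.filter_congr fun v _ => and_congr_right fun _ => forall₂_congr fun k hk => ?_
  rw [hX v k (hK k hk)]

open Classical in
-- Membership depends on the bits used up to slot `s + T` and on the ages in `K`. In slot `s + k +
-- 1` the batch uses age `k`, which is not in `K`, so the set is independent of that slot, as
-- `law_real_subsingleton_of_invariant` requires.
theorem silent_mixBits (hB : ∀ v ∈ B, w v = s) {k : ℕ} (hk : T ≤ k) (hkK : k ∉ K) (X Y : Bits n) :
    silent w B (s + T + 1) K (mixBits (slotBits w (s + k + 1)) X Y) =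
      silent w B (s + T + 1) K X := by
  have hS : succeededBefore w (mixBits (slotBits w (s + k + 1)) X Y) (s + T + 1) =
      succeededBefore w X (s + T + 1) :=
    (nonAnticipating_const w).succeededBefore_mix (s + k + 1) X Y (by omega)
  unfold silent
  rw [hS]
  refine Finset.filter_congr fun v hv => and_congr_right fun _ => forall₂_congr fun j hj => ?_
  have : j ∉ slotBits w (s + k + 1) v := by
    intro h
    have h : w v + j + 1 = ((s + k + 1 : ℕ) : ℕ∞) := h
    rw [hB v hv] at h
    norm_cast at h
    have : j = k := by omega
    exact hkK (this ▸ hj)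
  simp [mixBits, this]

open Classical in
/-- If in all slots of the window at least two silent parties fire or only ages of `K` occur, then
no silent party succeeds. -/
theorem silent_disjoint_succeededBefore (hB : ∀ v ∈ B, w v = s) {X : Bits n}
    (h : ∀ k, T ≤ k → k < l → k ∉ K →
      ¬ {v | v ∈ silent w B (s + T + 1) K X ∧ Fires w X (s + k + 1) v}.Subsingleton) :
    ∀ t, s + T + 1 ≤ t → t ≤ s + l + 1 → ∀ v ∈ silent w B (s + T + 1) K X,
      v ∉ succeededBefore w X t := by
  intro t ht
  induction t, ht using Nat.le_induction with
  | base =>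
    intro _ v hv
    exact (Finset.mem_filter.1 hv).2.1
  | succ t ht ih =>
    intro htl v hv hvS
    have ih := ih (by omega)
    obtain ⟨r, hr, hsr⟩ := mem_succeededBefore.1 hvS
    have hrt : r = t := by
      by_contra hne
      exact ih v hv (mem_succeededBefore.2 ⟨r, by omega, hsr⟩)
    subst hrt
    obtain ⟨k, rfl⟩ : ∃ k, r = s + k + 1 := ⟨r - s - 1, by omega⟩
    by_cases hk : k ∈ K
    · obtain ⟨j, hj, hX⟩ := hsr.fires
      rw [hB v (Finset.mem_filter.1 hv).1] at hj
      norm_cast at hj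
      have : j = k := by omega
      subst this
      have := (Finset.mem_filter.1 hv).2.2 j hk
      rw [hX] at this
      cases this
    · refine h k (by omega) (by omega) hk ?_
      have hsing : {u | u ∉ succeededBefore w X (s + k + 1) ∧ Fires w X (s + k + 1) u} = {v} := hsr
      refine (Set.subsingleton_singleton (a := v)).anti ?_
      rw [← hsing]
      exact fun u hu => ⟨ih u hu.1, hu.2⟩

open Classical in
-- There are three cases: at most `y` parties are silent; or in some slot outside `K` at most one
-- silent party fires despite contention at least `c`; or the silent parties block one another
-- throughout the window, and none of them has succeeded at its end.
theorem card_silent_le (hB : ∀ v ∈ B, w v = s) {y c : ℝ} (hy : 0 ≤ y)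
    (hlarge : ∀ k, T ≤ k → k < l → k ∉ K → c ≤ y * bitProb D k) (hT : T ≤ l) (X : Bits n) :
    ((silent w B (s + T + 1) K X).card : ℝ) ≤
      (∑ v ∈ B, ind (v ∉ succeededBefore w X (s + l + 1))) + y +
      B.card * ∑ k ∈ Finset.Ico T l \ K,
        ind (c ≤ ∑ v ∈ silent w B (s + T + 1) K X, rate (bitProb D) w (s + k + 1) v ∧
          {v | v ∈ silent w B (s + T + 1) K X ∧ Fires w X (s + k + 1) v}.Subsingleton) := by
  set Q := silent w B (s + T + 1) K X with hQ
  have hQB : Q ⊆ B := Finset.filter_subset _ _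
  set φ : ℕ → ℝ := fun k => ind (c ≤ ∑ v ∈ Q, rate (bitProb D) w (s + k + 1) v ∧
          {v | v ∈ Q ∧ Fires w X (s + k + 1) v}.Subsingleton) with hφ
  have hφ0 : ∀ k, 0 ≤ φ k := fun k => ind_nonneg _
  have h1 : 0 ≤ ∑ v ∈ B, ind (v ∉ succeededBefore w X (s + l + 1)) :=
    Finset.sum_nonneg fun _ _ => ind_nonneg _
  have h2 : 0 ≤ (B.card : ℝ) * ∑ k ∈ Finset.Ico T l \ K, φ k :=
    mul_nonneg (Nat.cast_nonneg _) (Finset.sum_nonneg fun k _ => hφ0 k)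
  by_cases hcard : (Q.card : ℝ) ≤ y
  · linarith
  push Not at hcard
  by_cases hbad : ∃ k ∈ Finset.Ico T l \ K, φ k = 1
  · obtain ⟨k, hk, hk1⟩ := hbad
    have h3 : (1 : ℝ) ≤ ∑ k ∈ Finset.Ico T l \ K, φ k :=
      hk1 ▸ Finset.single_le_sum (fun k _ => hφ0 k) hk
    have h4 : (Q.card : ℝ) ≤ B.card := by exact_mod_cast Finset.card_le_card hQB
    have h5 : (B.card : ℝ) ≤ B.card * ∑ k ∈ Finset.Ico T l \ K, φ k :=
      le_mul_of_one_le_right (Nat.cast_nonneg _) h3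
    linarith
  · push Not at hbad
    have hgood : ∀ k, T ≤ k → k < l → k ∉ K →
        ¬ {v | v ∈ Q ∧ Fires w X (s + k + 1) v}.Subsingleton := by
      intro k hk1 hk2 hk3 hsub
      refine hbad k (by simp [hk1, hk2, hk3]) (ind_of ⟨?_, hsub⟩)
      have : ∀ v ∈ Q, rate (bitProb D) w (s + k + 1) v = bitProb D k := by
        intro v hv
        refine rate_eq_of_eq _ ?_
        rw [hB v (hQB hv)]
        push_cast; rfl
      rw [Finset.sum_congr rfl this, Finset.sum_const, nsmul_eq_mul]
      exact (hlarge k hk1 hk2 hk3).trans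
        (mul_le_mul_of_nonneg_right hcard.le (bitProb_nonneg D k))
    have hdis := silent_disjoint_succeededBefore hB hgood (s + l + 1) (by omega) le_rfl
    have h3 : (Q.card : ℝ) ≤ ∑ v ∈ B, ind (v ∉ succeededBefore w X (s + l + 1)) := by
      rw [Finset.card_eq_sum_ones, Nat.cast_sum]
      calc ∑ v ∈ Q, ((1 : ℕ) : ℝ)
          = ∑ v ∈ Q, ind (v ∉ succeededBefore w X (s + l + 1)) :=
            Finset.sum_congr rfl fun v hv => by rw [ind_of (hdis v hv)]; simp
        _ ≤ _ := Finset.sum_le_sum_of_subset_of_nonneg hQB fun _ _ _ => ind_nonneg _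
    linarith

open Classical in
/-- A large batch keeps a contention that is too high as long as the probabilities at the ages in
question are large or their sum is small. -/
theorem sum_law_real_not_mem_ge (hD : IsMemoryless D) (hB : ∀ v ∈ B, w v = s) (hT : T ≤ l)
    (hK : K ⊆ Finset.Ico T l) {y c : ℝ} (hy : 0 ≤ y)
    (hlarge : ∀ k, T ≤ k → k < l → k ∉ K → c ≤ y * bitProb D k) :
    (∏ k ∈ K, (1 - bitProb D k)) *
        (∑ v ∈ B, (law D n).real {X | v ∉ succeededBefore w X (s + T + 1)}) ≤
      (∑ v ∈ B, (law D n).real {X | v ∉ succeededBefore w X (s + l + 1)}) + y +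
        B.card * (l * (5 * Real.exp (-(c / 2)))) := by
  have hKT : ∀ k ∈ K, T ≤ k := fun k hk => (Finset.mem_Ico.1 (hK hk)).1
  have hKl : ∀ k ∈ K, k < l := fun k hk => (Finset.mem_Ico.1 (hK hk)).2
  set M := s + l + 1
  have hdepQ : FinDep M (silent w B (s + T + 1) K) :=
    finDep_silent (by omega) fun k hk => (hKl k hk).trans_le (by omega)
  have hdepS : ∀ v, FinDep M fun X : Bits n => v ∉ succeededBefore w X (s + l + 1) := by
    intro v X X' hX
    have := (nonAnticipating_const w).finDep_succeededBefore (s + l + 1) X X' hX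
    simp only at this
    simp only [this]
  set ψ : ℕ → Bits n → Prop := fun k X =>
    c ≤ ∑ v ∈ silent w B (s + T + 1) K X, rate (bitProb D) w (s + k + 1) v ∧
          {v | v ∈ silent w B (s + T + 1) K X ∧ Fires w X (s + k + 1) v}.Subsingleton with hψ
  have hdepψ : ∀ k ∈ Finset.Ico T l \ K, FinDep M (ψ k) := by
    intro k hk X X' hX
    have hkl : k < l := by simp at hk; exact hk.1.2
    have h1 := hdepQ X X' hX
    have h2 := fun v => (nonAnticipating_const w).finDep_fires (s + k + 1) v X X'
      fun u j hj => hX u j (hj.trans_le (by omega))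
    simp only at h2
    simp only [hψ, h1, h2]
  have hleft : (∏ k ∈ K, (1 - bitProb D k)) *
        (∑ v ∈ B, (law D n).real {X | v ∉ succeededBefore w X (s + T + 1)}) =
      ∫ X, ((silent w B (s + T + 1) K X).card : ℝ) ∂(law D n) := by
    have hcard : ∀ X : Bits n, ((silent w B (s + T + 1) K X).card : ℝ) =
        ∑ v ∈ B, ind (v ∉ succeededBefore w X (s + T + 1) ∧ ∀ k ∈ K, X v k = false) := by
      intro X
      rw [silent, Finset.card_filter, Nat.cast_sum]
      exact Finset.sum_congr rfl fun v _ => by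
        unfold ind; push_cast; congr
    have hdepv : ∀ v, FinDep M fun X : Bits n =>
        v ∉ succeededBefore w X (s + T + 1) ∧ ∀ k ∈ K, X v k = false := by
      intro v X X' hX
      have h1 := (nonAnticipating_const w).finDep_succeededBefore (s + T + 1) X X'
        fun u j hj => hX u j (hj.trans_le (by omega))
      simp only at h1
      simp only [h1]
      refine propext (and_congr_right fun _ => forall₂_congr fun k hk => ?_)
      rw [hX v k ((hKl k hk).trans_le (by omega))]
    simp only [hcard]
    rw [integral_finsetSum _ fun v _ => (hdepv v).ind.integrable, Finset.mul_sum]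
    refine Finset.sum_congr rfl fun v hv => ?_
    rw [← law_real_not_mem_and_silent hD (hB v hv) hKT, integral_ind D (hdepv v)]
  have hi1 : Integrable (fun X : Bits n => ∑ v ∈ B,
      ind (v ∉ succeededBefore w X (s + l + 1))) (law D n) :=
    integrable_finsetSum _ fun v _ => (hdepS v).ind.integrable
  have hi2 : Integrable (fun X : Bits n => ∑ k ∈ Finset.Ico T l \ K,
      ind (ψ k X)) (law D n) :=
    integrable_finsetSum _ fun k hk => (hdepψ k hk).ind.integrable
  have hcardInt : Integrable (fun X => ((silent w B (s + T + 1) K X).card : ℝ)) (law D n) :=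
    (hdepQ.comp fun A => ((A.card : ℕ) : ℝ)).integrable
  rw [hleft]
  refine (integral_mono hcardInt ((hi1.add (integrable_const y)).add (hi2.const_mul (B.card : ℝ)))
    (fun X => card_silent_le (l := l) hB hy hlarge hT X)).trans ?_
  have hbad : ∫ X, ∑ k ∈ Finset.Ico T l \ K, ind (ψ k X) ∂(law D n) ≤
      l * (5 * Real.exp (-(c / 2))) := by
    rw [integral_finsetSum _ fun k hk => (hdepψ k hk).ind.integrable]
    calc ∑ k ∈ Finset.Ico T l \ K, ∫ X, ind (ψ k X) ∂(law D n)
        ≤ ∑ k ∈ Finset.Ico T l \ K, 5 * Real.exp (-(c / 2)) := by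
          refine Finset.sum_le_sum fun k hk => ?_
          rw [integral_ind D (hdepψ k hk)]
          simp only [Finset.mem_sdiff, Finset.mem_Ico] at hk
          exact law_real_subsingleton_of_invariant hD w (s + k + 1) hdepQ
            (silent_mixBits hB hk.1.1 hk.2) c
      _ = ((Finset.Ico T l \ K).card : ℝ) * (5 * Real.exp (-(c / 2))) := by
          rw [Finset.sum_const, nsmul_eq_mul]
      _ ≤ _ := by
          gcongr
          refine (Finset.card_le_card Finset.sdiff_subset).trans ?_
          simp
  have hsum : ∫ X, (∑ v ∈ B, ind (v ∉ succeededBefore w X (s + l + 1)))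
      ∂(law D n) = ∑ v ∈ B, (law D n).real {X | v ∉ succeededBefore w X (s + l + 1)} := by
    rw [integral_finsetSum _ fun v _ => (hdepS v).ind.integrable]
    exact Finset.sum_congr rfl fun v _ => integral_ind D (hdepS v)
  have key : ∀ (a b : Bits n → ℝ), Integrable a (law D n) → Integrable b (law D n) →
      ∫ X, ((a X + y) + B.card * b X) ∂(law D n) =
        ∫ X, a X ∂(law D n) + y + B.card * ∫ X, b X ∂(law D n) := by
    intro a b ha hb
    have h1 := integral_add (ha.add (integrable_const y)) (hb.const_mul (B.card : ℝ))
    have h2 := integral_add ha (integrable_const (μ := law D n) y)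
    simp only [Pi.add_apply] at h1
    rw [h1, h2, integral_const_mul]
    simp
  refine (key _ _ hi1 hi2).le.trans ?_
  rw [hsum]
  gcongr

end Window

/-! ### Wake-up times with high contention at all times -/

theorem rate_natCast {n : ℕ} (f : ℕ → ℝ) (w : Fin n → ℕ) (t : ℕ) (v : Fin n) :
    rate f (fun v => (w v : ℕ∞)) t v = if w v < t then f (t - 1 - w v) else 0 := by
  simp [rate]

theorem exp_neg_le_one_sub_half {x : ℝ} (h0 : 0 ≤ x) (h1 : x ≤ 1) :
    Real.exp (-x) ≤ 1 - x / 2 := by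
  rw [Real.exp_neg, inv_le_iff_one_le_mul₀ (Real.exp_pos _)]
  have : x + 1 ≤ Real.exp x := Real.add_one_le_exp _
  nlinarith

theorem sum_range_le_sum_ages {f : ℕ → ℝ} (h0 : ∀ k, 0 ≤ f k) {a t L : ℕ} (hat : a ≤ t)
    (htL : t ≤ L) :
    ∑ k ∈ Finset.range a, f k ≤ ∑ j : Fin L, if (j : ℕ) < t then f (t - 1 - j) else 0 := by
  rw [Fin.sum_univ_eq_sum_range (fun j => if j < t then f (t - 1 - j) else 0) L]
  calc ∑ k ∈ Finset.range a, f k ≤ ∑ k ∈ Finset.range t, f k :=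
        Finset.sum_le_sum_of_subset_of_nonneg (Finset.range_mono hat) fun k _ _ => h0 k
    _ = ∑ j ∈ Finset.range t, f (t - 1 - j) := (Finset.sum_range_reflect f t).symm
    _ = ∑ j ∈ Finset.range t, if j < t then f (t - 1 - j) else 0 :=
        Finset.sum_congr rfl fun j hj => (if_pos (Finset.mem_range.1 hj)).symm
    _ ≤ _ := Finset.sum_le_sum_of_subset_of_nonneg (Finset.range_mono htL) fun k _ _ => by
        split_ifs; exacts [h0 _, le_rfl]

/-- Some wake-up times keep the contention above `c` for a long time. -/
theorem exists_wake_contention_ge {f : ℕ → ℝ} (h0 : ∀ k, 0 ≤ f k) (h1 : ∀ k, f k ≤ 1)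
    {a L m : ℕ} (hL : 0 < L) {c : ℝ} (hc : 4 * c * L ≤ m * ∑ k ∈ Finset.range a, f k)
    (hsmall : (L + 1) * Real.exp (-c) < 1) :
    ∃ w : Fin m → ℕ, ∀ t, a ≤ t → t ≤ L →
      c ≤ ∑ v, rate f (fun v => (w v : ℕ∞)) t v := by
  set g : ℕ → ℕ → ℝ := fun t j => if j < t then f (t - 1 - j) else 0 with hg
  have hg0 : ∀ t j, 0 ≤ g t j := fun t j => by
    simp only [hg]; split_ifs; exacts [h0 _, le_rfl]
  have hg1 : ∀ t j, g t j ≤ 1 := fun t j => by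
    simp only [hg]; split_ifs; exacts [h1 _, zero_le_one]
  have hL' : (0 : ℝ) < L := by exact_mod_cast hL
  -- First-moment argument over all `L ^ m` wake-up vectors. A slot with contention below `c`
  -- contributes more than `exp (-c)` to the sum over slots of `exp (-contention)`. On average over
  -- the vectors a slot contributes at most `exp (-2 c)`, and there are at most `L + 1` slots.
  by_contra hno
  push Not at hno
  have hbad : ∀ w : Fin m → Fin L, Real.exp (-c) ≤
      ∑ t ∈ Finset.Icc a L, ∏ v, Real.exp (-g t (w v)) := by
    intro w
    obtain ⟨t, ht1, ht2, ht⟩ := hno fun v => (w v : ℕ)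
    simp only [rate_natCast] at ht
    refine le_trans ?_ (Finset.single_le_sum (f := fun t => ∏ v, Real.exp (-g t (w v)))
      (fun t _ => (Finset.prod_nonneg fun v _ => (Real.exp_pos _).le))
      (Finset.mem_Icc.2 ⟨ht1, ht2⟩))
    rw [← Real.exp_sum, Finset.sum_neg_distrib]
    exact Real.exp_le_exp.2 (neg_le_neg ht.le)
  have hsum := Finset.sum_le_sum fun (w : Fin m → Fin L) (_ : w ∈ Finset.univ) => hbad w
  rw [Finset.sum_comm, Finset.sum_const, Finset.card_univ, Fintype.card_fun, Fintype.card_fin,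
    Fintype.card_fin, nsmul_eq_mul] at hsum
  have hslot : ∀ t ∈ Finset.Icc a L, ∑ w : Fin m → Fin L, ∏ v, Real.exp (-g t (w v)) ≤
      (L : ℝ) ^ m * Real.exp (-(2 * c)) := by
    intro t ht
    obtain ⟨ht1, ht2⟩ := Finset.mem_Icc.1 ht
    rw [← Fintype.sum_pow (fun j : Fin L => Real.exp (-g t j)) m]
    set S := ∑ k ∈ Finset.range a, f k
    have hS0 : 0 ≤ S := Finset.sum_nonneg fun k _ => h0 k
    -- A uniformly random wake-up time gives mean contention at least `S / L`, because a slot `t ≥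
    -- a` sees every age below `a`. The linear bound `exp (-x) ≤ 1 - x / 2` on `[0, 1]` turns this
    -- mean into an exponential moment.
    have hone : ∑ j : Fin L, Real.exp (-g t j) ≤ L * Real.exp (-(S / (2 * L))) := by
      calc ∑ j : Fin L, Real.exp (-g t j) ≤ ∑ j : Fin L, (1 - g t j / 2) :=
            Finset.sum_le_sum fun j _ => exp_neg_le_one_sub_half (hg0 _ _) (hg1 _ _)
        _ = L - (∑ j : Fin L, g t j) / 2 := by
            rw [Finset.sum_sub_distrib, Finset.sum_div]; simp
        _ ≤ L - S / 2 := by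
            have := sum_range_le_sum_ages h0 ht1 ht2
            linarith
        _ = L * (-(S / (2 * L)) + 1) := by field_simp; ring
        _ ≤ _ := mul_le_mul_of_nonneg_left (Real.add_one_le_exp _) hL'.le
    calc (∑ j : Fin L, Real.exp (-g t j)) ^ m ≤ (L * Real.exp (-(S / (2 * L)))) ^ m :=
          pow_le_pow_left₀ (Finset.sum_nonneg fun _ _ => (Real.exp_pos _).le) hone m
      _ = (L : ℝ) ^ m * Real.exp (-(m * S / (2 * L))) := by
          rw [mul_pow, ← Real.exp_nat_mul]; ring_nf
      _ ≤ _ := by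
          gcongr
          rw [le_div_iff₀ (by positivity)]
          linarith
  have hall := hsum.trans (Finset.sum_le_sum hslot)
  rw [Finset.sum_const, nsmul_eq_mul, Nat.card_Icc] at hall
  have hcard : ((L + 1 - a : ℕ) : ℝ) ≤ L + 1 := by exact_mod_cast Nat.sub_le _ _
  have hpow : (0 : ℝ) < (L : ℝ) ^ m := by positivity
  have hexp : Real.exp (-(2 * c)) = Real.exp (-c) * Real.exp (-c) := by
    rw [← Real.exp_add]; ring_nf
  have hec := Real.exp_pos (-c)
  have : ((L ^ m : ℕ) : ℝ) * Real.exp (-c) <  (L : ℝ) ^ m * Real.exp (-c) := by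
    refine hall.trans_lt ?_
    calc ((L + 1 - a : ℕ) : ℝ) * ((L : ℝ) ^ m * Real.exp (-(2 * c)))
        ≤ (L + 1) * ((L : ℝ) ^ m * Real.exp (-(2 * c))) := by gcongr
      _ = ((L + 1) * Real.exp (-c)) * ((L : ℝ) ^ m * Real.exp (-c)) := by rw [hexp]; ring
      _ < 1 * ((L : ℝ) ^ m * Real.exp (-c)) := by gcongr
      _ = _ := one_mul _
  push_cast at this
  exact lt_irrefl _ this

/-! ### Jamming -/

theorem sum_rate_le {n : ℕ} {p : ℕ → ℝ} (h0 : ∀ k, 0 ≤ p k) (w : Fin n → ℕ∞) (v : Fin n) (E : ℕ) :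
    ∑ r ∈ Finset.range (E + 1), rate p w r v ≤ ∑ k ∈ Finset.range E, p k := by
  unfold rate
  generalize w v = a
  induction a using ENat.recTopCoe with
  | top => simp; exact Finset.sum_nonneg fun k _ => h0 k
  | coe a =>
    have : ∑ r ∈ Finset.range (E + 1), (if (a : ℕ∞) < (r : ℕ∞) then p (r - 1 - (a : ℕ∞).toNat) else 0) ≤
        ∑ k ∈ Finset.range (E - a), p k := by
      induction E with
      | zero => simp
      | succ E ih =>
        rw [Finset.sum_range_succ _ (E + 1)]
        by_cases ha : a < E + 1
        · rw [if_pos (by exact_mod_cast ha), show E + 1 - a = (E - a) + 1 by omega,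
            Finset.sum_range_succ _ (E - a)]
          simpa using ih
        · rw [if_neg (by exact_mod_cast ha), show E + 1 - a = 0 by omega]
          rw [show E - a = 0 by omega] at ih
          simpa using ih
    exact this.trans (Finset.sum_le_sum_of_subset_of_nonneg (Finset.range_mono (by omega))
      fun k _ _ => h0 k)

section Jam

variable {n : ℕ} {D : LocalClockProtocol}

open Classical in
/-- The part of the load in slot `t` that the parties of `S` would have contributed. -/
def deadLoad (f : ℕ → ℝ) (w : Fin n → ℕ∞) (J : Finset (Fin n)) (S : Set (Fin n)) (t : ℕ) : ℝ :=
  ∑ v ∈ J.filter (fun v => v ∈ S), rate f w t v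

/-- The parties that have succeeded account for at most half of the load. -/
def Calm (f : ℕ → ℝ) (w : Fin n → ℕ∞) (J : Finset (Fin n)) (X : Bits n) (t : ℕ) : Prop :=
  deadLoad f w J (succeededBefore w X t) t ≤ (∑ v ∈ J, rate f w t v) / 2

variable {f : ℕ → ℝ} {w : Fin n → ℕ∞} {J : Finset (Fin n)} {ρ c : ℝ}

open Classical in
theorem deadLoad_insert {S : Set (Fin n)} {a : Fin n} (ha : a ∉ S) (t : ℕ) :
    deadLoad f w J (S ∪ {a}) t = deadLoad f w J S t + if a ∈ J then rate f w t a else 0 := by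
  unfold deadLoad
  rw [Finset.sum_filter, Finset.sum_filter]
  by_cases haJ : a ∈ J
  · rw [if_pos haJ, ← Finset.add_sum_erase _ _ haJ, ← Finset.add_sum_erase (a := a) J
      (fun v => if v ∈ S then rate f w t v else 0) haJ, if_pos (Set.mem_union_right S (Set.mem_singleton a)), if_neg ha, zero_add,
      add_comm]
    congr 1
    refine Finset.sum_congr rfl fun v hv => ?_
    have : v ≠ a := Finset.ne_of_mem_erase hv
    simp [this]
  · rw [if_neg haJ, add_zero]
    refine Finset.sum_congr rfl fun v hv => ?_
    have : v ≠ a := fun h => haJ (h ▸ hv)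
    simp [this]

theorem succeededBefore_succ_of_succeedsAt {X : Bits n} {t : ℕ} {a : Fin n}
    (h : SucceedsAt w X t a) :
    succeededBefore w X (t + 1) = succeededBefore w X t ∪ {a} := by
  change succeededBefore w X t ∪ {u | SucceedsAt w X t u} = _
  congr 1
  ext u
  exact ⟨fun hu => succeedsAt_unique hu h, fun hu => by rw [Set.mem_singleton_iff.1 hu]; exact h⟩

theorem succeededBefore_succ_of_none {X : Bits n} {t : ℕ} (h : ∀ a, ¬ SucceedsAt w X t a) :
    succeededBefore w X (t + 1) = succeededBefore w X t := by
  change succeededBefore w X t ∪ {u | SucceedsAt w X t u} = _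
  rw [Set.union_eq_left]
  exact fun u hu => (h u hu).elim

theorem finDep_calm (t : ℕ) : FinDep t fun X => Calm f w J X t := by
  intro X X' hX
  have := (nonAnticipating_const w).finDep_succeededBefore t X X' hX
  simp only at this
  simp only [Calm, this]

theorem exp_half_le_two : Real.exp (1 / 2) ≤ 2 := by
  have h := Real.add_one_le_exp (-(1 / 2 : ℝ))
  rw [Real.exp_neg] at h
  have h2 := Real.exp_pos (1 / 2)
  rw [le_inv_comm₀ (by norm_num) h2] at h
  norm_num at h ⊢
  linarith

open Classical in
-- In a calm slot the surviving jammers still provide contention `c / 2`; the factor `2 ≥ exp (1/2)`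
-- accounts for the possible share of `a`.
theorem soleProb_le_of_calm (hf0 : ∀ k, 0 ≤ f k) (hf : ∀ k, f k ≤ bitProb D k)
    (hfρ : ∀ k, f k ≤ ρ) (hρ : ρ ≤ 1 / 2) {X : Bits n} {t : ℕ}
    (hc : c ≤ ∑ v ∈ J, rate f w t v) (hcalm : Calm f w J X t) (a : Fin n) :
    soleProb (bitProb D) w t (succeededBefore w X t)ᶜ a ≤
      rate (bitProb D) w t a * (2 * Real.exp (-(c / 2))) := by
  set S := succeededBefore w X t
  refine (soleProb_le (J := J.filter fun v => v ∉ S) (bitProb_nonneg D) (bitProb_le_one D) hf0 hf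
    fun v hv => (Finset.mem_filter.1 hv).2).trans ?_
  refine mul_le_mul_of_nonneg_left ?_ (rate_nonneg (bitProb_nonneg D) _ _ _)
  have hsplit := Finset.sum_filter_add_sum_filter_not J (fun v => v ∈ S) (rate f w t)
  have hdead : ∑ v ∈ J.filter (fun v => v ∈ S), rate f w t v ≤ (∑ v ∈ J, rate f w t v) / 2 := hcalm
  have hra : rate f w t a ≤ 1 / 2 :=
    (rate_le ((hf0 0).trans (hfρ 0)) hfρ w t a).trans hρ
  calc Real.exp (-(∑ v ∈ J.filter (fun v => v ∉ S), rate f w t v - rate f w t a))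
      ≤ Real.exp (1 / 2 + -(c / 2)) := Real.exp_le_exp.2 (by linarith)
    _ ≤ 2 * Real.exp (-(c / 2)) := by
        rw [Real.exp_add]
        exact mul_le_mul_of_nonneg_right exp_half_le_two (Real.exp_pos _).le

/-- The probability that too much of the load dies although it never did before. -/
theorem law_real_not_calm_le (hD : IsMemoryless D) (hf0 : ∀ k, 0 ≤ f k)
    (hf : ∀ k, f k ≤ bitProb D k) (hfρ : ∀ k, f k ≤ ρ) (hρ0 : 0 < ρ) (hρ : ρ ≤ 1 / 2)
    {t₀ t E : ℕ} (ht : t₀ ≤ t) (htE : t ≤ E)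
    (hc : ∀ s, t₀ ≤ s → s ≤ t → c ≤ ∑ v ∈ J, rate f w s v)
    (hP : Real.exp (-(c / 2)) * ∑ k ∈ Finset.range E, bitProb D k ≤ 1 / 64) :
    (law D n).real {X | (succeededBefore w X t₀ = ∅ ∧ ∀ s, t₀ ≤ s → s < t → Calm f w J X s) ∧
      ¬ Calm f w J X t} ≤ Real.exp (-(c / (4 * ρ))) := by
  classical
  set κ := 4 * ρ⁻¹ * Real.exp (-(c / 2)) with hκ
  have hκ0 : 0 ≤ κ := by positivity
  set g : ℕ → ℝ := fun r => ∑ v ∈ J, rate (bitProb D) w r v * rate f w t v with hg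
  have hrp : ∀ r v, 0 ≤ rate (bitProb D) w r v := fun r v => rate_nonneg (bitProb_nonneg D) w r v
  have hrf : ∀ r v, 0 ≤ rate f w r v := fun r v => rate_nonneg hf0 w r v
  have hrfρ : ∀ r v, rate f w r v ≤ ρ := fun r v => rate_le hρ0.le hfρ w r v
  set H : ℕ → Bits n → Prop := fun s X =>
    succeededBefore w X t₀ = ∅ ∧ ∀ r, t₀ ≤ r → r < s → Calm f w J X r with hH
  -- Exponential supermartingale for the load that slot `t` loses through earlier successes. As `f ≤
  -- ρ`, the scale `ρ⁻¹` keeps each increment of the exponent at most `1`, and `κ * g r` compensates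
  -- the drift in a calm slot `r`.
  set M : ℕ → Bits n → ℝ := fun s X => ind (H s X) *
    Real.exp (ρ⁻¹ * deadLoad f w J (succeededBefore w X s) t - κ * ∑ r ∈ Finset.Ico t₀ s, g r)
    with hM
  have hMnn : ∀ s X, 0 ≤ M s X := fun s X => mul_nonneg (ind_nonneg _) (Real.exp_pos _).le
  have hHdep : ∀ s, FinDep (max t₀ s) (H s) := by
    intro s X X' hX
    have h1 := (nonAnticipating_const w).finDep_succeededBefore t₀ X X'
      fun v k hk => hX v k (hk.trans_le (le_max_left _ _))
    simp only at h1
    simp only [hH, h1]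
    refine propext (and_congr_right fun _ => forall₃_congr fun r _ hr => ?_)
    exact iff_of_eq (finDep_calm r X X' fun v k hk =>
      hX v k ((hk.trans hr).trans_le (le_max_right _ _)))
  have hMdep : ∀ s, FinDep (max t₀ s) (M s) := by
    intro s X X' hX
    have h1 := (nonAnticipating_const w).finDep_succeededBefore s X X'
      fun v k hk => hX v k (hk.trans_le (le_max_right _ _))
    simp only at h1
    simp only [hM, h1, hHdep s X X' hX]
  have hMdep' : ∀ s, FinDep (max t₀ t) (M (min s t)) := fun s =>
    (hMdep _).mono (max_le_max le_rfl (min_le_right _ _))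
  have hstart : ∀ X, M t₀ X ≤ 1 := by
    intro X
    by_cases h : H t₀ X
    · simp only [hM, ind_of h, h.1, deadLoad]
      simp
    · simp only [hM, ind_of_not h, zero_mul]
      exact zero_le_one
  have hstep : ∀ s X, t₀ ≤ s → s < t → ∃ (b : ℝ) (δ : Fin n → ℝ),
      (∀ X', SamePast s w X w X' →
        M (s + 1) X' ≤ b + ∑ a, if SucceedsAt w X' s a then δ a else 0) ∧
      b + ∑ a, soleProb (bitProb D) w s (succeededBefore w X s)ᶜ a * δ a ≤ M s X := by
    intro s X hs hst
    by_cases hHX : H (s + 1) X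
    · have hHs : H s X := ⟨hHX.1, fun r h1 h2 => hHX.2 r h1 (by omega)⟩
      set b := Real.exp (ρ⁻¹ * deadLoad f w J (succeededBefore w X s) t -
        κ * ∑ r ∈ Finset.Ico t₀ (s + 1), g r) with hb
      refine ⟨b, fun a => b * (if a ∈ J then Real.exp (ρ⁻¹ * rate f w t a) - 1 else 0), ?_, ?_⟩
      · intro X' hX'
        have hS := hX'.succeededBefore (le_refl s)
        have hind : M (s + 1) X' ≤ Real.exp (ρ⁻¹ * deadLoad f w J (succeededBefore w X' (s + 1)) t -
            κ * ∑ r ∈ Finset.Ico t₀ (s + 1), g r) := by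
          by_cases h : H (s + 1) X'
          · simp only [hM, ind_of h, one_mul]; exact le_rfl
          · simp only [hM, ind_of_not h, zero_mul]; positivity
        refine hind.trans ?_
        by_cases hsucc : ∃ a, SucceedsAt w X' s a
        · obtain ⟨a, ha⟩ := hsucc
          rw [sum_succeedsAt_of _ ha, succeededBefore_succ_of_succeedsAt ha,
            deadLoad_insert ha.not_mem, ← hS]
          split_ifs with haJ
          · rw [show ρ⁻¹ * (deadLoad f w J (succeededBefore w X s) t + rate f w t a) -
              κ * ∑ r ∈ Finset.Ico t₀ (s + 1), g r =
              (ρ⁻¹ * deadLoad f w J (succeededBefore w X s) t -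
                κ * ∑ r ∈ Finset.Ico t₀ (s + 1), g r) + ρ⁻¹ * rate f w t a by ring, Real.exp_add,
              ← hb]
            linarith
          · rw [add_zero, mul_zero, add_zero]
        · push Not at hsucc
          rw [sum_succeedsAt_none _ hsucc, succeededBefore_succ_of_none hsucc, ← hS, add_zero]
      · have hb0 : 0 < b := Real.exp_pos _
        have hterm : ∀ a, soleProb (bitProb D) w s (succeededBefore w X s)ᶜ a *
            (b * (if a ∈ J then Real.exp (ρ⁻¹ * rate f w t a) - 1 else 0)) ≤
            b * (κ * if a ∈ J then rate (bitProb D) w s a * rate f w t a else 0) := by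
          intro a
          split_ifs with haJ
          · have h1 := soleProb_le_of_calm hf0 hf hfρ hρ (hc s hs hst.le)
              (hHX.2 s hs (by omega)) a
            have hx0 : 0 ≤ ρ⁻¹ * rate f w t a := mul_nonneg (by positivity) (hrf t a)
            have hx1 : ρ⁻¹ * rate f w t a ≤ 1 := by
              rw [inv_mul_le_iff₀ hρ0, mul_one]; exact hrfρ t a
            have h2 : Real.exp (ρ⁻¹ * rate f w t a) - 1 ≤ 2 * (ρ⁻¹ * rate f w t a) := by
              have := (abs_le.1 (Real.abs_exp_sub_one_sub_id_le (abs_le.2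
                ⟨by linarith, hx1⟩))).2
              nlinarith
            have h3 : 0 ≤ Real.exp (ρ⁻¹ * rate f w t a) - 1 := by
              have := Real.one_le_exp hx0
              linarith
            calc _ ≤ rate (bitProb D) w s a * (2 * Real.exp (-(c / 2))) *
                  (b * (2 * (ρ⁻¹ * rate f w t a))) := by
                  refine mul_le_mul h1 (mul_le_mul_of_nonneg_left h2 hb0.le)
                    (mul_nonneg hb0.le h3) (mul_nonneg (hrp s a) (by positivity))
              _ = _ := by rw [hκ]; ring
          · simp
        calc b + ∑ a, soleProb (bitProb D) w s (succeededBefore w X s)ᶜ a *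
            (b * (if a ∈ J then Real.exp (ρ⁻¹ * rate f w t a) - 1 else 0))
            ≤ b + ∑ a, b * (κ * if a ∈ J then rate (bitProb D) w s a * rate f w t a else 0) :=
              add_le_add_right (Finset.sum_le_sum fun a _ => hterm a) b
          _ = b * (κ * g s + 1) := by
              rw [← Finset.mul_sum, ← Finset.mul_sum, Finset.sum_ite_mem, Finset.univ_inter]
              ring
          _ ≤ b * Real.exp (κ * g s) :=
              mul_le_mul_of_nonneg_left (Real.add_one_le_exp _) hb0.le
          _ = M s X := by
              simp only [hM, ind_of hHs, one_mul]
              rw [hb, ← Real.exp_add, Finset.sum_Ico_succ_top hs]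
              ring_nf
    · refine ⟨0, fun _ => 0, fun X' hX' => ?_, by simpa using hMnn s X⟩
      have : ¬ H (s + 1) X' := by
        intro h
        refine hHX ⟨?_, fun r h1 h2 => ?_⟩
        · rw [hX'.succeededBefore hs]; exact h.1
        · have := h.2 r h1 h2
          unfold Calm at this ⊢
          rw [hX'.succeededBefore (by omega)]
          exact this
      simp only [hM, ind_of_not this, zero_mul]
      simp
  have hEM : ∫ X, M t X ∂(law D n) ≤ 1 := by
    refine ((nonAnticipating_const w).supermartingale hD (M := M) t₀
      (fun s hs => by simpa [max_eq_right hs] using hMdep s) t ht hstep).trans ?_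
    refine (integral_mono (hMdep t₀).integrable (integrable_const 1) hstart).trans ?_
    simp
  have hsub : {X : Bits n | H t X ∧ ¬ Calm f w J X t} ⊆ {X | Real.exp (c / (4 * ρ)) ≤ M t X} := by
    rintro X ⟨hHX, hcalm⟩
    change Real.exp (c / (4 * ρ)) ≤ M t X
    simp only [hM, ind_of hHX, one_mul]
    refine Real.exp_le_exp.2 ?_
    unfold Calm at hcalm
    push Not at hcalm
    set C := ∑ v ∈ J, rate f w t v
    have hcC : c ≤ C := hc t ht le_rfl
    have hC0 : 0 ≤ C := Finset.sum_nonneg fun v _ => hrf t v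
    -- After exchanging the sums, each jammer contributes at most the total mass of the ages times
    -- its rate in slot `t`. With `hP` the compensator is at most an eighth of the exponent that a
    -- loss of half of the load produces.
    have hgsum : ∑ r ∈ Finset.Ico t₀ t, g r ≤ (∑ k ∈ Finset.range E, bitProb D k) * C := by
      simp only [hg]
      rw [Finset.sum_comm, Finset.mul_sum]
      refine Finset.sum_le_sum fun v _ => ?_
      rw [← Finset.sum_mul]
      refine mul_le_mul_of_nonneg_right ?_ (hrf t v)
      refine le_trans (Finset.sum_le_sum_of_subset_of_nonneg ?_ fun r _ _ => hrp r v)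
        (sum_rate_le (bitProb_nonneg D) w v E)
      intro r hr
      simp only [Finset.mem_Ico, Finset.mem_range] at hr ⊢
      omega
    have hκg : κ * ∑ r ∈ Finset.Ico t₀ t, g r ≤ ρ⁻¹ * (C / 16) := by
      calc κ * ∑ r ∈ Finset.Ico t₀ t, g r
          ≤ κ * ((∑ k ∈ Finset.range E, bitProb D k) * C) := by gcongr
        _ = 4 * ρ⁻¹ * C * (Real.exp (-(c / 2)) * ∑ k ∈ Finset.range E, bitProb D k) := by
            rw [hκ]; ring
        _ ≤ 4 * ρ⁻¹ * C * (1 / 64) := by gcongr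
        _ = _ := by ring
    have hdead : ρ⁻¹ * (C / 2) ≤ ρ⁻¹ * deadLoad f w J (succeededBefore w X t) t := by
      gcongr
    have : c / (4 * ρ) ≤ ρ⁻¹ * (C / 4) := by
      rw [show c / (4 * ρ) = ρ⁻¹ * (c / 4) by field_simp]
      gcongr
    have h0 : 0 ≤ ρ⁻¹ * C := by positivity
    linarith
  refine (measureReal_mono hsub).trans ((markov_finDep (hMdep t) (hMnn t) (Real.exp_pos _)).trans ?_)
  rw [Real.exp_neg, ← one_div]
  gcongr

/-- If jamming parties keep the contention high, then a given party is unlikely to succeed. -/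
theorem law_real_mem_succeededBefore_le (hD : IsMemoryless D) (hf0 : ∀ k, 0 ≤ f k)
    (hf : ∀ k, f k ≤ bitProb D k) (hfρ : ∀ k, f k ≤ ρ) (hρ0 : 0 < ρ) (hρ : ρ ≤ 1 / 2)
    {t₀ E : ℕ} (hc : ∀ s, t₀ ≤ s → s ≤ E → c ≤ ∑ v ∈ J, rate f w s v)
    (hP : Real.exp (-(c / 2)) * ∑ k ∈ Finset.range E, bitProb D k ≤ 1 / 64) (u : Fin n) :
    (law D n).real {X | u ∈ succeededBefore w X (E + 1)} ≤
      (law D n).real {X | (succeededBefore w X t₀).Nonempty} +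
        (E + 1) * Real.exp (-(c / (4 * ρ))) + 1 / 32 := by
  classical
  set P := ∑ k ∈ Finset.range E, bitProb D k
  set bad : ℕ → Set (Bits n) := fun t =>
    {X | (succeededBefore w X t₀ = ∅ ∧ ∀ s, t₀ ≤ s → s < t → Calm f w J X s) ∧ ¬ Calm f w J X t}
    with hbad
  set win : ℕ → Set (Bits n) := fun t => {X | Calm f w J X t ∧ SucceedsAt w X t u} with hwin
  have hsub : {X : Bits n | u ∈ succeededBefore w X (E + 1)} ⊆
      {X | (succeededBefore w X t₀).Nonempty} ∪
        ((⋃ t ∈ Finset.Icc t₀ E, bad t) ∪ ⋃ t ∈ Finset.Icc t₀ E, win t) := by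
    intro X hX
    obtain ⟨t, ht, hu⟩ := mem_succeededBefore.1 hX
    by_cases h0 : (succeededBefore w X t₀).Nonempty
    · exact Or.inl h0
    refine Or.inr ?_
    have ht₀ : t₀ ≤ t := by
      by_contra hlt
      exact h0 ⟨u, mem_succeededBefore.2 ⟨t, by omega, hu⟩⟩
    -- A success of `u` in a slot that is not calm is charged to the first such slot, before which
    -- the supermartingale bound is valid.
    by_cases hcalm : Calm f w J X t
    · exact Or.inr (Set.mem_biUnion (x := t) (by simp; omega) ⟨hcalm, hu⟩)
    · have hex : ∃ s, t₀ ≤ s ∧ ¬ Calm f w J X s := ⟨t, ht₀, hcalm⟩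
      refine Or.inl (Set.mem_biUnion (x := Nat.find hex) ?_ ⟨⟨Set.not_nonempty_iff_eq_empty.1 h0,
        fun s h1 h2 => ?_⟩, (Nat.find_spec hex).2⟩)
      · have := Nat.find_le (h := hex) (n := t) ⟨ht₀, hcalm⟩
        have := (Nat.find_spec hex).1
        simp only [Finset.coe_Icc, Set.mem_Icc]
        omega
      · by_contra h3
        exact Nat.find_min hex h2 ⟨h1, h3⟩
  have hbadle : ∀ t ∈ Finset.Icc t₀ E, (law D n).real (bad t) ≤ Real.exp (-(c / (4 * ρ))) := by
    intro t ht
    obtain ⟨h1, h2⟩ := Finset.mem_Icc.1 ht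
    exact law_real_not_calm_le hD hf0 hf hfρ hρ0 hρ h1 h2 (fun s h3 h4 => hc s h3 (h4.trans h2)) hP
  have hwinle : ∀ t ∈ Finset.Icc t₀ E, (law D n).real (win t) ≤
      rate (bitProb D) w t u * (2 * Real.exp (-(c / 2))) := by
    intro t ht
    obtain ⟨h1, h2⟩ := Finset.mem_Icc.1 ht
    have hdep : FinDep t fun X => Calm f w J X t ∧ SucceedsAt w X t u :=
      (finDep_calm t).comp₂ ((nonAnticipating_const w).finDep_succeedsAt t u) And
    have hr0 : 0 ≤ rate (bitProb D) w t u * (2 * Real.exp (-(c / 2))) :=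
      mul_nonneg (rate_nonneg (bitProb_nonneg D) _ _ _) (by positivity)
    have := (nonAnticipating_const w).step_le hD t hdep.ind
      (G := fun _ => rate (bitProb D) w t u * (2 * Real.exp (-(c / 2)))) (T := t)
      (fun _ _ _ => rfl) fun X => ?_
    · rw [integral_ind D hdep] at this
      simpa using this
    · by_cases hcalm : Calm f w J X t
      · refine ⟨0, fun a => if a = u then 1 else 0, fun X' _ => ?_, ?_⟩
        · by_cases hs : Calm f w J X' t ∧ SucceedsAt w X' t u
          · rw [ind_of hs, sum_succeedsAt_of _ hs.2, if_pos rfl, zero_add]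
          · rw [ind_of_not hs, zero_add]
            exact Finset.sum_nonneg fun a _ => by positivity
        · simp only [mul_ite, mul_one, mul_zero, Finset.sum_ite_eq', Finset.mem_univ, if_true,
            zero_add]
          exact soleProb_le_of_calm hf0 hf hfρ hρ (hc t h1 h2) hcalm u
      · refine ⟨0, fun _ => 0, fun X' hX' => ?_, by simpa using hr0⟩
        rw [ind_of_not]
        · simp
        · rintro ⟨h3, -⟩
          unfold Calm at h3 hcalm
          rw [hX'.succeededBefore le_rfl] at hcalm
          exact hcalm h3
  calc _ ≤ _ := measureReal_mono hsub
    _ ≤ (law D n).real {X | (succeededBefore w X t₀).Nonempty} +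
        ((law D n).real (⋃ t ∈ Finset.Icc t₀ E, bad t) +
          (law D n).real (⋃ t ∈ Finset.Icc t₀ E, win t)) :=
        (measureReal_union_le _ _).trans (by gcongr; exact measureReal_union_le _ _)
    _ ≤ (law D n).real {X | (succeededBefore w X t₀).Nonempty} +
        ((E + 1) * Real.exp (-(c / (4 * ρ))) + 1 / 32) := by
        gcongr
        · refine (measureReal_biUnion_finset_le _ _).trans
            ((Finset.sum_le_card_nsmul _ _ _ hbadle).trans ?_)
          rw [nsmul_eq_mul, Nat.card_Icc]
          gcongr
          exact_mod_cast Nat.sub_le _ _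
        · refine (measureReal_biUnion_finset_le _ _).trans ((Finset.sum_le_sum hwinle).trans ?_)
          rw [← Finset.sum_mul]
          have h1 : ∑ t ∈ Finset.Icc t₀ E, rate (bitProb D) w t u ≤ P := by
            refine le_trans (Finset.sum_le_sum_of_subset_of_nonneg ?_
              fun r _ _ => rate_nonneg (bitProb_nonneg D) w r u)
              (sum_rate_le (bitProb_nonneg D) w u E)
            intro r hr
            simp only [Finset.mem_Icc, Finset.mem_range] at hr ⊢
            omega
          calc _ ≤ P * (2 * Real.exp (-(c / 2))) := by gcongr
            _ ≤ _ := by linarith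
    _ = _ := by ring

end Jam

/-! ### Wake-up times that consist of several groups -/

theorem rate_eq_of_wake_eq {n m : ℕ} (f : ℕ → ℝ) {w : Fin n → ℕ∞} {w' : Fin m → ℕ∞} {v : Fin n}
    {v' : Fin m} (h : w v = w' v') (t : ℕ) : rate f w t v = rate f w' t v' := by
  simp [rate, h]

/-- `h` parties are woken up at each time before `d`, `m` parties at the times `wJ`, and `r` parties
at time `s`. -/
theorem exists_wake_groups {n d h m r : ℕ} (hn : n = d * h + m + r) (s : ℕ) (wJ : Fin m → ℕ) :
    ∃ (w : Fin n → ℕ) (J B : Finset (Fin n)),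
      B.card = r ∧ (∀ v ∈ B, w v = s) ∧
      (∀ (g : ℕ → ℝ) t, ∑ v ∈ J, rate g (fun v => (w v : ℕ∞)) t v =
        ∑ i, rate g (fun i => (wJ i : ℕ∞)) t i) ∧
      (∀ g : ℕ → ℝ, (∀ k, 0 ≤ g k) → ∀ i < d, ∀ k,
        h * g k ≤ ∑ v, rate g (fun v => (w v : ℕ∞)) (i + k + 1) v) := by
  classical
  obtain ⟨e⟩ : Nonempty (Fin n ≃ (Fin d × Fin h) ⊕ (Fin m ⊕ Fin r)) :=
    ⟨Fintype.equivOfCardEq (by simp [hn, add_assoc])⟩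
  set W : (Fin d × Fin h) ⊕ (Fin m ⊕ Fin r) → ℕ :=
    Sum.elim (fun x => x.1) (Sum.elim wJ fun _ => s) with hW
  refine ⟨fun v => W (e v),
    Finset.univ.map ⟨fun i => e.symm (Sum.inr (Sum.inl i)), fun i j hij => by simpa using hij⟩,
    Finset.univ.map ⟨fun i => e.symm (Sum.inr (Sum.inr i)), fun i j hij => by simpa using hij⟩,
    by simp, ?_, ?_, ?_⟩
  · intro v hv
    simp only [Finset.mem_map, Finset.mem_univ, true_and] at hv
    obtain ⟨i, rfl⟩ := hv
    change W (e (e.symm (Sum.inr (Sum.inr i)))) = s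
    simp [hW]
  · intro g t
    rw [Finset.sum_map]
    refine Finset.sum_congr rfl fun i _ => rate_eq_of_wake_eq g ?_ t
    change ((W (e (e.symm (Sum.inr (Sum.inl i)))) : ℕ) : ℕ∞) = wJ i
    simp [hW]
  · intro g hg i hi k
    have h1 : ∀ b : Fin h, rate g (fun v => ((W (e v) : ℕ) : ℕ∞)) (i + k + 1)
        (e.symm (Sum.inl (⟨i, hi⟩, b))) = g k := by
      intro b
      refine rate_eq_of_eq _ ?_
      simp [hW]
    calc (h : ℝ) * g k = ∑ b : Fin h, rate g (fun v => ((W (e v) : ℕ) : ℕ∞)) (i + k + 1)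
          (e.symm (Sum.inl (⟨i, hi⟩, b))) := by
          simp only [h1]; simp
      _ = ∑ v ∈ Finset.univ.map ⟨fun b : Fin h => e.symm (Sum.inl (⟨i, hi⟩, b)),
          fun i j hij => by simpa using hij⟩, rate g (fun v => ((W (e v) : ℕ) : ℕ∞)) (i + k + 1) v := by
          rw [Finset.sum_map]; rfl
      _ ≤ _ := Finset.sum_le_sum_of_subset_of_nonneg (Finset.subset_univ _)
          fun v _ _ => rate_nonneg hg _ _ _

/-! ### Protocols with a small latency -/

/-- The latency is at most `ℓ n = o(n log ^ (b + 1) n / log log n)` up to an error probability of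
order `n ^ (-b)`, for all fixed wake-up times. -/
structure SmallLatency (D : LocalClockProtocol) (b : ℕ) (ℓ : ℕ → ℕ) : Prop where
  le_one : b ≤ 1
  le : ∀ ε : ℝ, 0 < ε → ∀ᶠ n : ℕ in atTop,
    (ℓ n : ℝ) ≤ ε * (n * Real.log n ^ (b + 1) / Real.log (Real.log n))
  prob : ∀ᶠ n : ℕ in atTop, ∀ (w : Fin n → ℕ) (u : Fin n),
    (law D n).real {X | u ∉ succeededBefore (fun v => (w v : ℕ∞)) X (w u + ℓ n + 1)} ≤
      1 / 8 / (n : ℝ) ^ b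

theorem measurableSet_mem_succeededBefore {n : ℕ} (w : Fin n → ℕ∞) (t : ℕ) (u : Fin n) :
    MeasurableSet {X : Bits n | u ∈ succeededBefore w X t} := by
  refine FinDep.measurableSet (T := t) fun X X' hX => ?_
  have := (nonAnticipating_const w).finDep_succeededBefore t X X' hX
  simp only at this
  rw [this]

theorem law_real_not_mem_eq {n : ℕ} (D : LocalClockProtocol) (w : Fin n → ℕ∞) (t : ℕ) (u : Fin n) :
    (law D n).real {X | u ∉ succeededBefore w X t} =
      1 - (law D n).real {X | u ∈ succeededBefore w X t} :=
  probReal_compl_eq_one_sub (measurableSet_mem_succeededBefore w t u)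

section SmallLatency

variable {D : LocalClockProtocol} {b : ℕ} {ℓ : ℕ → ℕ}

theorem SmallLatency.le_log_sq (h : SmallLatency D b ℓ) :
    ∀ᶠ n : ℕ in atTop, (ℓ n : ℝ) ≤ n * Real.log n ^ 2 := by
  filter_upwards [h.le 1 one_pos, tendsto_log_log_nat.eventually_ge_atTop 1,
    tendsto_log_nat.eventually_ge_atTop 1] with n h1 h2 h3
  refine h1.trans ?_
  rw [one_mul]
  have h4 : Real.log n ^ (b + 1) ≤ Real.log n ^ 2 :=
    pow_le_pow_right₀ h3 (by have := h.le_one; omega)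
  calc n * Real.log n ^ (b + 1) / Real.log (Real.log n) ≤ n * Real.log n ^ (b + 1) :=
        div_le_self (by positivity) h2
    _ ≤ _ := by gcongr

/-- With high contention everywhere, the latency is large. -/
theorem SmallLatency.lt_of_nonempty_le (h : SmallLatency D b ℓ) :
    ∀ᶠ n : ℕ in atTop, ∀ (w : Fin n → ℕ) (u : Fin n) (t : ℕ),
      (law D n).real {X | u ∈ succeededBefore (fun v => (w v : ℕ∞)) X t} ≤ 1 / 4 →
      t < w u + ℓ n + 1 := by
  filter_upwards [h.prob, eventually_ge_atTop 1] with n hn hn1 w u t ht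
  by_contra hlt
  have h1 := hn w u
  rw [law_real_not_mem_eq] at h1
  have h2 : (law D n).real {X | u ∈ succeededBefore (fun v => (w v : ℕ∞)) X (w u + ℓ n + 1)} ≤
      (law D n).real {X | u ∈ succeededBefore (fun v => (w v : ℕ∞)) X t} :=
    measureReal_mono fun X hX => succeededBefore_mono _ X (by omega) hX
  have h3 : 1 / 8 / (n : ℝ) ^ b ≤ 1 / 8 :=
    div_le_self (by norm_num) (one_le_pow₀ (by exact_mod_cast hn1))
  linarith

theorem law_real_mem_le_nonempty {n : ℕ} (D : LocalClockProtocol) (w : Fin n → ℕ∞) (t : ℕ)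
    (u : Fin n) : (law D n).real {X | u ∈ succeededBefore w X t} ≤
      (law D n).real {X | (succeededBefore w X t).Nonempty} :=
  measureReal_mono fun _ hX => ⟨u, hX⟩

theorem exists_exp_small {ε : ℝ} (hε : 0 < ε) (A : ℝ) : ∃ c : ℝ, A * Real.exp (-(c / 2)) ≤ ε := by
  have h := ((Real.tendsto_exp_neg_atTop_nhds_zero.comp
    (tendsto_id.atTop_div_const (by norm_num : (0 : ℝ) < 2))).const_mul A)
  rw [mul_zero] at h
  obtain ⟨c, hc⟩ := (h.eventually_le_const hε).exists
  exact ⟨c, hc⟩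

/-- If no bit could ever be set, nobody would succeed. The first possible age is what lets the
groups woken up during the startup block one another. -/
theorem SmallLatency.exists_first_age (h : SmallLatency D b ℓ) :
    ∃ k₀, 0 < bitProb D k₀ ∧ ∀ k < k₀, bitProb D k = 0 := by
  classical
  have hex : ∃ k, 0 < bitProb D k := by
    by_contra hno
    push Not at hno
    have h0 : ∀ k, bitProb D k = 0 := fun k => le_antisymm (hno k) (bitProb_nonneg D k)
    obtain ⟨n, hn, hn1⟩ := (h.lt_of_nonempty_le.and (eventually_ge_atTop 1)).exists
    obtain ⟨c, hc⟩ := exists_exp_small (ε := 1 / 4) (by norm_num) ((0 + ℓ n + 1 : ℕ) * 5)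
    have := hn (fun _ => 0) ⟨0, hn1⟩ (0 + ℓ n + 1)
      ((law_real_mem_le_nonempty _ _ _ _).trans
        ((law_real_succeededBefore_nonempty_le D _ c _ fun s _ => Or.inl fun v => ?_).trans
          (by rw [← mul_assoc]; exact hc)))
    · simp at this
    · unfold rate; split_ifs <;> simp [h0]
  exact ⟨Nat.find hex, Nat.find_spec hex, fun k hk =>
    le_antisymm (not_lt.1 (Nat.find_min hex hk)) (bitProb_nonneg D k)⟩

/-- Groups that are woken up one after the other block each other. -/
theorem startup {n d h k₀ : ℕ} {w : Fin n → ℕ} (hk : ∀ k < k₀, bitProb D k = 0)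
    (hw : ∀ i < d, ∀ k, h * bitProb D k ≤ ∑ v, rate (bitProb D) (fun v => (w v : ℕ∞)) (i + k + 1) v) :
    ∀ s < d + 1, (∀ v, rate (bitProb D) (fun v => (w v : ℕ∞)) s v = 0) ∨
      h * bitProb D k₀ ≤ ∑ v, rate (bitProb D) (fun v => (w v : ℕ∞)) s v := by
  intro s hs
  -- Through slot `k₀` nobody has reached age `k₀`. In each later slot the group woken up `k₀ + 1`
  -- slots earlier is exactly at this age.
  by_cases hsk : s ≤ k₀
  · refine Or.inl fun v => ?_
    rw [rate_natCast]
    split_ifs with hlt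
    · exact hk _ (by omega)
    · rfl
  · right
    obtain ⟨i, rfl⟩ : ∃ i, s = i + k₀ + 1 := ⟨s - k₀ - 1, by omega⟩
    exact hw i (by omega) k₀

/-! ### The mass of the ages in a window -/

/-- The ages in a window at which `p` is at most `n ^ (-1 / j)`. -/
def rareAges (p : ℕ → ℝ) (j n : ℕ) (T l : ℕ) : Finset ℕ :=
  open Classical in (Finset.Ico T l).filter fun k => p k ^ j * n ≤ 1

theorem mem_rareAges {p : ℕ → ℝ} {j n T l k : ℕ} :
    k ∈ rareAges p j n T l ↔ (T ≤ k ∧ k < l) ∧ p k ^ j * n ≤ 1 := by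
  simp [rareAges]

theorem tendsto_root (j : ℝ) (hj : 0 < j) :
    Tendsto (fun n : ℕ => Real.exp (Real.log n / j)) atTop atTop :=
  Real.tendsto_exp_atTop.comp (tendsto_log_nat.atTop_div_const hj)

theorem eventually_pow_le_exp (A : ℝ) (k : ℕ) : ∀ᶠ x : ℝ in atTop, A * x ^ k ≤ Real.exp (x / 2) := by
  have h := (Real.tendsto_pow_mul_exp_neg_atTop_nhds_zero k).comp
    (tendsto_id.atTop_div_const (by norm_num : (0 : ℝ) < 2))
  have h2 := h.const_mul (A * 2 ^ k)
  rw [mul_zero] at h2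
  filter_upwards [h2.eventually_le_const one_pos] with x hx
  simp only [Function.comp, id, Real.exp_neg, div_pow] at hx
  rw [← div_eq_mul_inv, ← mul_div_assoc, div_le_one (Real.exp_pos _)] at hx
  refine le_trans (le_of_eq ?_) hx
  field_simp

/-- Where `p > n ^ (-1/2)`, even `n ^ (3/4)` remaining members of the batch create contention `n ^
(1/4)` and block one another. So a member that has reached age `T` and stays silent at the rare ages
most likely fails up to age `ℓ n`. With `σ` the mass of the rare ages, this silence has probability
at least `exp (-2 σ)`, and the permitted error probability bounds `σ` from below. -/
theorem SmallLatency.window_mass (hD : IsMemoryless D) (h : SmallLatency D b ℓ) :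
    ∀ᶠ n : ℕ in atTop, ∀ (w : Fin n → ℕ) (B : Finset (Fin n)) (s T : ℕ),
      (n : ℝ) / 2 ≤ B.card → (∀ v ∈ B, w v = s) →
      (∀ v ∈ B, (law D n).real {X | v ∈ succeededBefore (fun v => (w v : ℕ∞)) X (s + T + 1)} ≤
        1 / 4) →
      1 / 10 * Real.log n ^ b ≤ ∑ k ∈ rareAges (bitProb D) 2 n T (ℓ n), bitProb D k := by
  classical
  have hexp := ((tendsto_root 4 (by norm_num)).eventually (eventually_pow_le_exp 5 9))
  filter_upwards [h.prob, h.lt_of_nonempty_le, h.le_log_sq, hexp, eventually_mul_log_pow_le 1 2,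
    (tendsto_root 20 (by norm_num)).eventually_ge_atTop 6] with n hprob hlt hlog hexp hsq hr6
    w B s T hcard hB hquarter
  have hn0 : (0 : ℝ) < n := by
    rcases Nat.eq_zero_or_pos n with rfl | hn
    · norm_num at hr6
    · exact_mod_cast hn
  -- `q = n ^ (1/4)` is the contention, and `q ^ 3` the number of silent parties that suffices for
  -- it. `r = n ^ (1/20)` serves the case `b = 1`: there `σ < (log n) / 10` would give `exp (-2 σ) ≥
  -- r ^ (-4)`, against an error of at most `4 / q = 4 * r ^ (-5)`.
  set r := Real.exp (Real.log n / 20) with hr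
  set q := Real.exp (Real.log n / 4) with hq
  have hr0 : 0 < r := Real.exp_pos _
  have hqr : q = r ^ 5 := by rw [hq, hr, ← Real.exp_nat_mul]; congr 1; push_cast; ring
  have hnq : (n : ℝ) = q ^ 4 := by
    rw [hq, ← Real.exp_nat_mul, ← Real.exp_log hn0, Real.log_exp]; congr 1; push_cast; ring
  have hr5 : (6 : ℝ) ^ 5 ≤ r ^ 5 := by gcongr
  have hq1 : 6 ^ 5 ≤ q := hqr ▸ hr5
  have hq0 : 0 < q := by linarith
  have hBpos : 0 < (B.card : ℝ) := by linarith [div_pos hn0 two_pos]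
  obtain ⟨v₀, hv₀⟩ : B.Nonempty := Finset.card_pos.1 (by exact_mod_cast hBpos)
  have hTl : T ≤ ℓ n := by
    have := hlt w v₀ (s + T + 1) (hquarter v₀ hv₀)
    rw [hB v₀ hv₀] at this
    omega
  set K := rareAges (bitProb D) 2 n T (ℓ n)
  set σ := ∑ k ∈ K, bitProb D k
  have hK : K ⊆ Finset.Ico T (ℓ n) := Finset.filter_subset _ _
  have hlarge : ∀ k, T ≤ k → k < ℓ n → k ∉ K → q ≤ q ^ 3 * bitProb D k := by
    intro k h1 h2 h3
    have h4 : ¬ bitProb D k ^ 2 * n ≤ 1 := fun h4 => h3 (mem_rareAges.2 ⟨⟨h1, h2⟩, h4⟩)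
    push Not at h4
    have h5 : 1 < (bitProb D k * q ^ 2) ^ 2 := by rw [hnq] at h4; linarith [h4]
    have h6 : 1 < bitProb D k * q ^ 2 := by
      refine lt_of_pow_lt_pow_left₀ 2 (mul_nonneg (bitProb_nonneg D k) (by positivity)) ?_
      simpa using h5
    nlinarith
  have hmain := sum_law_real_not_mem_ge hD (w := fun v => (w v : ℕ∞)) (B := B) (s := s)
    (fun v hv => by rw [hB v hv]) hTl hK (by positivity : 0 ≤ q ^ 3) hlarge
  have hπ : Real.exp (-(2 * σ)) ≤ ∏ k ∈ K, (1 - bitProb D k) := by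
    rw [Finset.mul_sum, ← Finset.sum_neg_distrib, Real.exp_sum]
    refine Finset.prod_le_prod (fun _ _ => (Real.exp_pos _).le) fun k hk => ?_
    refine exp_neg_two_mul_le (bitProb_nonneg D k) ?_
    have h1 := (mem_rareAges.1 hk).2
    have h2 : (4 : ℝ) ≤ n := by
      rw [hnq]
      calc (4 : ℝ) ≤ (6 ^ 5) ^ 4 := by norm_num
        _ ≤ q ^ 4 := by gcongr
    nlinarith [bitProb_nonneg D k]
  have hleft : (3 / 4 : ℝ) * B.card ≤ ∑ v ∈ B, (law D n).real
      {X | v ∉ succeededBefore (fun v => (w v : ℕ∞)) X (s + T + 1)} := by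
    have := Finset.card_nsmul_le_sum B (fun v => (law D n).real
      {X | v ∉ succeededBefore (fun v => (w v : ℕ∞)) X (s + T + 1)}) (3 / 4) fun v hv => by
        rw [law_real_not_mem_eq]
        linarith [hquarter v hv]
    rw [nsmul_eq_mul] at this
    linarith
  have hright : ∑ v ∈ B, (law D n).real
      {X | v ∉ succeededBefore (fun v => (w v : ℕ∞)) X (s + ℓ n + 1)} ≤
      B.card * (1 / 8 / (n : ℝ) ^ b) := by
    have := Finset.sum_le_card_nsmul B (fun v => (law D n).real
      {X | v ∉ succeededBefore (fun v => (w v : ℕ∞)) X (s + ℓ n + 1)}) (1 / 8 / (n : ℝ) ^ b)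
      fun v hv => by
        have := hprob w v
        rwa [hB v hv] at this
    rwa [nsmul_eq_mul] at this
  have hq3 : q ^ 3 ≤ B.card * (2 / q) := by
    calc q ^ 3 = q ^ 4 / 2 * (2 / q) := by field_simp
      _ ≤ _ := by rw [← hnq]; gcongr
  have hl : ℓ n * (5 * Real.exp (-(q / 2))) ≤ 1 / q := by
    have h1 : (ℓ n : ℝ) ≤ q ^ 8 := by
      calc (ℓ n : ℝ) ≤ n * Real.log n ^ 2 := hlog
        _ ≤ n * n := by gcongr; linarith
        _ = q ^ 8 := by rw [hnq]; ring
    rw [Real.exp_neg, ← div_eq_mul_inv, ← mul_div_assoc, div_le_div_iff₀ (Real.exp_pos _) hq0]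
    calc ℓ n * 5 * q ≤ q ^ 8 * 5 * q := by gcongr
      _ = 5 * q ^ 9 := by ring
      _ ≤ _ := by rw [one_mul]; exact hexp
  have hfin : Real.exp (-(2 * σ)) * (3 / 4) ≤ 1 / 8 / (n : ℝ) ^ b + 2 / q + 1 / q := by
    have h1 : Real.exp (-(2 * σ)) * (3 / 4) * B.card ≤
        (1 / 8 / (n : ℝ) ^ b + 2 / q + 1 / q) * B.card := by
      calc Real.exp (-(2 * σ)) * (3 / 4) * B.card = Real.exp (-(2 * σ)) * (3 / 4 * B.card) := by ring
        _ ≤ (∏ k ∈ K, (1 - bitProb D k)) * ∑ v ∈ B, (law D n).real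
            {X | v ∉ succeededBefore (fun v => (w v : ℕ∞)) X (s + T + 1)} := by
            exact mul_le_mul hπ hleft (mul_nonneg (by norm_num) hBpos.le) ((Real.exp_pos _).le.trans hπ)
        _ ≤ _ := hmain
        _ ≤ B.card * (1 / 8 / (n : ℝ) ^ b) + B.card * (2 / q) + B.card * (1 / q) :=
            add_le_add (add_le_add hright hq3) (mul_le_mul_of_nonneg_left hl hBpos.le)
        _ = _ := by ring
    exact le_of_mul_le_mul_right h1 hBpos
  by_contra hσ
  push Not at hσ
  have hinv : 3 / q ≤ 3 / 6 ^ 5 := by gcongr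
  rcases Nat.le_one_iff_eq_zero_or_eq_one.1 h.le_one with hb | hb
  · rw [hb, pow_zero] at hσ hfin
    have h1 := Real.add_one_le_exp (-(2 * σ))
    have h2 : 2 / q + 1 / q = 3 / q := by ring
    rw [div_one] at hfin
    norm_num at hinv
    linarith
  · rw [hb, pow_one] at hσ hfin
    have h1 : r⁻¹ ^ 4 ≤ Real.exp (-(2 * σ)) := by
      rw [hr, ← Real.exp_neg, ← Real.exp_nat_mul]
      refine Real.exp_le_exp.2 ?_
      push_cast
      linarith
    have h2 : 1 / 8 / (n : ℝ) + 2 / q + 1 / q ≤ 4 * r⁻¹ ^ 5 := by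
      have h3 : (1 : ℝ) / n ≤ 1 / q := by
        rw [hnq]
        refine one_div_le_one_div_of_le hq0 ?_
        exact le_self_pow₀ (by linarith) (by norm_num)
      have h4 : r⁻¹ ^ 5 = 1 / q := by rw [hqr, inv_pow, one_div]
      rw [h4]
      have h5 : 1 / 8 / (n : ℝ) = 1 / 8 * (1 / n) := by ring
      have h6 : 2 / q = 2 * (1 / q) := by ring
      have h7 : 0 < 1 / q := by positivity
      rw [h5, h6]
      linarith
    have h3 : r⁻¹ ^ 5 ≤ 1 / 6 * r⁻¹ ^ 4 := by
      rw [pow_succ, mul_comm]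
      gcongr
      rw [← one_div]
      gcongr
    have h4 : 0 < r⁻¹ ^ 4 := by positivity
    linarith

end SmallLatency

/-! ### A priori bounds for the total mass and for the light mass -/

theorem tendsto_nat_sqrt : Tendsto Nat.sqrt atTop atTop :=
  tendsto_atTop_atTop.2 fun b => ⟨b * b, fun _ h => Nat.le_sqrt.2 h⟩

theorem eventually_mul_log_pow_le_sqrt (c : ℝ) (k : ℕ) :
    ∀ᶠ T : ℕ in atTop, c * Real.log T ^ k ≤ Nat.sqrt T := by
  filter_upwards [eventually_mul_log_pow_le ((c + 1) ^ 2) (2 * k),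
    tendsto_log_nat.eventually_ge_atTop 1] with T hT h1
  have h2 : (1 : ℝ) ≤ Real.log T ^ k := one_le_pow₀ h1
  have h3 : (T : ℝ) < (Nat.sqrt T + 1) ^ 2 := by
    have := Nat.lt_succ_sqrt T
    rw [sq]
    exact_mod_cast this
  have h4 : ((c + 1) * Real.log T ^ k) ^ 2 < (Nat.sqrt T + 1 : ℝ) ^ 2 := by
    refine lt_of_le_of_lt (le_of_eq ?_) (hT.trans_lt h3)
    rw [mul_pow, ← pow_mul, mul_comm k 2]
  have h5 := lt_of_pow_lt_pow_left₀ 2 (by positivity) h4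
  linarith

section SmallLatency

variable {D : LocalClockProtocol} {b : ℕ} {ℓ : ℕ → ℕ}

set_option maxHeartbeats 800000 in
-- With more mass than `log ^ 5 d`, `O(d log ^ 2 d)` parties could keep the contention high for at
-- least `d log ^ 5 d` slots; the startup groups cover the first `d` of them. Probably nobody would
-- succeed in this time, whereas the latency bound for so few parties is only `O(d log ^ 4 d)`.
theorem SmallLatency.sum_bitProb_le (h : SmallLatency D b ℓ) :
    ∀ᶠ d : ℕ in atTop, ∑ k ∈ Finset.range d, bitProb D k ≤ Real.log d ^ 5 := by
  obtain ⟨k₀, hk0, hk⟩ := h.exists_first_age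
  obtain ⟨N, hN⟩ := eventually_atTop.1 (h.lt_of_nonempty_le.and h.le_log_sq)
  filter_upwards [eventually_ge_atTop N, eventually_ge_atTop 100, eventually_mul_log_pow_le 11 2,
    eventually_mul_log_pow_le 3 5, tendsto_log_nat.eventually_ge_atTop 45,
    tendsto_log_nat.eventually_ge_atTop (8 / bitProb D k₀)] with d hdN hd100 hd2 hd5 hlam hlamp
  by_contra hS
  push Not at hS
  set lam := Real.log d with hlamdef
  set S := ∑ k ∈ Finset.range d, bitProb D k
  have hd0 : (0 : ℝ) < d := by exact_mod_cast (by omega : 0 < d)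
  have hd100' : (100 : ℝ) ≤ d := by exact_mod_cast hd100
  have hlam0 : 0 < lam := by linarith
  set h' := ⌈lam ^ 2⌉₊
  set q := ⌈lam ^ 5⌉₊
  set L := d * q with hL
  set m := ⌈4 * L / lam ^ 3⌉₊
  have hh1 : lam ^ 2 ≤ h' := Nat.le_ceil _
  have hh2 : (h' : ℝ) ≤ lam ^ 2 + 1 := (Nat.ceil_lt_add_one (by positivity)).le
  have hq1 : lam ^ 5 ≤ q := Nat.le_ceil _
  have hq2 : (q : ℝ) ≤ lam ^ 5 + 1 := (Nat.ceil_lt_add_one (by positivity)).le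
  have hm1 : 4 * L / lam ^ 3 ≤ m := Nat.le_ceil _
  have hm2 : (m : ℝ) ≤ 4 * L / lam ^ 3 + 1 := (Nat.ceil_lt_add_one (by positivity)).le
  have hone : 1 ≤ lam := by linarith
  have hp2 : 1 ≤ lam ^ 2 := one_le_pow₀ hone
  have hp5 : 1 ≤ lam ^ 5 := one_le_pow₀ hone
  have hLcast : (L : ℝ) = d * q := by rw [hL]; push_cast; ring
  have hLge : d * lam ^ 5 ≤ L := by rw [hLcast]; gcongr
  have hLle : (L : ℝ) + 1 ≤ d ^ 2 := by
    rw [hLcast]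
    have : (q : ℝ) + 1 ≤ d := by linarith
    nlinarith
  have hLpos : 0 < L := by
    have : (0 : ℝ) < L := lt_of_lt_of_le (by positivity) hLge
    exact_mod_cast this
  have hlamd : Real.exp lam = d := Real.exp_log hd0
  have hexp4 : Real.exp (-(4 * lam)) = ((d : ℝ) ^ 4)⁻¹ := by
    rw [Real.exp_neg, ← hlamd, ← Real.exp_nat_mul]; norm_num
  have hexpc : Real.exp (-lam ^ 2) ≤ ((d : ℝ) ^ 4)⁻¹ := by
    rw [← hexp4]; exact Real.exp_le_exp.2 (by nlinarith)
  have hd24 : (d : ℝ) ^ 2 * ((d : ℝ) ^ 4)⁻¹ = ((d : ℝ) ^ 2)⁻¹ := by field_simp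
  have hd2inv : ((d : ℝ) ^ 2)⁻¹ ≤ (100 ^ 2)⁻¹ := by gcongr
  obtain ⟨wJ, hwJ⟩ := exists_wake_contention_ge (f := bitProb D) (bitProb_nonneg D)
    (bitProb_le_one D) (a := d) (L := L) (m := m) hLpos (c := lam ^ 2)
    (by
      calc 4 * lam ^ 2 * L = 4 * L / lam ^ 3 * lam ^ 5 := by field_simp
        _ ≤ m * S := by gcongr)
    (by
      calc (L + 1) * Real.exp (-lam ^ 2) ≤ (d : ℝ) ^ 2 * ((d : ℝ) ^ 4)⁻¹ := by gcongr
        _ ≤ (100 ^ 2)⁻¹ := hd24 ▸ hd2inv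
        _ < 1 := by norm_num)
  obtain ⟨n, hn⟩ : ∃ n, n = d * h' + m + 1 := ⟨_, rfl⟩
  obtain ⟨w, J, B, hBcard, hB, hJ, hG⟩ := exists_wake_groups hn 0 wJ
  obtain ⟨u, hu⟩ := Finset.card_pos.1 (by omega : 0 < B.card)
  have hh'1 : 1 ≤ h' := by
    have : (1 : ℝ) ≤ h' := hp2.trans hh1
    exact_mod_cast this
  have hdn : d ≤ n := by nlinarith
  obtain ⟨hlt, hlog⟩ := hN n (hdN.trans hdn)
  have hrate0 : ∀ t v, 0 ≤ rate (bitProb D) (fun v => (w v : ℕ∞)) t v :=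
    fun t v => rate_nonneg (bitProb_nonneg D) _ _ _
  have hcont : ∀ s < L + 1, (∀ v, rate (bitProb D) (fun v => (w v : ℕ∞)) s v = 0) ∨
      8 * lam ≤ ∑ v, rate (bitProb D) (fun v => (w v : ℕ∞)) s v := by
    intro s hs
    by_cases hsd : s < d + 1
    · refine (startup hk (fun i hi k => hG _ (bitProb_nonneg D) i hi k) s hsd).imp_right fun h1 => ?_
      refine le_trans ?_ h1
      rw [div_le_iff₀ hk0] at hlamp
      calc 8 * lam ≤ lam * bitProb D k₀ * lam := by gcongr
        _ = lam ^ 2 * bitProb D k₀ := by ring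
        _ ≤ h' * bitProb D k₀ := by gcongr
    · right
      have h1 := hwJ s (by omega) (by omega)
      rw [← hJ] at h1
      calc 8 * lam ≤ lam ^ 2 := by nlinarith
        _ ≤ _ := h1
        _ ≤ _ := Finset.sum_le_sum_of_subset_of_nonneg (Finset.subset_univ _)
            fun v _ _ => hrate0 s v
  have hprob := law_real_succeededBefore_nonempty_le D (fun v => (w v : ℕ∞)) (8 * lam) (L + 1) hcont
  have hlatency := hlt w u (L + 1) ((law_real_mem_le_nonempty _ _ _ _).trans (hprob.trans (by
    rw [show 8 * lam / 2 = 4 * lam by ring, hexp4]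
    push_cast
    calc ((L : ℝ) + 1) * (5 * ((d : ℝ) ^ 4)⁻¹) ≤ (d : ℝ) ^ 2 * (5 * ((d : ℝ) ^ 4)⁻¹) := by gcongr
      _ = 5 * ((d : ℝ) ^ 2)⁻¹ := by rw [← hd24]; ring
      _ ≤ 5 * (100 ^ 2)⁻¹ := by gcongr
      _ ≤ 1 / 4 := by norm_num)))
  rw [hB u hu] at hlatency
  have hLl : (L : ℝ) ≤ ℓ n := by exact_mod_cast (by omega : L ≤ ℓ n)
  have hmle : (m : ℝ) ≤ 8 * d * lam ^ 2 + 1 := by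
    refine hm2.trans ?_
    gcongr
    rw [div_le_iff₀ (by positivity), hLcast]
    have : (q : ℝ) ≤ 2 * lam ^ 5 := by linarith
    calc 4 * (d * (q : ℝ)) ≤ 4 * (d * (2 * lam ^ 5)) := by gcongr
      _ = _ := by ring
  have hnle : (n : ℝ) ≤ 11 * lam ^ 2 * d := by
    rw [hn]; push_cast
    have h1 : (d : ℝ) * h' ≤ d * (lam ^ 2 + 1) := by gcongr
    have h2 : (d : ℝ) * 1 ≤ d * lam ^ 2 := by gcongr
    linarith
  have hn0 : (0 : ℝ) < n := lt_of_lt_of_le hd0 (by exact_mod_cast hdn)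
  have hlogn : Real.log n ≤ 2 * lam := by
    rw [show 2 * lam = Real.log ((d : ℝ) ^ 2) by rw [Real.log_pow]; push_cast; rfl]
    refine Real.log_le_log hn0 (hnle.trans ?_)
    rw [sq (d : ℝ)]
    gcongr
  have hlogn0 : 0 ≤ Real.log n := Real.log_natCast_nonneg n
  have : (d : ℝ) * lam ^ 5 ≤ 44 * (d * lam ^ 4) := by
    calc (d : ℝ) * lam ^ 5 ≤ L := hLge
      _ ≤ ℓ n := hLl
      _ ≤ n * Real.log n ^ 2 := hlog
      _ ≤ 11 * lam ^ 2 * d * (2 * lam) ^ 2 := by gcongr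
      _ = _ := by ring
  have h4 : 0 < (d : ℝ) * lam ^ 4 := by positivity
  have h5 : (d : ℝ) * lam ^ 5 = lam * (d * lam ^ 4) := by ring
  nlinarith

/-- The mass of the ages before `d` at which `p` is at most `d ^ (-1 / 8)`. -/
def lightMass (p : ℕ → ℝ) (d : ℕ) : ℝ := ∑ k ∈ rareAges p 8 d 0 d, p k

theorem lightMass_le (D : LocalClockProtocol) (d : ℕ) :
    lightMass (bitProb D) d ≤ ∑ k ∈ Finset.range d, bitProb D k := by
  refine Finset.sum_le_sum_of_subset_of_nonneg (fun k hk => ?_) fun k _ _ => bitProb_nonneg D k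
  exact Finset.mem_range.2 (mem_rareAges.1 hk).1.2

/-- Startup groups with `O(√d log ^ 2 d)` parties hold a batch of the same size back until age `√d`,
and `window_mass` applies with `ℓ n ≤ d`. Since `d ≤ n ^ 2`, an age with `p ^ 2 * n ≤ 1` satisfies
`p ^ 8 * d ≤ 1`. -/
theorem SmallLatency.lightMass_ge (hD : IsMemoryless D) (h : SmallLatency D b ℓ) :
    ∀ᶠ d : ℕ in atTop, 1 / 10 ≤ lightMass (bitProb D) d := by
  obtain ⟨k₀, hk0, hk⟩ := h.exists_first_age
  obtain ⟨N, hN⟩ := eventually_atTop.1 ((h.window_mass hD).and h.le_log_sq)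
  filter_upwards [tendsto_nat_sqrt.eventually_ge_atTop N,
    tendsto_nat_sqrt.eventually_ge_atTop 100, eventually_ge_atTop 100,
    eventually_mul_log_pow_le_sqrt 4 4,
    tendsto_log_nat.eventually_ge_atTop 1,
    tendsto_log_nat.eventually_ge_atTop (8 / bitProb D k₀)] with d hdN hs100 hd100 hd4 hlam hlamp
  set lam := Real.log d with hlamdef
  set a := Nat.sqrt d with ha
  have hd0 : (0 : ℝ) < d := by exact_mod_cast (by omega : 0 < d)
  have ha100 : (100 : ℝ) ≤ a := by exact_mod_cast hs100
  have had : a * a ≤ d := Nat.sqrt_le d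
  have had' : (a : ℝ) * a ≤ d := by exact_mod_cast had
  set h' := ⌈lam ^ 2⌉₊
  have hh1 : lam ^ 2 ≤ h' := Nat.le_ceil _
  have hh2 : (h' : ℝ) ≤ lam ^ 2 + 1 := (Nat.ceil_lt_add_one (by positivity)).le
  have hp2 : 1 ≤ lam ^ 2 := one_le_pow₀ hlam
  have hh'1 : 1 ≤ h' := by
    have : (1 : ℝ) ≤ h' := hp2.trans hh1
    exact_mod_cast this
  obtain ⟨n, hn⟩ : ∃ n, n = a * h' + 0 + a * h' := ⟨_, rfl⟩
  obtain ⟨w, J, B, hBcard, hB, hJ, hG⟩ := exists_wake_groups hn 0 Fin.elim0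
  have han : 2 * a ≤ n := by rw [hn]; nlinarith
  have hncast : (n : ℝ) = 2 * (a * h') := by rw [hn]; push_cast; ring
  obtain ⟨hwin, hlog⟩ := hN n (by omega)
  have hcont := startup (n := n) hk (fun i hi k => hG _ (bitProb_nonneg D) i hi k)
  have hprob := law_real_succeededBefore_nonempty_le D (fun v => (w v : ℕ∞)) _ (a + 1) hcont
  have hlamd : Real.exp lam = d := Real.exp_log hd0
  have hsmall : ((a + 1 : ℕ) : ℝ) * (5 * Real.exp (-(h' * bitProb D k₀ / 2))) ≤ 1 / 4 := by
    have h1 : 8 * lam ≤ h' * bitProb D k₀ := by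
      rw [div_le_iff₀ hk0] at hlamp
      calc 8 * lam ≤ lam * bitProb D k₀ * lam := by gcongr
        _ = lam ^ 2 * bitProb D k₀ := by ring
        _ ≤ h' * bitProb D k₀ := by gcongr
    have h2 : Real.exp (-(h' * bitProb D k₀ / 2)) ≤ (d : ℝ)⁻¹ := by
      rw [← hlamd, ← Real.exp_neg]
      exact Real.exp_le_exp.2 (by linarith)
    calc ((a + 1 : ℕ) : ℝ) * (5 * Real.exp (-(h' * bitProb D k₀ / 2)))
        ≤ (a + 1 : ℕ) * (5 * (d : ℝ)⁻¹) := by gcongr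
      _ = (5 * (a + 1)) / d := by push_cast; field_simp
      _ ≤ 1 / 4 := by
          rw [div_le_iff₀ hd0]
          nlinarith
  have hmass := hwin w B 0 a (by rw [hBcard, hncast]; push_cast; linarith) hB fun v _ => by
    rw [zero_add]
    exact (law_real_mem_le_nonempty _ _ _ _).trans (hprob.trans hsmall)
  have hn1 : 1 ≤ Real.log n := by
    rw [Real.le_log_iff_exp_le (by rw [hncast]; positivity)]
    have h1 := Real.exp_one_lt_three
    have h2 : (2 * a : ℝ) ≤ n := by exact_mod_cast han
    linarith
  have hld : ℓ n ≤ d := by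
    have h1 : (n : ℝ) ≤ 4 * lam ^ 2 * a := by
      rw [hncast]
      have : (a : ℝ) * h' ≤ a * (2 * lam ^ 2) := by gcongr; linarith
      linarith
    have h2 : Real.log n ≤ lam := by
      refine Real.log_le_log (by rw [hncast]; positivity) (h1.trans ?_)
      have : 4 * lam ^ 2 ≤ 4 * lam ^ 4 := by
        gcongr
        · norm_num
      calc 4 * lam ^ 2 * a ≤ a * a := by gcongr; linarith
        _ ≤ d := had'
    have h3 : (ℓ n : ℝ) ≤ d := by
      calc (ℓ n : ℝ) ≤ n * Real.log n ^ 2 := hlog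
        _ ≤ 4 * lam ^ 2 * a * lam ^ 2 := by gcongr
        _ = 4 * lam ^ 4 * a := by ring
        _ ≤ a * a := by gcongr
        _ ≤ d := had'
    exact_mod_cast h3
  refine le_trans ?_ (hmass.trans (Finset.sum_le_sum_of_subset_of_nonneg (fun k hk => ?_)
    fun k _ _ => bitProb_nonneg D k))
  · have : 1 ≤ Real.log n ^ b := one_le_pow₀ hn1
    linarith
  · obtain ⟨⟨-, h2⟩, h3⟩ := mem_rareAges.1 hk
    refine mem_rareAges.2 ⟨⟨Nat.zero_le k, h2.trans_le hld⟩, ?_⟩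
    have h4 : (d : ℝ) ≤ n ^ 2 := by
      have h5 : d < (a + 1) * (a + 1) := Nat.lt_succ_sqrt d
      have h6 : d ≤ n ^ 2 := by nlinarith
      exact_mod_cast h6
    have hp0 := bitProb_nonneg D k
    have hp1 := bitProb_le_one D k
    calc bitProb D k ^ 8 * d ≤ bitProb D k ^ 4 * n ^ 2 :=
          mul_le_mul (pow_le_pow_of_le_one hp0 hp1 (by norm_num)) h4 hd0.le (by positivity)
      _ = (bitProb D k ^ 2 * n) ^ 2 := by ring
      _ ≤ 1 := pow_le_one₀ (by positivity) h3

end SmallLatency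

/-! ### The jammed batch and the mass after age `T` -/

open Classical in
/-- The probabilities at the ages that count for `lightMass`. -/
def lightProb (p : ℕ → ℝ) (d : ℕ) (k : ℕ) : ℝ := if k ∈ rareAges p 8 d 0 d then p k else 0

theorem lightProb_nonneg {p : ℕ → ℝ} (h0 : ∀ k, 0 ≤ p k) (d k : ℕ) : 0 ≤ lightProb p d k := by
  unfold lightProb; split_ifs; exacts [h0 k, le_rfl]

theorem lightProb_le {p : ℕ → ℝ} (h0 : ∀ k, 0 ≤ p k) (d k : ℕ) : lightProb p d k ≤ p k := by
  unfold lightProb; split_ifs; exacts [le_rfl, h0 k]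

theorem lightProb_le_root {p : ℕ → ℝ} {d : ℕ} {ρ : ℝ} (hρ : 0 < ρ)
    (hd : ρ ^ 8 * d = 1) (k : ℕ) : lightProb p d k ≤ ρ := by
  unfold lightProb
  split_ifs with h
  · have h1 := (mem_rareAges.1 h).2
    have hd0 : (0 : ℝ) < d := by
      rcases Nat.eq_zero_or_pos d with rfl | h
      · norm_num at hd
      · exact_mod_cast h
    refine le_of_pow_le_pow_left₀ (n := 8) (by norm_num) hρ.le ?_
    exact le_of_mul_le_mul_right (h1.trans hd.ge) hd0
  · exact hρ.le

theorem sum_lightProb (p : ℕ → ℝ) (d : ℕ) :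
    ∑ k ∈ Finset.range d, lightProb p d k = lightMass p d := by
  unfold lightProb lightMass
  rw [Finset.sum_ite_mem]
  congr 1
  ext k
  simp only [Finset.mem_inter, Finset.mem_range, mem_rareAges]
  tauto

theorem rate_div_const {n : ℕ} (f : ℕ → ℝ) (ρ : ℝ) (w : Fin n → ℕ∞) (t : ℕ) (v : Fin n) :
    rate (fun k => f k / ρ) w t v = rate f w t v / ρ := by
  unfold rate; split_ifs <;> simp

section SmallLatency

variable {D : LocalClockProtocol} {b : ℕ} {ℓ : ℕ → ℕ}

/-- A large batch of parties that probably do not succeed before age `T`. -/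
theorem exists_jammed_batch (hD : IsMemoryless D) {k₀ d h' m n T : ℕ} {c ρ : ℝ}
    (hn : n = d * h' + m + (d * h' + m)) (hd : 0 < d)
    (hk : ∀ k < k₀, bitProb D k = 0) (hρ0 : 0 < ρ) (hρ : ρ ≤ 1 / 2) (hρd : ρ ^ 8 * d = 1)
    (hm : 4 * c * (d + T : ℕ) ≤ m * lightMass (bitProb D) d)
    (hcover : ((d + T : ℕ) + 1) * Real.exp (-(c / ρ)) < 1)
    (hP : Real.exp (-(c / 2)) * ∑ k ∈ Finset.range (d + T), bitProb D k ≤ 1 / 64)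
    (hstart : ((d + 1 : ℕ) : ℝ) * (5 * Real.exp (-(h' * bitProb D k₀ / 2))) ≤ 1 / 16)
    (hjam : ((d + T : ℕ) + 1) * Real.exp (-(c / (4 * ρ))) ≤ 1 / 16) :
    ∃ (w : Fin n → ℕ) (B : Finset (Fin n)), (n : ℝ) / 2 ≤ B.card ∧ (∀ v ∈ B, w v = d) ∧
      ∀ v ∈ B, (law D n).real {X | v ∈ succeededBefore (fun v => (w v : ℕ∞)) X (d + T + 1)} ≤
        1 / 4 := by
  set f := lightProb (bitProb D) d with hf
  have hf0 : ∀ k, 0 ≤ f k := lightProb_nonneg (bitProb_nonneg D) d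
  have hfp : ∀ k, f k ≤ bitProb D k := lightProb_le (bitProb_nonneg D) d
  have hfρ : ∀ k, f k ≤ ρ := lightProb_le_root hρ0 hρd
  -- Dividing by `ρ` makes the light probabilities at most `1` and the required contention `c / ρ`.
  -- This is large enough for the union bound over all slots although `c` itself need not be.
  obtain ⟨wJ, hwJ⟩ := exists_wake_contention_ge (f := fun k => f k / ρ)
    (fun k => div_nonneg (hf0 k) hρ0.le) (fun k => (div_le_one hρ0).2 (hfρ k)) (a := d)
    (L := d + T) (m := m) (by omega) (c := c / ρ)
    (by
      rw [← Finset.sum_div, sum_lightProb]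
      calc 4 * (c / ρ) * (d + T : ℕ) = 4 * c * (d + T : ℕ) / ρ := by ring
        _ ≤ m * lightMass (bitProb D) d / ρ := by gcongr
        _ = _ := by ring) hcover
  obtain ⟨w, J, B, hBcard, hB, hJ, hG⟩ := exists_wake_groups hn d wJ
  refine ⟨w, B, ?_, hB, fun v _ => ?_⟩
  · rw [hBcard, hn]; push_cast; linarith
  have hc : ∀ s, d + 1 ≤ s → s ≤ d + T → c ≤ ∑ v ∈ J, rate f (fun v => (w v : ℕ∞)) s v := by
    intro s h1 h2
    have h3 := hwJ s (by omega) h2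
    rw [← hJ] at h3
    simp only [rate_div_const] at h3
    rw [← Finset.sum_div] at h3
    exact (div_le_div_iff_of_pos_right hρ0).1 h3
  have h1 := law_real_mem_succeededBefore_le hD hf0 hfp hfρ hρ0 hρ hc hP v
  have h2 := law_real_succeededBefore_nonempty_le D (fun v => (w v : ℕ∞)) _ (d + 1)
    (startup (n := n) hk (fun i hi k => hG _ (bitProb_nonneg D) i hi k))
  linarith

theorem half_log_log_le {x y : ℝ} (hy : 4 ≤ y) (hx : y / 2 ≤ x) :
    Real.log y / 2 ≤ Real.log x := by
  have hy0 : 0 < y := by linarith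
  set e := Real.exp (Real.log y / 2) with he
  have he2 : e ^ 2 = y := by
    rw [he, ← Real.exp_nat_mul]
    push_cast
    rw [mul_div_cancel₀ _ (by norm_num), Real.exp_log hy0]
  have he0 : 0 < e := Real.exp_pos _
  rw [Real.le_log_iff_exp_le (by linarith), ← he]
  nlinarith

/-- The bounds on the number of parties that are used for the batch. -/
theorem batch_size_bounds {lam T d h' m S n : ℝ} (hlam : 3 ≤ lam) (hT : lam = Real.log T) (hT0 : 0 < T)
    (hdT : d * d ≤ T) (hTd : T ≤ (d + 1) ^ 2) (hd : 3 * lam ^ 7 ≤ d) (hd2 : 1940 * lam ≤ d)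
    (hh : 0 ≤ h') (hh' : h' ≤ lam ^ 2 + 1) (hS1 : 1 / 10 ≤ S) (hS2 : S ≤ lam ^ 5)
    (hm1 : 4 * (12 * Real.log lam) * (d + T) / S ≤ m)
    (hm2 : m ≤ 4 * (12 * Real.log lam) * (d + T) / S + 1)
    (hn : n = 2 * (d * h' + m)) :
    T ≤ n ^ 2 ∧ d ≤ n ∧ n ≤ 194 * (Real.log lam * T / S) ∧ lam / 2 ≤ Real.log n ∧
      Real.log n ≤ 2 * lam := by
  have hS0 : 0 < S := by linarith
  have hψ1 : 1 ≤ Real.log lam := by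
    rw [Real.le_log_iff_exp_le (by linarith)]
    exact Real.exp_one_lt_three.le.trans hlam
  have hψ2 : Real.log lam ≤ lam := Real.log_le_self (by linarith)
  set ψ := Real.log lam
  have hd0 : 5820 ≤ d := by linarith
  have hdleT : d ≤ T := by nlinarith
  have hlam5 : 1 ≤ lam ^ 5 := one_le_pow₀ (by linarith)
  have hlam57 : lam ^ 5 ≤ lam ^ 7 := pow_le_pow_right₀ (by linarith) (by norm_num)
  have hTS : d ≤ T / S := by
    rw [le_div_iff₀ hS0]
    calc d * S ≤ d * d := by gcongr; linarith
      _ ≤ T := hdT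
  have hX : T / S ≤ ψ * T / S := by
    gcongr
    exact le_mul_of_one_le_left hT0.le hψ1
  have hm3 : 48 * (T / S) ≤ m := by
    refine le_trans ?_ hm1
    rw [← mul_div_assoc]
    refine div_le_div_of_nonneg_right ?_ hS0.le
    calc 48 * T = 48 * (1 * T) := by ring
      _ ≤ 48 * (ψ * (d + T)) := by gcongr; linarith
      _ = _ := by ring
  have hm4 : m ≤ 96 * (ψ * T / S) + 1 := by
    refine hm2.trans ?_
    gcongr
    rw [← mul_div_assoc]
    refine div_le_div_of_nonneg_right ?_ hS0.le
    calc 4 * (12 * ψ) * (d + T) ≤ 4 * (12 * ψ) * (T + T) := by gcongr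
      _ = _ := by ring
  have hdh0 : 0 ≤ d * h' := by positivity
  have hdn : 2 * d ≤ n := by rw [hn]; linarith
  have hdh : d * h' + 1 ≤ ψ * T / S := by
    refine le_trans ?_ hX
    rw [le_div_iff₀ hS0]
    have h1 : h' + 1 ≤ 3 * lam ^ 2 := by nlinarith
    calc (d * h' + 1) * S ≤ (d * (3 * lam ^ 2)) * lam ^ 5 := by
          gcongr
          nlinarith
      _ = d * (3 * lam ^ 7) := by ring
      _ ≤ d * d := by gcongr
      _ ≤ T := hdT
  have hn1 : n ≤ 194 * (ψ * T / S) := by rw [hn]; linarith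
  have hTn : T ≤ n ^ 2 := hTd.trans (by gcongr; linarith)
  have hn0 : 0 < n := by linarith
  refine ⟨hTn, by linarith, hn1, ?_, ?_⟩
  · have := Real.log_le_log hT0 hTn
    rw [Real.log_pow, ← hT] at this
    push_cast at this
    linarith
  · have h1 : n ≤ T ^ 2 := by
      refine hn1.trans ?_
      rw [← mul_div_assoc, div_le_iff₀ hS0]
      calc 194 * (ψ * T) ≤ 194 * (lam * T) := by gcongr
        _ = T * (1940 * lam) * (1 / 10) := by ring
        _ ≤ T * T * S := by gcongr; linarith
        _ = T ^ 2 * S := by ring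
    have := Real.log_le_log hn0 h1
    rw [Real.log_pow, ← hT] at this
    push_cast at this
    exact this

set_option maxHeartbeats 1000000 in
-- Holding a batch back until age `T` takes contention `12 log log T`, hence `n` of order at most `T
-- log log T / S` with `S` the light mass below `√T`. The denominator `log log n` in the assumption
-- on `ℓ` cancels this factor, and `window_mass` places the mass between `T` and `ℓ n`. As `T ≤ n ^
-- 2`, the condition `p ^ 2 * n ≤ 1` becomes `p ^ 4 * T ≤ 1`.
theorem SmallLatency.exists_heavy_window (hD : IsMemoryless D) (h : SmallLatency D b ℓ) {ε : ℝ}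
    (hε : 0 < ε) :
    ∀ᶠ T : ℕ in atTop, ∃ l : ℕ,
      (l : ℝ) ≤ ε * (T * Real.log T ^ (b + 1) / lightMass (bitProb D) (Nat.sqrt T)) ∧
      1 / 20 * Real.log T ^ b ≤ ∑ k ∈ rareAges (bitProb D) 4 T T l, bitProb D k := by
  obtain ⟨k₀, hk0, hk⟩ := h.exists_first_age
  -- `1552 = 194 * 2 * 4`: `194` from `batch_size_bounds`, `2` from `log log n ≥ (log log T) / 2`,
  -- and `4 ≥ 2 ^ (b + 1)` from `log n ≤ 2 log T`.
  obtain ⟨N, hN⟩ := eventually_atTop.1 ((h.window_mass hD).and (h.le (ε / 1552) (by positivity)))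
  obtain ⟨N₂, hN₂⟩ := eventually_atTop.1 h.sum_bitProb_le
  filter_upwards [tendsto_nat_sqrt.eventually_ge_atTop N,
    tendsto_nat_sqrt.eventually_ge_atTop N₂,
    tendsto_nat_sqrt.eventually (h.lightMass_ge hD),
    eventually_mul_log_pow_le_sqrt 3 7,
    eventually_mul_log_pow_le_sqrt (8 ^ 8) 8,
    eventually_mul_log_pow_le_sqrt 1940 1,
    tendsto_log_nat.eventually_ge_atTop 2048,
    tendsto_log_nat.eventually_ge_atTop (8 / bitProb D k₀)] with T hdN hdN₂ hS1 hd7 hd8 hd1 hlam hlamp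
  set lam := Real.log T with hlamdef
  set d := Nat.sqrt T with hd
  set S := lightMass (bitProb D) d
  rw [pow_one] at hd1
  have hT0 : (0 : ℝ) < T := by
    rcases Nat.eq_zero_or_pos T with h0 | h0
    · rw [hlamdef, h0] at hlam; norm_num at hlam
    · exact_mod_cast h0
  have hdbig : (1000 : ℝ) ≤ d := by linarith
  have hd0 : (0 : ℝ) < d := by linarith
  have hdT : (d : ℝ) * d ≤ T := by exact_mod_cast Nat.sqrt_le T
  have hTd : (T : ℝ) ≤ (d + 1) ^ 2 := by
    have h1 : T ≤ (d + 1) ^ 2 := by rw [sq]; exact (Nat.lt_succ_sqrt T).le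
    exact_mod_cast h1
  have hd1000 : 1000 * (d : ℝ) ≤ T := le_trans (by gcongr) hdT
  have hdleT : (d : ℝ) ≤ T := by linarith
  have hT1000 : (1000 : ℝ) ≤ T := hdbig.trans hdleT
  have hTT : 1000 * (T : ℝ) ≤ T ^ 2 := by rw [sq]; gcongr
  have hlam0 : 0 < lam := by linarith
  have hexpT : Real.exp lam = T := Real.exp_log hT0
  have hlogd : Real.log d ≤ lam := Real.log_le_log hd0 hdleT
  have hlogd0 : 0 ≤ Real.log d := Real.log_natCast_nonneg d
  have hS2 : S ≤ lam ^ 5 :=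
    (lightMass_le D d).trans ((hN₂ d hdN₂).trans (by gcongr))
  have hS0 : 0 < S := by linarith
  have hψ1 : 1 ≤ Real.log lam := by
    rw [Real.le_log_iff_exp_le hlam0]
    have := Real.exp_one_lt_three
    linarith
  -- Then `exp (-c / 2) = lam ^ (-6)`, which beats the bound `(2 * lam) ^ 5` for the mass of all
  -- ages below `d + T`.
  set c := 12 * Real.log lam with hc
  set h' := ⌈lam ^ 2⌉₊
  set m := ⌈4 * c * (d + T) / S⌉₊
  have hh1 : lam ^ 2 ≤ h' := Nat.le_ceil _
  have hh2 : (h' : ℝ) ≤ lam ^ 2 + 1 := (Nat.ceil_lt_add_one (by positivity)).le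
  have hm1 : 4 * c * (d + T) / S ≤ m := Nat.le_ceil _
  have hm2 : (m : ℝ) ≤ 4 * c * (d + T) / S + 1 := (Nat.ceil_lt_add_one (by positivity)).le
  obtain ⟨n, hn⟩ : ∃ n, n = d * h' + m + (d * h' + m) := ⟨_, rfl⟩
  have hncast : (n : ℝ) = 2 * (d * h' + m) := by rw [hn]; push_cast; ring
  obtain ⟨hTn, hdn, hn1, hlogn1, hlogn2⟩ := batch_size_bounds (by linarith) hlamdef hT0 hdT hTd hd7
    hd1 (Nat.cast_nonneg _) hh2 hS1 hS2 hm1 hm2 hncast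
  -- `ρ = d ^ (-1/8)` is the threshold for light ages. It is at most `1 / (8 * lam)`, so that `c /
  -- (4 * ρ) ≥ 2 * lam` and the jam fails in a given slot with probability at most `T ^ (-2)`.
  obtain ⟨ρ, hρ0, hρd⟩ : ∃ ρ : ℝ, 0 < ρ ∧ ρ ^ 8 * d = 1 := by
    refine ⟨Real.exp (-(Real.log d / 8)), Real.exp_pos _, ?_⟩
    rw [← Real.exp_nat_mul]
    push_cast
    rw [show (8 : ℝ) * -(Real.log d / 8) = -Real.log d by ring, Real.exp_neg, Real.exp_log hd0]
    exact inv_mul_cancel₀ hd0.ne'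
  have hρlam : ρ * (8 * lam) ≤ 1 := by
    refine le_of_pow_le_pow_left₀ (n := 8) (by norm_num) zero_le_one ?_
    calc (ρ * (8 * lam)) ^ 8 = ρ ^ 8 * (8 ^ 8 * lam ^ 8) := by ring
      _ ≤ ρ ^ 8 * d := by gcongr
      _ = 1 ^ 8 := by rw [hρd, one_pow]
  have hρ : ρ ≤ 1 / 2 := by nlinarith
  have hcρ : 2 * lam ≤ c / (4 * ρ) := by
    rw [le_div_iff₀ (by positivity)]
    linarith
  have hcρ' : 2 * lam ≤ c / ρ := by
    rw [le_div_iff₀ hρ0]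
    linarith
  have hexp2 : Real.exp (-(2 * lam)) = ((T : ℝ) * T)⁻¹ := by
    rw [Real.exp_neg, two_mul, Real.exp_add, hexpT]
  have hLe : ((d + T : ℕ) : ℝ) + 1 ≤ 3 * T := by push_cast; linarith
  have hsmall : 3 * (T : ℝ) * ((T : ℝ) * T)⁻¹ ≤ 1 / 16 := by
    rw [mul_inv, ← mul_assoc, mul_assoc 3, mul_inv_cancel₀ hT0.ne', mul_one, ← div_eq_mul_inv,
      div_le_div_iff₀ hT0 (by norm_num)]
    linarith
  have hbatch := exists_jammed_batch hD (T := T) (c := c) hn (by exact_mod_cast hd0) hk hρ0 hρ hρd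
    (by rw [div_le_iff₀ hS0] at hm1; push_cast; exact hm1)
    (by
      calc (((d + T : ℕ) : ℝ) + 1) * Real.exp (-(c / ρ)) ≤ 3 * T * Real.exp (-(2 * lam)) := by gcongr
        _ ≤ 1 / 16 := by rw [hexp2]; exact hsmall
        _ < 1 := by norm_num)
    (by
      have h1 : Real.exp (-(c / 2)) = (lam ^ 6)⁻¹ := by
        rw [show -(c / 2) = -((6 : ℕ) * Real.log lam) by rw [hc]; push_cast; ring, Real.exp_neg,
          Real.exp_nat_mul, Real.exp_log hlam0]
      have h2 : Real.log (d + T : ℕ) ≤ 2 * lam := by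
        rw [show 2 * lam = Real.log ((T : ℝ) ^ 2) by rw [Real.log_pow]; push_cast; rfl]
        refine Real.log_le_log (by push_cast; positivity) ?_
        push_cast
        linarith
      have h3 := hN₂ (d + T) (by omega)
      rw [h1]
      calc (lam ^ 6)⁻¹ * ∑ k ∈ Finset.range (d + T), bitProb D k ≤ (lam ^ 6)⁻¹ * (2 * lam) ^ 5 := by
            gcongr
            exact h3.trans (pow_le_pow_left₀ (Real.log_natCast_nonneg _) h2 5)
        _ = 32 / lam := by field_simp; ring
        _ ≤ 1 / 64 := by
            rw [div_le_div_iff₀ hlam0 (by norm_num)]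
            linarith)
    (by
      have h1 : 4 * lam ≤ h' * bitProb D k₀ := by
        rw [div_le_iff₀ hk0] at hlamp
        calc 4 * lam ≤ 8 * lam := by linarith
          _ ≤ lam * bitProb D k₀ * lam := by gcongr
          _ = lam ^ 2 * bitProb D k₀ := by ring
          _ ≤ h' * bitProb D k₀ := by gcongr
      calc ((d + 1 : ℕ) : ℝ) * (5 * Real.exp (-(h' * bitProb D k₀ / 2)))
          ≤ (d + 1 : ℕ) * (5 * Real.exp (-(2 * lam))) := by
            gcongr
            linarith
        _ = (d + 1 : ℕ) * 5 * Real.exp (-(2 * lam)) := by ring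
        _ ≤ 3 * T * ((T : ℝ) * T)⁻¹ := by
            rw [hexp2]
            refine mul_le_mul_of_nonneg_right ?_ (by positivity)
            push_cast
            linarith
        _ ≤ 1 / 16 := hsmall)
    (by
      calc (((d + T : ℕ) : ℝ) + 1) * Real.exp (-(c / (4 * ρ))) ≤ 3 * T * Real.exp (-(2 * lam)) := by
            gcongr
        _ ≤ 1 / 16 := by rw [hexp2]; exact hsmall)
  obtain ⟨w, B, hcard, hB, hquarter⟩ := hbatch
  have hdn' : d ≤ n := by exact_mod_cast hdn
  obtain ⟨hwin, hle⟩ := hN n (hdN.trans hdn')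
  have hmass := hwin w B d T hcard hB hquarter
  refine ⟨ℓ n, ?_, ?_⟩
  · have hψn := half_log_log_le (by linarith) hlogn1
    have hlogn0 : 0 ≤ Real.log n := by linarith
    have hb := h.le_one
    calc (ℓ n : ℝ) ≤ ε / 1552 * (n * Real.log n ^ (b + 1) / Real.log (Real.log n)) := hle
      _ ≤ ε / 1552 * (194 * (Real.log lam * T / S) * (2 * lam) ^ (b + 1) / (Real.log lam / 2)) := by
          gcongr
      _ = ε * (T * lam ^ (b + 1) / S) * (2 ^ (b + 1) / 4) := by
          rw [mul_pow]
          have : Real.log lam ≠ 0 := by linarith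
          field_simp
          ring
      _ ≤ ε * (T * lam ^ (b + 1) / S) * 1 := by
          gcongr
          rw [div_le_one (by norm_num)]
          calc (2 : ℝ) ^ (b + 1) ≤ 2 ^ 2 := pow_le_pow_right₀ (by norm_num) (by omega)
            _ = 4 := by norm_num
      _ = _ := mul_one _
  · have h1 : 1 / 2 * lam ^ b ≤ Real.log n ^ b := by
      rcases Nat.le_one_iff_eq_zero_or_eq_one.1 h.le_one with hb | hb
      · rw [hb]; norm_num
      · rw [hb, pow_one, pow_one]; linarith
    refine le_trans (by linarith) (hmass.trans (Finset.sum_le_sum_of_subset_of_nonneg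
      (fun k hk => ?_) fun k _ _ => bitProb_nonneg D k))
    obtain ⟨h2, h3⟩ := mem_rareAges.1 hk
    refine mem_rareAges.2 ⟨h2, ?_⟩
    have hp0 := bitProb_nonneg D k
    calc bitProb D k ^ 4 * T ≤ bitProb D k ^ 4 * n ^ 2 := by gcongr
      _ = (bitProb D k ^ 2 * n) ^ 2 := by ring
      _ ≤ 1 := pow_le_one₀ (by positivity) h3

end SmallLatency

/-! ### The contradiction at a record of the light ratio -/

section SmallLatency

variable {D : LocalClockProtocol} {b : ℕ} {ℓ : ℕ → ℕ}

/-- The latency that is caused by the lack of light mass. -/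
def lightRatio (p : ℕ → ℝ) (b d : ℕ) : ℝ := Real.log d ^ (b + 1) / lightMass p d

/-- A heavy window that starts at `T = d * d` has positive mass, so it ends after `T`. As its end is
at most `ε` times `T log ^ (b + 1) T / S`, with `S` the light mass at `d` and `ε` arbitrary, the
ratio is eventually larger than any constant. -/
theorem SmallLatency.tendsto_lightRatio (hD : IsMemoryless D) (h : SmallLatency D b ℓ) :
    Tendsto (lightRatio (bitProb D) b) atTop atTop := by
  refine tendsto_atTop.2 fun M => ?_
  set M' := max M 1 with hM'
  have hM1 : 1 ≤ M' := le_max_right _ _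
  have hmul : Tendsto (fun d : ℕ => d * d) atTop atTop :=
    tendsto_atTop_mono (fun d => Nat.le_mul_self d) tendsto_id
  filter_upwards [hmul.eventually (h.exists_heavy_window hD (ε := 1 / (4 * M')) (by positivity)),
    h.lightMass_ge hD, tendsto_log_nat.eventually_ge_atTop 1, eventually_ge_atTop 1] with
    d ⟨l, hl, hmass⟩ hS hlog hd1
  rw [Nat.sqrt_eq] at hl
  have hd0 : (0 : ℝ) < d := by exact_mod_cast hd1
  have hlog2 : Real.log ((d * d : ℕ) : ℝ) = 2 * Real.log d := by
    push_cast
    rw [Real.log_mul hd0.ne' hd0.ne']; ring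
  have hlt : d * d < l := by
    by_contra hle
    have : rareAges (bitProb D) 4 (d * d) (d * d) l = ∅ := by
      refine Finset.eq_empty_of_forall_notMem fun k hk => ?_
      have := (mem_rareAges.1 hk).1
      omega
    rw [this, Finset.sum_empty, hlog2] at hmass
    have : 0 < 1 / 20 * (2 * Real.log d) ^ b := by positivity
    linarith
  have hlt' : ((d * d : ℕ) : ℝ) < l := by exact_mod_cast hlt
  have hS0 : 0 < lightMass (bitProb D) d := by linarith
  rw [hlog2] at hl
  have hb := h.le_one
  have h4 : (2 : ℝ) ^ (b + 1) ≤ 4 := by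
    calc (2 : ℝ) ^ (b + 1) ≤ 2 ^ 2 := pow_le_pow_right₀ (by norm_num) (by omega)
      _ = 4 := by norm_num
  have hdd : (0 : ℝ) < ((d * d : ℕ) : ℝ) := by push_cast; positivity
  have h1 : ((d * d : ℕ) : ℝ) * 1 ≤ ((d * d : ℕ) : ℝ) * (lightRatio (bitProb D) b d / M') := by
    calc ((d * d : ℕ) : ℝ) * 1 ≤ l := by rw [mul_one]; exact hlt'.le
      _ ≤ 1 / (4 * M') * (((d * d : ℕ) : ℝ) * (2 * Real.log d) ^ (b + 1) /
          lightMass (bitProb D) d) := hl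
      _ = ((d * d : ℕ) : ℝ) * (lightRatio (bitProb D) b d / M') * (2 ^ (b + 1) / 4) := by
          rw [mul_pow, lightRatio]; field_simp
      _ ≤ ((d * d : ℕ) : ℝ) * (lightRatio (bitProb D) b d / M') * 1 := by
          have : 0 ≤ lightRatio (bitProb D) b d := by unfold lightRatio; positivity
          gcongr
          rw [div_le_one (by norm_num)]
          exact h4
      _ = _ := mul_one _
  have h2 := le_of_mul_le_mul_left h1 hdd
  rw [le_div_iff₀ (by linarith), one_mul] at h2
  exact (le_max_left _ _).trans h2

theorem SmallLatency.exists_heavy_window_lightRatio (hD : IsMemoryless D)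
    (h : SmallLatency D b ℓ) :
    ∀ᶠ T : ℕ in atTop, ∃ l : ℕ, (l : ℝ) ≤ T * lightRatio (bitProb D) b (Nat.sqrt T) ∧
      1 / 20 * Real.log T ^ b ≤ ∑ k ∈ rareAges (bitProb D) 4 T T l, bitProb D k := by
  filter_upwards [h.exists_heavy_window hD (ε := 1 / 9) (by norm_num),
    tendsto_nat_sqrt.eventually (h.lightMass_ge hD),
    tendsto_nat_sqrt.eventually_ge_atTop 4] with T ⟨l, hl, hmass⟩ hS hd4
  refine ⟨l, hl.trans ?_, hmass⟩
  set d := Nat.sqrt T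
  have hS0 : 0 < lightMass (bitProb D) d := by linarith
  have hT : T ≤ d ^ 3 := by
    have h1 : T < (d + 1) * (d + 1) := Nat.lt_succ_sqrt T
    nlinarith [Nat.mul_le_mul hd4 (Nat.mul_le_mul hd4 (le_refl d))]
  have hT0 : 0 < T := by
    rcases Nat.eq_zero_or_pos T with h0 | h0
    · simp [d, h0] at hd4
    · exact h0
  have hlog : Real.log T ≤ 3 * Real.log d := by
    have := Real.log_le_log (by exact_mod_cast hT0) (by exact_mod_cast hT : (T : ℝ) ≤ (d : ℝ) ^ 3)
    rw [Real.log_pow] at this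
    exact_mod_cast this
  have hb := h.le_one
  have hlog0 : 0 ≤ Real.log T := Real.log_natCast_nonneg T
  have hlogd : 0 ≤ Real.log d := Real.log_natCast_nonneg d
  calc 1 / 9 * (T * Real.log T ^ (b + 1) / lightMass (bitProb D) d)
      ≤ 1 / 9 * (T * (3 * Real.log d) ^ (b + 1) / lightMass (bitProb D) d) := by gcongr
    _ = T * lightRatio (bitProb D) b d * (3 ^ (b + 1) / 9) := by
        rw [mul_pow, lightRatio]; ring
    _ ≤ T * lightRatio (bitProb D) b d * 1 := by
        have : 0 ≤ lightRatio (bitProb D) b d := by unfold lightRatio; positivity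
        gcongr
        rw [div_le_one (by norm_num)]
        calc (3 : ℝ) ^ (b + 1) ≤ 3 ^ 2 := pow_le_pow_right₀ (by norm_num) (by omega)
          _ = 9 := by norm_num
    _ = _ := mul_one _

/-- Disjoint windows add up to a large light mass. -/
theorem sum_rareAges_ge {p : ℕ → ℝ} (h0 : ∀ k, 0 ≤ p k) {N T R : ℕ} (hR : 1 ≤ R)
    (hN : N ≤ T * T) {κ : ℝ} {J : ℕ}
    (hwin : ∀ j < J, κ ≤ ∑ k ∈ rareAges p 4 (T * R ^ j) (T * R ^ j) (T * R ^ (j + 1)), p k) :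
    J * κ ≤ ∑ k ∈ rareAges p 8 N 0 (T * R ^ J), p k := by
  classical
  induction J with
  | zero => simpa using Finset.sum_nonneg fun k _ => h0 k
  | succ J ih =>
    have ih := ih fun j hj => hwin j (by omega)
    have hmono : T * R ^ J ≤ T * R ^ (J + 1) :=
      Nat.mul_le_mul le_rfl (Nat.pow_le_pow_right hR (by omega))
    have hTJ : T ≤ T * R ^ J := Nat.le_mul_of_pos_right _ (by positivity)
    have hdisj : Disjoint (rareAges p 8 N 0 (T * R ^ J))
        (rareAges p 4 (T * R ^ J) (T * R ^ J) (T * R ^ (J + 1))) := by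
      refine Finset.disjoint_left.2 fun k h1 h2 => ?_
      have h1 := (mem_rareAges.1 h1).1
      have h2 := (mem_rareAges.1 h2).1
      omega
    have hsub : rareAges p 8 N 0 (T * R ^ J) ∪
        rareAges p 4 (T * R ^ J) (T * R ^ J) (T * R ^ (J + 1)) ⊆
        rareAges p 8 N 0 (T * R ^ (J + 1)) := by
      intro k hk
      rcases Finset.mem_union.1 hk with hk | hk
      · obtain ⟨h1, h2⟩ := mem_rareAges.1 hk
        exact mem_rareAges.2 ⟨⟨h1.1, h1.2.trans_le hmono⟩, h2⟩
      · obtain ⟨h1, h2⟩ := mem_rareAges.1 hk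
        refine mem_rareAges.2 ⟨⟨Nat.zero_le k, h1.2⟩, ?_⟩
        have h3 : (N : ℝ) ≤ ((T * R ^ J : ℕ) : ℝ) ^ 2 := by
          have : N ≤ (T * R ^ J) ^ 2 := by
            rw [sq]
            exact hN.trans (Nat.mul_le_mul hTJ hTJ)
          exact_mod_cast this
        have hp := h0 k
        -- The exponents `4` for windows and `8` for light mass fit together: an age that is rare
        -- for a window starting at `T'` counts as light at `N` whenever `N ≤ T' ^ 2`.
        calc p k ^ 8 * N ≤ p k ^ 8 * ((T * R ^ J : ℕ) : ℝ) ^ 2 := by gcongr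
          _ = (p k ^ 4 * ((T * R ^ J : ℕ) : ℝ)) ^ 2 := by ring
          _ ≤ 1 := pow_le_one₀ (by positivity) h2
    have := Finset.sum_le_sum_of_subset_of_nonneg hsub fun k _ _ => h0 k
    rw [Finset.sum_union hdisj] at this
    have h5 := hwin J (by omega)
    push_cast
    linarith

/-- Between `√N` and `N` there are about `log N / log r` disjoint windows of ratio `r`, where `r` is
the record value at `N`. Each has light mass of order at least `log ^ b N`, but the light mass at
`N` equals `log ^ (b + 1) N / r`. So `r` would be `O(log r)`, while `r` can be chosen arbitrarily
large. -/
theorem not_smallLatency (hD : IsMemoryless D) (h : SmallLatency D b ℓ) : False := by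
  obtain ⟨N₁, hN₁⟩ := eventually_atTop.1 (h.exists_heavy_window_lightRatio hD)
  obtain ⟨N₂, hN₂⟩ := eventually_atTop.1 (((h.lightMass_ge hD).and
    (tendsto_nat_sqrt.eventually (tendsto_nat_sqrt.eventually_ge_atTop N₁))).and
    ((eventually_mul_log_pow_le_sqrt 22 2).and
    ((tendsto_log_nat.eventually_ge_atTop 1).and (eventually_ge_atTop 16))))
  obtain ⟨N₃, hN₃⟩ := eventually_atTop.1 (eventually_mul_log_pow_le 641 1)
  obtain ⟨N₄, hN₄⟩ := eventually_atTop.1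
    ((h.tendsto_lightRatio hD).eventually_ge_atTop (max (N₃ : ℝ) 2))
  -- At a record all earlier ratios are smaller, so every heavy window starting at some large `T <
  -- N` ends by `T * R`, with the same factor `R` for all of them.
  obtain ⟨N, hN, hrec⟩ := Filter.high_scores (h.tendsto_lightRatio hD) (max N₂ N₄)
  obtain ⟨⟨hS, hsqrt⟩, hsq, hlog1, hN16⟩ := hN₂ N ((le_max_left _ _).trans hN)
  have hr := hN₄ N ((le_max_right _ _).trans hN)
  set r := lightRatio (bitProb D) b N with hrdef
  have hr2 : 2 ≤ r := (le_max_right _ _).trans hr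
  have hr3 : (N₃ : ℝ) ≤ r := (le_max_left _ _).trans hr
  set S := lightMass (bitProb D) N with hSdef
  have hS0 : 0 < S := by linarith
  have hrS : r * S = Real.log N ^ (b + 1) := by
    rw [hrdef, lightRatio, div_mul_cancel₀ _ hS0.ne']
  set R := ⌈r⌉₊ with hR
  have hR1 : r ≤ R := Nat.le_ceil r
  have hR2 : (R : ℝ) ≤ r + 1 := (Nat.ceil_lt_add_one (by linarith)).le
  have hR2' : 2 ≤ R := by
    have : (2 : ℝ) ≤ R := hr2.trans hR1
    exact_mod_cast this
  have hRN₃ : N₃ ≤ R := by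
    have : (N₃ : ℝ) ≤ R := hr3.trans hR1
    exact_mod_cast this
  set a := Nat.sqrt N with ha
  have ha4 : 4 ≤ a := Nat.le_sqrt.2 (by omega)
  have haN : a * a ≤ N := Nat.sqrt_le N
  have hNa : N ≤ (a + 1) * (a + 1) := (Nat.lt_succ_sqrt N).le
  have hb := h.le_one
  have hrle : r ≤ 10 * Real.log N ^ 2 := by
    have h1 : Real.log N ^ (b + 1) ≤ Real.log N ^ 2 := pow_le_pow_right₀ hlog1 (by omega)
    have h2 : r * (1 / 10) ≤ r * S := by gcongr
    linarith
  have hRa : 2 * R ≤ a := by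
    have h1 : 1 ≤ Real.log N ^ 2 := one_le_pow₀ hlog1
    have : (2 * R : ℝ) ≤ a := by linarith
    exact_mod_cast this
  have hfit : R * (a + 1) ≤ N := by nlinarith
  -- The number of factors `R` that fit between `a + 1` and `N`. Starting at `a + 1` instead of `a`
  -- ensures `N ≤ (a + 1) ^ 2`, as the thresholds require.
  set J := Nat.log R (N / (a + 1)) with hJ
  have hNa0 : N / (a + 1) ≠ 0 := (Nat.div_pos (by nlinarith) (by omega)).ne'
  have hJ1 : 1 ≤ J := Nat.log_pos (by omega) ((Nat.le_div_iff_mul_le (by omega)).2 hfit)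
  have hJ2 : (a + 1) * R ^ J ≤ N := by
    have := Nat.pow_log_le_self R hNa0
    rw [Nat.le_div_iff_mul_le (by omega)] at this
    rwa [mul_comm]
  have hJ3 : N < (a + 1) * R ^ (J + 1) := by
    have := Nat.lt_pow_succ_log_self (b := R) (by omega) (N / (a + 1))
    rw [Nat.div_lt_iff_lt_mul (by omega)] at this
    rwa [mul_comm]
  have hN0 : (0 : ℝ) < N := by exact_mod_cast (by omega : 0 < N)
  have hlogR0 : 0 < Real.log R := Real.log_pos (by exact_mod_cast (by omega : 1 < R))
  have hwin : ∀ j < J, 1 / 40 * Real.log N ^ b ≤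
      ∑ k ∈ rareAges (bitProb D) 4 ((a + 1) * R ^ j) ((a + 1) * R ^ j) ((a + 1) * R ^ (j + 1)),
        bitProb D k := by
    intro j hj
    have hRj : 1 ≤ R ^ j := Nat.one_le_pow _ _ (by omega)
    have hTa : a + 1 ≤ (a + 1) * R ^ j := Nat.le_mul_of_pos_right _ hRj
    have hTj : (a + 1) * R ^ j < N := by
      refine lt_of_lt_of_le ?_ hJ2
      exact Nat.mul_lt_mul_of_pos_left (Nat.pow_lt_pow_right (by omega) hj) (by omega)
    have hsq1 : N₁ ≤ Nat.sqrt ((a + 1) * R ^ j) := hsqrt.trans (Nat.sqrt_le_sqrt (by omega))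
    obtain ⟨l, hl, hmass⟩ := hN₁ ((a + 1) * R ^ j) (hsq1.trans (Nat.sqrt_le_self _))
    have hlast : l ≤ (a + 1) * R ^ (j + 1) := by
      have h1 : lightRatio (bitProb D) b (Nat.sqrt ((a + 1) * R ^ j)) ≤ R :=
        (hrec _ ((Nat.sqrt_le_self _).trans_lt hTj)).le.trans hR1
      have h2 : (l : ℝ) ≤ (((a + 1) * R ^ j : ℕ) : ℝ) * R := hl.trans (by gcongr)
      rw [pow_succ, ← mul_assoc]
      exact_mod_cast h2
    have hlogT : Real.log N / 2 ≤ Real.log (((a + 1) * R ^ j : ℕ) : ℝ) := by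
      have h1 : (N : ℝ) ≤ (((a + 1) * R ^ j : ℕ) : ℝ) ^ 2 := by
        have : N ≤ ((a + 1) * R ^ j) ^ 2 := by
          rw [sq]; exact hNa.trans (Nat.mul_le_mul hTa hTa)
        exact_mod_cast this
      have h2 := Real.log_le_log hN0 h1
      rw [Real.log_pow] at h2
      norm_num at h2 ⊢
      linarith
    have h1 : 1 / 2 * Real.log N ^ b ≤ Real.log (((a + 1) * R ^ j : ℕ) : ℝ) ^ b := by
      rcases Nat.le_one_iff_eq_zero_or_eq_one.1 hb with hb | hb
      · rw [hb]; norm_num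
      · rw [hb, pow_one, pow_one]; linarith
    refine le_trans (by linarith) (hmass.trans (Finset.sum_le_sum_of_subset_of_nonneg
      (fun k hk => ?_) fun k _ _ => bitProb_nonneg D k))
    obtain ⟨h2, h3⟩ := mem_rareAges.1 hk
    exact mem_rareAges.2 ⟨⟨h2.1, h2.2.trans_le hlast⟩, h3⟩
  have hsum := sum_rareAges_ge (bitProb_nonneg D) (by omega) hNa hwin
  have hSge : J * (1 / 40 * Real.log N ^ b) ≤ S := by
    refine hsum.trans (Finset.sum_le_sum_of_subset_of_nonneg (fun k hk => ?_)
      fun k _ _ => bitProb_nonneg D k)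
    obtain ⟨h2, h3⟩ := mem_rareAges.1 hk
    exact mem_rareAges.2 ⟨⟨h2.1, h2.2.trans_le hJ2⟩, h3⟩
  have hJle : r * J ≤ 40 * Real.log N := by
    have hpos : 0 < Real.log N ^ b := by positivity
    have h1 : r * (J * (1 / 40 * Real.log N ^ b)) ≤ Real.log N ^ b * Real.log N := by
      rw [← pow_succ, ← hrS]
      gcongr
    have h2 : Real.log N ^ b * (r * J) ≤ Real.log N ^ b * (40 * Real.log N) := by linarith
    exact le_of_mul_le_mul_left h2 hpos
  have hlogN : Real.log N ≤ 4 * ((J + 1) * Real.log R) := by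
    have h1 : (N : ℝ) ≤ (a + 1) * (R : ℝ) ^ (J + 1) := by exact_mod_cast hJ3.le
    have h2 := Real.log_le_log hN0 h1
    have ha0 : (0 : ℝ) < a + 1 := by positivity
    have hR0 : (0 : ℝ) < R := by linarith
    rw [Real.log_mul ha0.ne' (by positivity), Real.log_pow] at h2
    have h3 : ((a + 1 : ℕ) : ℝ) ^ 4 ≤ (N : ℝ) ^ 3 := by
      have h4 : (a + 1) * (a + 1) ≤ 4 * N := by nlinarith
      have h5 : (a + 1) ^ 4 ≤ N ^ 3 := by
        calc (a + 1) ^ 4 = ((a + 1) * (a + 1)) * ((a + 1) * (a + 1)) := by ring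
          _ ≤ (4 * N) * (4 * N) := Nat.mul_le_mul h4 h4
          _ = 16 * (N * N) := by ring
          _ ≤ N * (N * N) := Nat.mul_le_mul hN16 le_rfl
          _ = N ^ 3 := by ring
      exact_mod_cast h5
    have h6 := Real.log_le_log (by positivity) h3
    rw [Real.log_pow, Real.log_pow] at h6
    push_cast at h2 h6
    linarith
  have hJ1' : (1 : ℝ) ≤ J := by exact_mod_cast hJ1
  have hfinal : r ≤ 320 * Real.log R := by
    have h1 : r * J ≤ 320 * Real.log R * J := by
      calc r * J ≤ 40 * (4 * ((J + 1) * Real.log R)) := by linarith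
        _ ≤ 40 * (4 * ((J + J) * Real.log R)) := by gcongr
        _ = _ := by ring
    exact le_of_mul_le_mul_right h1 (by linarith)
  have h641 := hN₃ R hRN₃
  rw [pow_one] at h641
  linarith

end SmallLatency

/-! ### Extraction of the hypothesis from the latency metrics -/

theorem smallLatency_of_isLittleO {D : LocalClockProtocol} {b : ℕ} (hb : b ≤ 1) {g : ℕ → ℝ}
    (hg : g =o[atTop] fun n : ℕ => (n : ℝ) * Real.log n ^ (b + 1) / Real.log (Real.log n))
    {C : ℝ} (hC : 0 < C)
    (hprob : ∀ᶠ n : ℕ in atTop, ∀ (w : Fin n → ℕ) (u : Fin n),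
      (law D n).real {X | u ∉ succeededBefore (fun v => (w v : ℕ∞)) X (w u + ⌊C * g n⌋₊ + 1)} ≤
        1 / 8 / (n : ℝ) ^ b) :
    SmallLatency D b fun n => ⌊C * g n⌋₊ := by
  refine ⟨hb, fun ε hε => ?_, hprob⟩
  filter_upwards [hg.def (div_pos hε hC), tendsto_log_log_nat.eventually_ge_atTop 1,
    tendsto_log_nat.eventually_ge_atTop 1] with n hn hll hl
  have hf : 0 ≤ (n : ℝ) * Real.log n ^ (b + 1) / Real.log (Real.log n) := by positivity
  rw [Real.norm_of_nonneg hf] at hn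
  have h1 : C * g n ≤ ε * (n * Real.log n ^ (b + 1) / Real.log (Real.log n)) := by
    calc C * g n ≤ C * ‖g n‖ := by gcongr; exact Real.le_norm_self _
      _ ≤ C * (ε / C * (n * Real.log n ^ (b + 1) / Real.log (Real.log n))) := by gcongr
      _ = _ := by field_simp
  rcases le_total 0 (C * g n) with h0 | h0
  · exact (Nat.floor_le h0).trans h1
  · rw [Nat.floor_of_nonpos h0]
    push_cast
    positivity

/-- The case `b = 1`: for `n ≥ 8` the error `n ^ (-2)` is at most `1 / (8 n)`, and this weaker bound
is enough. -/
theorem not_isLittleO_whpLatency (D : LocalClockProtocol) (hD : IsMemoryless D) :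
    ¬ IsLittleOLatency (whpLatency obliviousWake D)
      (fun n : ℕ => (n : ℝ) * Real.log n ^ 2 / Real.log (Real.log n)) := by
  rintro ⟨g, hg, hle⟩
  refine not_smallLatency hD (smallLatency_of_isLittleO (b := 1) le_rfl hg one_pos ?_)
  filter_upwards [hle, eventually_ge_atTop 8] with n hn hn8 w u
  rw [one_mul]
  set l := latencyBound obliviousWake D n (((n : ℝ≥0∞) ^ 2)⁻¹) with hl
  have hmem : l ∈ {l : ℕ∞ | ∀ (A : ObliviousAdversary n) (u : Fin n),
      1 - ((n : ℝ≥0∞) ^ 2)⁻¹ ≤ law D n {X | latency (obliviousWake n A X) X u ≤ l}} :=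
    csInf_mem ⟨⊤, fun A u => by simp⟩
  have hlg : (l : ℝ≥0∞) ≤ ENNReal.ofReal (g n) := hn
  have hlfloor : l ≤ (⌊g n⌋₊ : ℕ∞) := by
    have htop : l ≠ ⊤ := by
      rintro h
      rw [h] at hlg
      simp at hlg
    obtain ⟨l', hl'⟩ := ENat.ne_top_iff_exists.1 htop
    rw [← hl'] at hlg ⊢
    rcases eq_or_ne l' 0 with h0 | h0
    · rw [h0]; exact_mod_cast Nat.zero_le _
    · rw [ENat.toENNReal_coe, ENNReal.natCast_le_ofReal h0] at hlg
      exact_mod_cast Nat.le_floor hlg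
  have h1 := hmem w u
  have hset : {X | latency (obliviousWake n w X) X u ≤ l} ⊆
      {X | u ∈ succeededBefore (fun v => (w v : ℕ∞)) X (w u + ⌊g n⌋₊ + 1)} := by
    intro X hX
    exact (latency_le_iff (w := fun v => (w v : ℕ∞)) rfl _).1 (le_trans hX hlfloor)
  have h2 := h1.trans (measure_mono hset)
  rw [law_real_not_mem_eq]
  have hn0 : (0 : ℝ) < n := by exact_mod_cast (by omega : 0 < n)
  have h3 : 1 - ((n : ℝ) ^ 2)⁻¹ ≤ (law D n).real
      {X | u ∈ succeededBefore (fun v => (w v : ℕ∞)) X (w u + ⌊g n⌋₊ + 1)} := by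
    have h4 := ENNReal.toReal_mono (measure_ne_top _ _) h2
    rw [ENNReal.toReal_sub_of_le _ ENNReal.one_ne_top] at h4
    · simpa [Measure.real] using h4
    · rw [ENNReal.inv_le_one]
      exact one_le_pow₀ (by exact_mod_cast (by omega : 1 ≤ n))
  have h5 : ((n : ℝ) ^ 2)⁻¹ ≤ 1 / 8 / (n : ℝ) ^ 1 := by
    rw [pow_one, div_div, inv_eq_one_div, sq]
    have : (8 : ℝ) ≤ n := by exact_mod_cast hn8
    gcongr
  linarith

/-- The case `b = 0`: by Markov's inequality the latency exceeds `8 * g n` with probability at most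
`1/8`. -/
theorem not_isLittleO_expLatency (D : LocalClockProtocol) (hD : IsMemoryless D) :
    ¬ IsLittleOLatency (expLatency obliviousWake D)
      (fun n : ℕ => (n : ℝ) * Real.log n / Real.log (Real.log n)) := by
  rintro ⟨g, hg, hle⟩
  refine not_smallLatency hD (smallLatency_of_isLittleO (b := 0) (C := 8) zero_le_one
    (by simpa using hg) (by norm_num) ?_)
  filter_upwards [hle] with n hn w u
  set A := {X : Bits n | u ∉ succeededBefore (fun v => (w v : ℕ∞)) X (w u + ⌊8 * g n⌋₊ + 1)} with hA
  have hAm : MeasurableSet A := 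
    (measurableSet_mem_succeededBefore (fun v => (w v : ℕ∞)) (w u + ⌊8 * g n⌋₊ + 1) u).compl
  have h1 : ((⌊8 * g n⌋₊ + 1 : ℕ) : ℝ≥0∞) * law D n A ≤ ENNReal.ofReal (g n) := by
    rw [← lintegral_indicator_const hAm]
    refine le_trans (lintegral_mono fun X => ?_) (le_trans (le_iSup₂
      (f := fun (w : ObliviousAdversary n) (u : Fin n) =>
        ∫⁻ X, (latency (obliviousWake n w X) X u : ℝ≥0∞) ∂(law D n)) w u) hn)
    by_cases hX : X ∈ A
    · rw [Set.indicator_of_mem hX]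
      have h2 : ¬ latency (obliviousWake n w X) X u ≤ (⌊8 * g n⌋₊ : ℕ∞) := fun h =>
        hX ((latency_le_iff (w := fun v => (w v : ℕ∞)) rfl _).1 h)
      have h3 : ((⌊8 * g n⌋₊ + 1 : ℕ) : ℕ∞) ≤ latency (obliviousWake n w X) X u := by
        push_cast
        exact Order.add_one_le_of_lt (not_le.1 h2)
      have h4 := ENat.toENNReal_le.2 h3
      rwa [ENat.toENNReal_coe] at h4
    · rw [Set.indicator_of_notMem hX]
      exact zero_le
  have h2 := ENNReal.toReal_mono ENNReal.ofReal_ne_top h1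
  rw [ENNReal.toReal_mul, ENNReal.toReal_natCast, ENNReal.toReal_ofReal'] at h2
  have h3 := Nat.lt_floor_add_one (8 * g n)
  have h4 : max (g n) 0 ≤ ((⌊8 * g n⌋₊ + 1 : ℕ) : ℝ) * (1 / 8) := by
    push_cast
    exact max_le (by linarith) (by positivity)
  rw [pow_zero, div_one]
  exact le_of_mul_le_mul_left (h2.trans h4) (by positivity)

end

end ContentionResolution

open ContentionResolution in
theorem mainTheorem1 :
    (∃ D : LocalClockProtocol, IsMemoryless D ∧
      IsBigOLatency (whpLatency adaptiveWake D)
        (fun n : ℕ => (n : ℝ) * Real.log n ^ 2 / Real.log (Real.log n))) ∧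
    (∃ D : LocalClockProtocol, IsMemoryless D ∧
      IsBigOLatency (expLatency adaptiveWake D)
        (fun n : ℕ => (n : ℝ) * Real.log n / Real.log (Real.log n))) ∧
    (∀ D : LocalClockProtocol, IsMemoryless D →
      ¬ IsLittleOLatency (whpLatency obliviousWake D)
        (fun n : ℕ => (n : ℝ) * Real.log n ^ 2 / Real.log (Real.log n))) ∧
    (∀ D : LocalClockProtocol, IsMemoryless D →
      ¬ IsLittleOLatency (expLatency obliviousWake D)
        (fun n : ℕ => (n : ℝ) * Real.log n / Real.log (Real.log n))) := by
  exact ⟨exists_whpLatency, exists_expLatency, not_isLittleO_whpLatency, not_isLittleO_expLatency⟩
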